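/- **Conventions.** Words have positive integer letters; $s_i=(i\ i{+}1)$, and a word $w=w_1\cdots w_m$ is *reduced* (for $\sigma=s_{w_1}\cdots s_{w_m}$) if no shorter word has the same product. An inversion of $\sigma=\sigma_1\sigma_2\cdots$ is a pair of positions $i<j$ with $\sigma_i>\sigma_j$; a descent is an inversion $(i,i+1)$. The letter $w_l$ *swaps* the two values that stand at positions $w_l,w_l+1$ in $s_{w_1}\cdots s_{w_{l-1}}$. *Tab.* A *Grassmannian word* is a reduced word of a permutation $a_1\cdots a_k b_1 b_2\cdots$ with exactly one descent, at $k$. Its tableau $\mathrm{Tab}(w)$ has rows indexed by $a_k,\dots,a_1$ and columns indexed by $b_1,b_2,\dots$, with entry $m+1-l$ in row $a_i$ and column $b_j$ if $w_l$ swaps $a_i$ and $b_j$ (empty rows and columns are dropped). *Little bump.* Let $w$ be reduced and such that omitting $w_i$ leaves a reduced word. To *decrement at $i$* means to replace $w_i$ by $w_i-1$ if $w_i>1$, and to increase every other letter by $1$ if $w_i=1$. The Little bump $w{\uparrow_i}$ decrements at $i$; while the resulting word is not reduced, it decrements at the index $j$ different from the index just decremented whose letter swaps the same two values; it stops at the first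 reduced word. *Little map.* $\mathrm{LS}(w)=\mathrm{Tab}(w)$ if $w$ is Grassmannian; otherwise $\mathrm{LS}(w)=\mathrm{LS}(w{\uparrow_i})$, where $w_i$ swaps $\sigma_r$ and $\sigma_s$ for the lexicographically last inversion $(r,s)$ of the permutation $\sigma$ of $w$. **Theorem.** Let $n\ge1$. 1. For $\sigma=\sigma_1\cdots\sigma_n\in S_n$ let $w(\sigma)=(2\sigma_n-1)(2\sigma_{n-1}-1)\cdots(2\sigma_1-1)$, and let $(P'(\sigma),Q'(\sigma))$ be the insertion and recording tableaux of Robinson–Schensted (row) insertion applied to $\sigma$. Then $w(\sigma)$ is a reduced word, the procedure defining $\mathrm{LS}$ terminates on $w(\sigma)$ and on $w(\sigma^{-1})$ with a uniquely determined output, and $$\mathrm{LS}(w(\sigma))=Q'(\sigma),\qquad \mathrm{LS}(w(\sigma^{-1}))=P'(\sigma).$$ 2. (RSK.) Let $\binom{u_1\ \cdots\ u_n}{v_1\ \cdots\ v_n}$ be a two-line array of natural numbers whose columns are in weakly increasing lexicographic order, and let $\sigma\in S_n$ be the standardization of $v$, i.e. $\sigma_i<\sigma_j$ if and only if $v_i<v_j$,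 or $v_i=v_j$ and $i<j$. Then the RSK insertion tableau of the array is obtained from $\mathrm{LS}(w(\sigma^{-1}))$ by replacing each entry $k$ by $v_{\sigma^{-1}(k)}$, and the RSK recording tableau is obtained from $\mathrm{LS}(w(\sigma))$ by replacing each entry $k$ by $u_k$. -/

import Mathlib

namespace LittleRS

/-- A tableau, as the list of its rows from top to bottom (each row from left to right). -/
abbrev Tableau := List (List ℕ)

/-! ### Reduced words -/

/-- The product `s_{w_1} s_{w_2} ⋯ s_{w_m}`, where `s_i` is the transposition `(i i+1)`.
Permutations of `{1, …, N}` are viewed as permutations of `ℕ` that fix everything else;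
the one-line notation of `σ` is `σ 1, σ 2, …`. -/
def wordPerm (w : List ℕ) : Equiv.Perm ℕ :=
  (w.map fun i => Equiv.swap i (i + 1)).prod

/-- `w` is a reduced word: its letters are positive, and it is of minimal length among the words
with the same product. -/
def IsReduced (w : List ℕ) : Prop :=
  (∀ a ∈ w, 0 < a) ∧
    ∀ v : List ℕ, (∀ a ∈ v, 0 < a) → wordPerm v = wordPerm w → w.length ≤ v.length

/-- `(i, j)` is an inversion of `σ` (a pair of positions). -/
def IsInversion (σ : Equiv.Perm ℕ) (i j : ℕ) : Prop :=
  0 < i ∧ i < j ∧ σ j < σ i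

/-- `(i, j)` is the lexicographically last inversion of `σ`. -/
def IsLastInversion (σ : Equiv.Perm ℕ) (i j : ℕ) : Prop :=
  IsInversion σ i j ∧ ∀ i' j', IsInversion σ i' j' → i' < i ∨ (i' = i ∧ j' ≤ j)

/-- A descent of `σ` is an inversion of the form `(k, k + 1)`. -/
def IsDescent (σ : Equiv.Perm ℕ) (k : ℕ) : Prop :=
  IsInversion σ k (k + 1)

/-- `w` is a Grassmannian word whose permutation has `k` as its only descent. -/
def IsGrassmannianAt (w : List ℕ) (k : ℕ) : Prop :=
  IsReduced w ∧ ∀ i, IsDescent (wordPerm w) i ↔ i = k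

/-- `w` is a Grassmannian word: a reduced word of a permutation with exactly one descent. -/
def IsGrassmannian (w : List ℕ) : Prop :=
  ∃ k, IsGrassmannianAt w k

/-- The two values (wires) that the letter with index `l` (counted from `0`) swaps: multiplying
`τ = s_{w_1} ⋯ s_{w_{l}}` by the next generator `s_c` on the right exchanges the values at the
positions `c` and `c + 1` in the one-line notation of `τ`.
Only meaningful for `l < w.length`. -/
def swapped (w : List ℕ) (l : ℕ) : Sym2 ℕ :=
  s(wordPerm (w.take l) (w.getD l 0), wordPerm (w.take l) (w.getD l 0 + 1))

/-- The letter with index `l` swaps the values `x` and `y`. -/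
def SwapsAt (w : List ℕ) (l x y : ℕ) : Prop :=
  l < w.length ∧ swapped w l = s(x, y)

/-- The tableau `Tab(w)` of a Grassmannian word `w = w_1 ⋯ w_m` of
`σ = a_1 ⋯ a_k b_1 b_2 ⋯` with descent at `k`. Rows are indexed by `a_k, a_{k-1}, …, a_1`, columns
by `b_1, b_2, …`, and the entry in row `a` and column `b` is `m + 1 - l` if `w_l` (counted from `1`)
swaps `a` and `b`. The `b`'s that are swapped with a given `a` are an initial segment of
`b_1, b_2, …`, and the `a`'s not swapped at all are fixed points `a_1, a_2, …`, whose empty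
rows are dropped. -/
def tab (w : List ℕ) (k : ℕ) : Tableau :=
  ((List.range k).map fun p =>
    (List.range (w.foldr max 0 + 1)).filterMap fun q =>
      ((List.range w.length).find? fun l =>
        swapped w l = s(wordPerm w (k - p), wordPerm w (k + 1 + q))).map
          fun l => w.length - l).filter fun row => row ≠ []

/-! ### Little bumps and the Little map -/

/-- The word `w^{(i-)}`: decrement the letter with index `i` (counted from `0`) if it is larger
than `1`; otherwise keep it and increment all the other letters. -/
def decr (w : List ℕ) (i : ℕ) : List ℕ :=
  if 1 < w.getD i 0 then w.mapIdx fun j a => if j = i then a - 1 else a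
  else w.mapIdx fun j a => if j = i then a else a + 1

/-- The process of a bump: decrement at `i`; stop when the word is reduced; otherwise continue
at the index `j ≠ i` whose letter swaps the same values as the letter at `i`. -/
inductive BumpRun : List ℕ → ℕ → List ℕ → Prop
  | halt (w : List ℕ) (i : ℕ) (h : IsReduced (decr w i)) : BumpRun w i (decr w i)
  | push (w : List ℕ) (i j : ℕ) (v : List ℕ) (h : ¬ IsReduced (decr w i))
      (hj : j < w.length) (hij : j ≠ i) (hs : swapped (decr w i) j = swapped (decr w i) i)
      (hv : BumpRun (decr w i) j v) : BumpRun w i v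

/-- `v = w↑_i`: the word `v` is the result of the Little bump on `w` that begins at index `i`,
where `w` and the word obtained by omitting that letter are reduced. -/
def LittleBump (w : List ℕ) (i : ℕ) (v : List ℕ) : Prop :=
  i < w.length ∧ IsReduced w ∧ IsReduced (w.eraseIdx i) ∧ BumpRun w i v

/-- The Little map, as the relation "the procedure started at `w` terminates with output `T`":
output `Tab(w)` if `w` is a Grassmannian word, and otherwise perform the Little bump that begins
where the values of the last inversion of the permutation are swapped, and continue. -/
inductive LS : List ℕ → Tableau → Prop
  | grassmannian (w : List ℕ) (k : ℕ) (h : IsGrassmannianAt w k) : LS w (tab w k)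
  | bump (w : List ℕ) (r s i : ℕ) (v : List ℕ) (T : Tableau) (h : ¬ IsGrassmannian w)
      (hrs : IsLastInversion (wordPerm w) r s)
      (hi : SwapsAt w i (wordPerm w r) (wordPerm w s))
      (hv : LittleBump w i v) (hT : LS v T) : LS w T

/-! ### The Robinson–Schensted(–Knuth) correspondence -/

/-- Row insertion of `x`: `x` replaces the first entry larger than it, which is returned, or is
appended to the row if there is none. -/
def insertRow (x : ℕ) : List ℕ → List ℕ × Option ℕ
  | [] => ([x], none)
  | y :: R => if x < y then (x :: R, some y) else (y :: (insertRow x R).1, (insertRow x R).2)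

/-- Schensted insertion of `x` into a tableau: the new tableau, and the index (from `0`) of the row
in which it has a new box. -/
def insertTableau (x : ℕ) : Tableau → Tableau × ℕ
  | [] => ([[x]], 0)
  | R :: T =>
    match insertRow x R with
    | (R', none) => (R' :: T, 0)
    | (R', some y) => (R' :: (insertTableau y T).1, (insertTableau y T).2 + 1)

/-- Add a box with entry `a` at the end of the row with index `i`. -/
def addBox (a : ℕ) : ℕ → Tableau → Tableau
  | _, [] => [[a]]
  | 0, R :: T => (R ++ [a]) :: T
  | i + 1, R :: T => R :: addBox a i T

/-- The RSK algorithm on the two-line array with top row `u` and bottom row `v`: the bottom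
entries are inserted from left to right, and the new box is labelled with the top entry. The
result is the pair (insertion tableau, recording tableau). -/
def rsk {n : ℕ} (u v : Fin n → ℕ) : Tableau × Tableau :=
  (List.ofFn fun i => (u i, v i)).foldl
    (fun PQ a => ((insertTableau a.2 PQ.1).1, addBox a.1 (insertTableau a.2 PQ.1).2 PQ.2)) ([], [])

/-- The one-line notation `σ_1, …, σ_n` of a permutation, with values in `{1, …, n}`. -/
def oneLine {n : ℕ} (σ : Equiv.Perm (Fin n)) (i : Fin n) : ℕ := (σ i : ℕ) + 1

/-- Robinson–Schensted: the pair (insertion tableau `P'(σ)`, recording tableau `Q'(σ)`). -/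
def rs {n : ℕ} (σ : Equiv.Perm (Fin n)) : Tableau × Tableau :=
  rsk (fun i => (i : ℕ) + 1) (oneLine σ)

/-- The word `w(σ) = (2σ_n - 1) ⋯ (2σ_1 - 1)`. -/
def rsWord {n : ℕ} (σ : Equiv.Perm (Fin n)) : List ℕ :=
  (List.ofFn fun i => 2 * oneLine σ i - 1).reverse

/-- The standardization of a sequence `v`: the permutation `σ` with `σ i < σ j` if and only if
`v i < v j`, or `v i = v j` and `i < j`. -/
def standardization {n : ℕ} (v : Fin n → ℕ) : Equiv.Perm (Fin n) := (Tuple.sort v)⁻¹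

/-- `standardization` has its defining property. -/
theorem standardization_lt_iff {n : ℕ} (v : Fin n → ℕ) (i j : Fin n) :
    standardization v i < standardization v j ↔ v i < v j ∨ (v i = v j ∧ i < j) := by
  have h : ∀ k, standardization v k = (Tuple.graphEquiv₂ v).symm (Tuple.graphEquiv₁ v k) :=
    fun k => rfl
  rw [h, h, OrderIso.lt_iff_lt]
  exact Prod.Lex.toLex_lt_toLex

/-- Replace each entry `k ∈ {1, …, n}` of a tableau by `f_k`. -/
def relabel {n : ℕ} (f : Fin n → ℕ) (T : Tableau) : Tableau :=
  T.map fun row => row.map fun k => (List.ofFn f).getD (k - 1) 0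

end LittleRS

/-!
The Little map turns a reduced word into a Grassmannian word by a sequence of bumps, and the tableau
of the Grassmannian word is read off from its wiring diagram. The proof follows the shape of this
tableau while letters are removed from the front of the word, and compares it with the growth of
the Robinson–Schensted insertion tableau.

A bump moves through words with one doubled crossing. For this reason words are treated over `ℤ`
and with holes (`ZWord`): a shift of all letters, which is what happens when the letter `1` is
decremented, then is only a change of the offset in `ofList`. A word is reduced if and only if no
two wires cross twice (`isReduced_iff`). Two properties of bumps carry the argument:

* a bump preserves ascents and descents of the word (`Bump.sameDescents`);
* bumps commute with Coxeter–Knuth moves: if two words differ by such a move in a window, then so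
  do the results of corresponding bumps (`Bump.ck`).

Let `v` be a Grassmannian word reached from `w(σ)`, and let `λ` be the partition that the last `j`
letters of `v` contribute to the shape of `Tab(v)` (`sh`). A factor of `v` with decreasing letters
contributes a horizontal strip, one with increasing letters a vertical strip. If the last `j`
letters begin with `t` decreasing factors, their total length is therefore at most the size of the
first `t` rows of `λ`; if they end with `t` increasing factors, the total length of these is at most
the size of the first `t` columns (`Gr.sum_le_of_decreasing_blocks`,
`Gr.sum_le_of_increasing_blocks`). On the other hand `σ_1 ⋯ σ_j` is Knuth equivalent to the row and
to the column reading word of its insertion tableau `P_j` (`knuth_rowWord`, `knuth_colWord`), and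
these words consist of monotone factors that are the rows or the columns of `P_j`. A Knuth move on
`σ_1 ⋯ σ_j` is a Coxeter–Knuth move among the last `j` letters of `w(σ)`; carried along the bumps,
it does not change `λ`. As descents are preserved, the first `t` rows and the first `t` columns of
`P_j` are not larger than those of `λ`. If the two shapes agree for `j - 1` letters, both grow by
one box with the next one, and these bounds force the two boxes to be in the same row
(`box_eq_of_dominance`). By induction `Tab(v)` is the recording tableau (`Chain.tabFrom_eq`),
whichever bumps led to `v`.

Termination of the Little map is `exists_LS`. The statement on `σ⁻¹` is the symmetry
`Q'(σ⁻¹) = P'(σ)`, proved by the symmetric local rule of growth diagrams (`growth_flip`, `grows`).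
The statement on RSK holds because row insertion commutes with the relabelling that undoes the
standardization (`insertTableau_map`).
-/

namespace LittleRS

/-! ### Words over `ℤ` with holes -/

/-- A word whose letters are integers. The value `none` is a hole: it acts as the identity. Only
the letters with index below a given length matter. -/
abbrev ZWord := ℕ → Option ℤ

/-- The generator of a letter: an adjacent transposition, or the identity for a hole. -/
def gen : Option ℤ → Equiv.Perm ℤ
  | none => 1
  | some c => Equiv.swap c (c + 1)

/-- The product of the first `l` letters. -/
def pre (w : ZWord) : ℕ → Equiv.Perm ℤ
  | 0 => 1
  | l + 1 => pre w l * gen (w l)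

/-- The position of the wire (that is, value) `x` after the first `l` letters. -/
def pos (w : ZWord) (l : ℕ) (x : ℤ) : ℤ := (pre w l)⁻¹ x

/-- The letter with index `l` swaps the wires `x` and `y`. -/
def Cross (w : ZWord) (l : ℕ) (x y : ℤ) : Prop :=
  ∃ c, w l = some c ∧
    ((pos w l x = c ∧ pos w l y = c + 1) ∨ (pos w l x = c + 1 ∧ pos w l y = c))

/-- No two wires cross twice among the first `m` letters. -/
def Red (w : ZWord) (m : ℕ) : Prop :=
  ∀ i j, i < j → j < m → ∀ x y, Cross w i x y → ¬ Cross w j x y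

/-- The number of letters, not counting holes. -/
def cnt (w : ZWord) (m : ℕ) : ℕ := ((Finset.range m).filter fun l => w l ≠ none).card

theorem gen_some_apply (c y : ℤ) :
    gen (some c) y = if y = c then c + 1 else if y = c + 1 then c else y := by
  simp [gen, Equiv.swap_apply_def]

theorem gen_inv (a : Option ℤ) : (gen a)⁻¹ = gen a := by
  cases a <;> simp [gen]

@[simp] theorem pos_zero (w : ZWord) (x : ℤ) : pos w 0 x = x := by simp [pos, pre]

theorem pos_succ (w : ZWord) (l : ℕ) (x : ℤ) : pos w (l + 1) x = gen (w l) (pos w l x) := by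
  simp [pos, pre, gen_inv, mul_inv_rev]

theorem pos_succ_some {w : ZWord} {l : ℕ} {c : ℤ} (h : w l = some c) (x : ℤ) :
    pos w (l + 1) x = if pos w l x = c then c + 1 else
      if pos w l x = c + 1 then c else pos w l x := by
  rw [pos_succ, h, gen_some_apply]

theorem pos_succ_none {w : ZWord} {l : ℕ} (h : w l = none) (x : ℤ) :
    pos w (l + 1) x = pos w l x := by
  rw [pos_succ, h]; rfl

theorem pos_injective (w : ZWord) (l : ℕ) : Function.Injective (pos w l) :=
  (pre w l)⁻¹.injective

@[simp] theorem pos_pre (w : ZWord) (l : ℕ) (x : ℤ) : pos w l (pre w l x) = x := by simp [pos]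

@[simp] theorem pre_pos (w : ZWord) (l : ℕ) (x : ℤ) : pre w l (pos w l x) = x := by simp [pos]

theorem pos_inj {w : ZWord} {l : ℕ} {x y : ℤ} : pos w l x = pos w l y ↔ x = y :=
  (pos_injective w l).eq_iff

theorem pre_eq_of_pos {w v : ZWord} {l l' : ℕ} (h : ∀ x, pos w l x = pos v l' x) :
    pre w l = pre v l' := by
  have : (pre w l)⁻¹ = (pre v l')⁻¹ := Equiv.ext h
  exact inv_injective this

theorem pos_of_pre_eq {w v : ZWord} {l l' : ℕ} (h : pre w l = pre v l') (x : ℤ) :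
    pos w l x = pos v l' x := by
  simp [pos, h]

/-- If two words agree between the times `a` and `b`, then wires that are at the same position at
time `a` are so at time `b`. -/
theorem pos_eq_of_agree {w v : ZWord} {a b : ℕ} (hab : a ≤ b)
    (h : ∀ i, a ≤ i → i < b → w i = v i) {x y : ℤ} (hxy : pos w a x = pos v a y) :
    pos w b x = pos v b y := by
  induction b, hab using Nat.le_induction with
  | base => exact hxy
  | succ b hab ih =>
    rw [pos_succ, pos_succ, h b hab (by omega), ih fun i h1 h2 => h i h1 (by omega)]

theorem pos_congr {w v : ZWord} {b : ℕ} (h : ∀ i, i < b → w i = v i) (x : ℤ) :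
    pos w b x = pos v b x :=
  pos_eq_of_agree (Nat.zero_le b) (fun i _ hi => h i hi) (by simp)

theorem Cross.symm {w : ZWord} {l : ℕ} {x y : ℤ} (h : Cross w l x y) : Cross w l y x := by
  obtain ⟨c, h1, h2⟩ := h
  exact ⟨c, h1, by tauto⟩

theorem Cross.ne {w : ZWord} {l : ℕ} {x y : ℤ} (h : Cross w l x y) : x ≠ y := by
  rintro rfl
  obtain ⟨c, -, h⟩ := h
  omega

theorem Cross.pair {w : ZWord} {l : ℕ} {x y x' y' : ℤ} (h : Cross w l x y)
    (h' : Cross w l x' y') : (x' = x ∧ y' = y) ∨ (x' = y ∧ y' = x) := by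
  obtain ⟨c, h1, h2⟩ := h
  obtain ⟨c', h1', h2'⟩ := h'
  obtain rfl : c = c' := by simpa [h1] using h1'
  have e1 := pos_inj (w := w) (l := l) (x := x') (y := x)
  have e2 := pos_inj (w := w) (l := l) (x := y') (y := y)
  have e3 := pos_inj (w := w) (l := l) (x := x') (y := y)
  have e4 := pos_inj (w := w) (l := l) (x := y') (y := x)
  rw [← e1, ← e2, ← e3, ← e4]
  omega

theorem cross_of_some {w : ZWord} {l : ℕ} {c : ℤ} (h : w l = some c) :
    Cross w l (pre w l c) (pre w l (c + 1)) :=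
  ⟨c, h, by simp⟩

/-- A crossing exchanges the two wires. -/
theorem Cross.pos_succ_eq {w : ZWord} {l : ℕ} {x y : ℤ} (h : Cross w l x y) (z : ℤ) :
    pos w (l + 1) z = pos w l (Equiv.swap x y z) := by
  obtain ⟨c, h1, h2⟩ := h
  rw [pos_succ_some h1, Equiv.swap_apply_def]
  have e1 := @pos_inj w l z x
  have e2 := @pos_inj w l z y
  split_ifs with h3 h4 h5 h6 <;> grind

theorem Cross.pos_left {w : ZWord} {l : ℕ} {x y : ℤ} (h : Cross w l x y) :
    pos w (l + 1) x = pos w l y := by rw [h.pos_succ_eq]; simp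

theorem Cross.pos_right {w : ZWord} {l : ℕ} {x y : ℤ} (h : Cross w l x y) :
    pos w (l + 1) y = pos w l x := by rw [h.pos_succ_eq]; simp

theorem pos_lt_succ_iff {w : ZWord} {l : ℕ} {x y : ℤ} (h : ¬ Cross w l x y) :
    pos w (l + 1) x < pos w (l + 1) y ↔ pos w l x < pos w l y := by
  rcases hw : w l with _ | c
  · rw [pos_succ_none hw, pos_succ_none hw]
  · rw [pos_succ_some hw, pos_succ_some hw]
    have : ¬ ((pos w l x = c ∧ pos w l y = c + 1) ∨ (pos w l x = c + 1 ∧ pos w l y = c)) :=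
      fun h' => h ⟨c, hw, h'⟩
    split_ifs <;> omega

/-- The order of two wires does not change as long as they do not cross. -/
theorem pos_lt_iff_of_not_cross {w : ZWord} {a b : ℕ} (hab : a ≤ b) {x y : ℤ}
    (h : ∀ l, a ≤ l → l < b → ¬ Cross w l x y) :
    pos w b x < pos w b y ↔ pos w a x < pos w a y := by
  induction b, hab using Nat.le_induction with
  | base => rfl
  | succ b hab ih =>
    rw [pos_lt_succ_iff (h b hab (by omega)), ih fun i h1 h2 => h i h1 (by omega)]

theorem exists_cross {w : ZWord} {a b : ℕ} (hab : a ≤ b) {x y : ℤ}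
    (h1 : pos w a x < pos w a y) (h2 : pos w b y < pos w b x) :
    ∃ l, a ≤ l ∧ l < b ∧ Cross w l x y := by
  by_contra! h
  have := (pos_lt_iff_of_not_cross hab h).2 h1
  omega

theorem Red.eq_of_cross {w : ZWord} {m : ℕ} (h : Red w m) {i j : ℕ} (hi : i < m) (hj : j < m)
    {x y : ℤ} (h1 : Cross w i x y) (h2 : Cross w j x y) : i = j := by
  rcases lt_trichotomy i j with hij | hij | hij
  · exact (h i j hij hj x y h1 h2).elim
  · exact hij
  · exact (h j i hij hi x y h2 h1).elim

/-- In a reduced word, up to and including the time of their crossing, two wires keep their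
order. -/
theorem Red.pos_lt_before {w : ZWord} {m : ℕ} (h : Red w m) {l a : ℕ} (hl : l < m) (ha : a ≤ l)
    {x y : ℤ} (hc : Cross w l x y) : pos w l x < pos w l y ↔ pos w a x < pos w a y :=
  pos_lt_iff_of_not_cross ha fun i _ hi hc' => h i l hi hl x y hc' hc

theorem Red.pos_lt_after {w : ZWord} {m : ℕ} (h : Red w m) {l a : ℕ} (ha : l < a) (ham : a ≤ m)
    {x y : ℤ} (hc : Cross w l x y) : pos w a x < pos w a y ↔ pos w l y < pos w l x := by
  rw [pos_lt_iff_of_not_cross (Nat.succ_le_of_lt ha) fun i h1 h2 hc' =>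
    h l i h1 (by omega) x y hc hc', hc.pos_left, hc.pos_right]

/-! ### Deleting letters -/

theorem pos_update_le (w : ZWord) {i l : ℕ} (a : Option ℤ) (hl : l ≤ i) (z : ℤ) :
    pos (Function.update w i a) l z = pos w l z :=
  pos_congr (fun j hj => by rw [Function.update_of_ne (by omega)]) z

theorem Cross.pos_erase {w : ZWord} {i l : ℕ} {x y : ℤ} (h : Cross w i x y) (hl : i < l) (z : ℤ) :
    pos (Function.update w i none) l z = pos w l (Equiv.swap x y z) := by
  refine pos_eq_of_agree (Nat.succ_le_of_lt hl)
    (fun j hj _ => by rw [Function.update_of_ne (by omega)]) ?_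
  rw [pos_succ_none (by simp), pos_update_le _ _ le_rfl, h.pos_succ_eq]
  simp

theorem Cross.pre_erase {w : ZWord} {i l : ℕ} {x y : ℤ} (h : Cross w i x y) (hl : i < l) :
    pre (Function.update w i none) l = Equiv.swap x y * pre w l := by
  have : (pre (Function.update w i none) l)⁻¹ = (pre w l)⁻¹ * Equiv.swap x y :=
    Equiv.ext fun z => h.pos_erase hl z
  rw [← inv_inj, this, mul_inv_rev, Equiv.swap_inv]

theorem cross_update_lt {w : ZWord} {i l : ℕ} (a : Option ℤ) (hl : l < i) {x y : ℤ} :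
    Cross (Function.update w i a) l x y ↔ Cross w l x y := by
  unfold Cross
  rw [Function.update_of_ne (by omega), pos_update_le _ _ hl.le, pos_update_le _ _ hl.le]

theorem Cross.cross_erase {w : ZWord} {i l : ℕ} {x y : ℤ} (h : Cross w i x y) (hl : i < l)
    {z t : ℤ} : Cross (Function.update w i none) l z t ↔
      Cross w l (Equiv.swap x y z) (Equiv.swap x y t) := by
  rw [Cross, Cross, Function.update_of_ne (by omega), h.pos_erase hl, h.pos_erase hl]

/-- The two wires of a deleted crossing cross elsewhere after the deletion exactly where they
crossed before. -/
theorem Cross.cross_erase_iff {w : ZWord} {i l : ℕ} {x y : ℤ} (h : Cross w i x y) (hl : l ≠ i) :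
    Cross (Function.update w i none) l x y ↔ Cross w l x y := by
  rcases lt_or_gt_of_ne hl with hl | hl
  · exact cross_update_lt _ hl
  · rw [h.cross_erase hl]
    simp only [Equiv.swap_apply_left, Equiv.swap_apply_right]
    exact ⟨Cross.symm, Cross.symm⟩

theorem cnt_erase {w : ZWord} {i m : ℕ} (hi : i < m) (h : w i ≠ none) :
    cnt (Function.update w i none) m + 1 = cnt w m := by
  unfold cnt
  have : (Finset.range m).filter (fun l => Function.update w i none l ≠ none) =
      ((Finset.range m).filter fun l => w l ≠ none).erase i := by
    ext l
    by_cases hl : l = i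
    · subst hl; simp
    · simp [hl]
  rw [this, Finset.card_erase_add_one (by simp [hi, h])]

theorem Cross.ne_none {w : ZWord} {l : ℕ} {x y : ℤ} (h : Cross w l x y) : w l ≠ none := by
  obtain ⟨c, h, -⟩ := h
  simp [h]

/-- A word in which two wires cross twice can be shortened by two letters. -/
theorem exists_shorter {w : ZWord} {m : ℕ} (h : ¬ Red w m) :
    ∃ v, pre v m = pre w m ∧ cnt v m + 2 = cnt w m := by
  unfold Red at h
  push Not at h
  obtain ⟨i, j, hij, hj, x, y, h1, h2⟩ := h
  have h3 : Cross (Function.update w j none) i x y := (cross_update_lt _ hij).2 h1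
  refine ⟨Function.update (Function.update w j none) i none, ?_, ?_⟩
  · rw [h3.pre_erase (by omega), h2.pre_erase (by omega), ← mul_assoc, Equiv.swap_mul_self, one_mul]
  · have e1 := cnt_erase hj h2.ne_none
    have e2 := cnt_erase (hij.trans hj) h3.ne_none
    omega

/-- A reduced word has the least number of letters among the words with the same product. -/
theorem Red.cnt_le {w v : ZWord} {m m' : ℕ} (h : Red w m) (he : pre v m' = pre w m) :
    cnt w m ≤ cnt v m' := by
  -- wires that cross in `w` are inverted, and therefore cross in `v`
  have key : ∀ l, l < m → w l ≠ none → ∃ l' < m', ∃ x y, Cross w l x y ∧ Cross v l' x y := by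
    intro l hl hw
    obtain ⟨c, hc⟩ := Option.ne_none_iff_exists'.1 hw
    have hx := cross_of_some hc
    have h1 := (h.pos_lt_before hl (Nat.zero_le l) hx).1 (by simp)
    have h2 := h.pos_lt_after hl le_rfl hx.symm
    simp only [pos_pre, pos_zero] at h1 h2
    have h3 := h2.2 (by omega)
    rw [pos_of_pre_eq he.symm, pos_of_pre_eq he.symm] at h3
    obtain ⟨l', -, hl', hc'⟩ := exists_cross (Nat.zero_le m') (by simpa using h1) h3
    exact ⟨l', hl', _, _, hx, hc'⟩
  choose! f hf x y hx hy using key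
  refine Finset.card_le_card_of_injOn f ?_ ?_
  · intro l hl
    simp only [Finset.coe_filter, Finset.mem_range, Set.mem_ofPred_eq] at hl ⊢
    exact ⟨hf l hl.1 hl.2, (hy l hl.1 hl.2).ne_none⟩
  · intro l hl l' hl' hff
    simp only [Finset.coe_filter, Finset.mem_range, Set.mem_ofPred_eq] at hl hl'
    have c1 := hy l hl.1 hl.2
    have c2 := hy l' hl'.1 hl'.2
    rw [← hff] at c2
    have d1 := hx l hl.1 hl.2
    have d2 := hx l' hl'.1 hl'.2
    rcases c1.pair c2 with ⟨e1, e2⟩ | ⟨e1, e2⟩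
    · rw [e1, e2] at d2
      exact h.eq_of_cross hl.1 hl'.1 d1 d2
    · rw [e1, e2] at d2
      exact h.eq_of_cross hl.1 hl'.1 d1 d2.symm

theorem Red.of_cnt_le {w v : ZWord} {m m' : ℕ} (h : Red w m) (he : pre v m' = pre w m)
    (hc : cnt v m' ≤ cnt w m) : Red v m' := by
  by_contra hv
  obtain ⟨v', h1, h2⟩ := exists_shorter hv
  have := h.cnt_le (h1.trans he)
  omega

/-- If a word is not reduced but becomes reduced after deleting the letter `i`, then the wires of
`i` cross a second time. -/
theorem exists_partner {w : ZWord} {m i : ℕ} (hi : i < m)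
    (hr : Red (Function.update w i none) m) (hw : ¬ Red w m) {x y : ℤ} (hc : Cross w i x y) :
    ∃ j < m, j ≠ i ∧ Cross w j x y := by
  wlog hxy : pos w i x < pos w i y generalizing x y
  · have hne := pos_inj (w := w) (l := i) |>.not.2 hc.ne
    obtain ⟨j, h1, h2, h3⟩ := this hc.symm (by omega)
    exact ⟨j, h1, h2, h3.symm⟩
  by_contra! hcon
  have hno : ∀ l, 0 ≤ l → l < m → ¬ Cross (Function.update w i none) l x y := by
    intro l _ hl h
    by_cases hli : l = i
    · subst hli; exact h.ne_none (by simp)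
    · exact hcon l hl hli ((hc.cross_erase_iff hli).1 h)
  have h1 := pos_lt_iff_of_not_cross (Nat.zero_le m) hno
  have h2 := pos_lt_iff_of_not_cross (Nat.zero_le i) fun l a b => hno l a (by omega)
  rw [pos_update_le _ _ le_rfl, pos_update_le _ _ le_rfl] at h2
  have h3 := h1.2 (h2.1 hxy)
  have h0 := h2.1 hxy
  rw [hc.pos_erase hi, hc.pos_erase hi, Equiv.swap_apply_left, Equiv.swap_apply_right] at h3
  -- two letters of `w` are superfluous; in the shorter word the inverted wires `x` and `y` cross, and
  -- omitting this crossing gives a word of the permutation of `w` without `i` with too few letters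
  obtain ⟨v, e1, e2⟩ := exists_shorter hw
  rw [← pos_of_pre_eq e1, ← pos_of_pre_eq e1] at h3
  obtain ⟨l, -, hl, hlc⟩ := exists_cross (Nat.zero_le m) (by simpa using h0) h3
  have e3 := hlc.pre_erase hl
  rw [e1, ← hc.pre_erase hi] at e3
  have := hr.cnt_le e3
  have := cnt_erase hl hlc.ne_none
  have := cnt_erase hi hc.ne_none
  omega

/-- Exchange: if the same wires cross at `i` and `j`, then either letter may be deleted. -/
theorem pre_erase_eq {w : ZWord} {m i j : ℕ} (hi : i < m) (hj : j < m) {x y : ℤ}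
    (h1 : Cross w i x y) (h2 : Cross w j x y) :
    pre (Function.update w j none) m = pre (Function.update w i none) m := by
  rw [h1.pre_erase hi, h2.pre_erase hj]

theorem red_erase {w : ZWord} {m i j : ℕ} (hi : i < m) (hj : j < m)
    (hr : Red (Function.update w i none) m) {x y : ℤ}
    (h1 : Cross w i x y) (h2 : Cross w j x y) : Red (Function.update w j none) m := by
  refine hr.of_cnt_le (pre_erase_eq hi hj h1 h2) ?_
  have := cnt_erase hi h1.ne_none
  have := cnt_erase hj h2.ne_none
  omega

theorem partner_unique {w : ZWord} {m i j j' : ℕ}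
    (hr : Red (Function.update w i none) m) {x y : ℤ} (h : Cross w i x y)
    (hj : j < m) (hj' : j' < m) (hji : j ≠ i) (hji' : j' ≠ i)
    (h1 : Cross w j x y) (h2 : Cross w j' x y) : j = j' :=
  hr.eq_of_cross hj hj' ((h.cross_erase_iff hji).2 h1) ((h.cross_erase_iff hji').2 h2)

/-! ### Bumps of words over `ℤ` -/

/-- Decrement the letter with index `i`. -/
def dec (w : ZWord) (i : ℕ) : ZWord := Function.update w i ((w i).map (· - 1))

/-- The letters with indices `i ≠ j` swap the same two wires. -/
def Partner (m : ℕ) (w : ZWord) (i j : ℕ) : Prop :=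
  j < m ∧ j ≠ i ∧ ∃ x y, Cross w i x y ∧ Cross w j x y

/-- `Run m w i v`: if the letter `i` has just been decremented, resulting in `w`, then the bump goes
on to end with the word `v`. -/
inductive Run (m : ℕ) : ZWord → ℕ → ZWord → Prop
  | halt (w : ZWord) (i : ℕ) (h : Red w m) : Run m w i w
  | push (w : ZWord) (i j : ℕ) (v : ZWord) (h : Partner m w i j) (hv : Run m (dec w j) j v) :
      Run m w i v

/-- The bumped wire: it is the right one of the two wires that the letter `i`, which has just been
decremented, swaps. -/
def Mover (w : ZWord) (i : ℕ) (A : ℤ) : Prop := ∃ d, w i = some d ∧ pos w i A = d + 1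

/-- The area under the path of the wire `A`, normalized to be a natural number. -/
def energy (w : ZWord) (m : ℕ) (A : ℤ) : ℕ :=
  ∑ l ∈ Finset.range (m + 1), (pos w l A - A + l).toNat

@[simp] theorem dec_same (w : ZWord) (i : ℕ) : dec w i i = (w i).map (· - 1) := by simp [dec]

theorem dec_of_ne (w : ZWord) {i j : ℕ} (h : j ≠ i) : dec w i j = w j := by simp [dec, h]

@[simp] theorem dec_erase (w : ZWord) (i : ℕ) :
    Function.update (dec w i) i none = Function.update w i none := by simp [dec]

theorem le_pos (w : ZWord) (l : ℕ) (A : ℤ) : A - l ≤ pos w l A := by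
  induction l with
  | zero => simp
  | succ l ih =>
    rcases h : w l with _ | c
    · rw [pos_succ_none h]; push_cast; omega
    · rw [pos_succ_some h]; push_cast; split_ifs <;> omega

theorem Mover.exists_cross {w : ZWord} {i : ℕ} {A : ℤ} (h : Mover w i A) :
    ∃ Z, Cross w i Z A ∧ pos w i Z < pos w i A := by
  obtain ⟨d, h1, h2⟩ := h
  exact ⟨pre w i d, ⟨d, h1, by simp [h2]⟩, by simp [h2]⟩

/-- The invariants of a bump: the word without the letter that was decremented stays a reduced word
of the same permutation, the bumped wire stays the same, and its path moves to the left. -/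
theorem Partner.step {m : ℕ} {w : ZWord} {i j : ℕ} {A : ℤ} (hi : i < m)
    (hr : Red (Function.update w i none) m) (hA : Mover w i A) (h : Partner m w i j) :
    Red (Function.update (dec w j) j none) m ∧
      pre (Function.update (dec w j) j none) m = pre (Function.update w i none) m ∧
      Mover (dec w j) j A ∧
      energy (Function.update (dec w j) j none) m A < energy (Function.update w i none) m A := by
  obtain ⟨hj, hji, x, y, hx, hy⟩ := h
  obtain ⟨Z, hc, hZA⟩ := hA.exists_cross
  have hcj : Cross w j Z A := by
    rcases hx.pair hc with ⟨rfl, rfl⟩ | ⟨rfl, rfl⟩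
    exacts [hy, hy.symm]
  have hcu : Cross (Function.update w i none) j Z A := (hc.cross_erase_iff hji).2 hcj
  rw [dec_erase]
  refine ⟨red_erase hi hj hr hx hy, pre_erase_eq hi hj hx hy, ?_, ?_⟩
  · obtain ⟨e, he, hcase⟩ := hcj
    refine ⟨e - 1, by simp [he], ?_⟩
    have h1 : pos (dec w j) j A = pos w j A := pos_update_le _ _ le_rfl _
    rw [h1]
    rcases lt_or_gt_of_ne hji with hlt | hlt
    · have h2 := hr.pos_lt_after hlt hi.le hcu
      rw [pos_update_le _ _ le_rfl, pos_update_le _ _ le_rfl, pos_update_le _ _ hlt.le,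
        pos_update_le _ _ hlt.le] at h2
      have := h2.1 hZA
      omega
    · have h2 := hr.pos_lt_before hj hlt.le hcu
      rw [pos_update_le _ _ le_rfl, pos_update_le _ _ le_rfl, hc.pos_erase hlt, hc.pos_erase hlt,
        Equiv.swap_apply_left, Equiv.swap_apply_right] at h2
      have := h2.2 hZA
      omega
  · -- deleting `j` instead of `i` moves the path of `A` to the left between the times `i` and `j`,
    -- and leaves it unchanged elsewhere
    have key : ∀ l ≤ m, pos (Function.update w j none) l A ≤ pos (Function.update w i none) l A ∧
        (l = max i j →
          pos (Function.update w j none) l A < pos (Function.update w i none) l A) := by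
      intro l hl
      rcases lt_or_gt_of_ne hji with hlt | hlt
      · rcases le_or_gt l j with h1 | h1
        · rw [pos_update_le _ _ h1, pos_update_le _ _ (by omega)]
          exact ⟨le_rfl, by omega⟩
        · rcases le_or_gt l i with h2 | h2
          · have e1 := hr.pos_lt_after h1 hl hcu
            have e2 := hr.pos_lt_after hlt hi.le hcu
            rw [pos_update_le _ _ le_rfl, pos_update_le _ _ le_rfl] at e2
            have e3 := e1.2 (e2.1 hZA)
            rw [pos_update_le _ _ h2, pos_update_le _ _ h2] at e3
            rw [hcj.pos_erase h1, Equiv.swap_apply_right, pos_update_le _ _ h2]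
            exact ⟨e3.le, fun _ => e3⟩
          · rw [hcj.pos_erase h1, hc.pos_erase h2]
            exact ⟨le_rfl, by omega⟩
      · rcases le_or_gt l i with h1 | h1
        · rw [pos_update_le _ _ h1, pos_update_le _ _ (by omega)]
          exact ⟨le_rfl, by omega⟩
        · rcases le_or_gt l j with h2 | h2
          · have e1 := hr.pos_lt_before hj h2 hcu
            have e2 := hr.pos_lt_before hj hlt.le hcu
            rw [pos_update_le _ _ le_rfl, pos_update_le _ _ le_rfl] at e2
            have e3 := e1.1 (e2.2 hZA)
            rw [hc.pos_erase h1, hc.pos_erase h1, Equiv.swap_apply_right,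
              Equiv.swap_apply_left] at e3
            rw [hc.pos_erase h1, Equiv.swap_apply_right, pos_update_le _ _ h2]
            exact ⟨e3.le, fun _ => e3⟩
          · rw [hcj.pos_erase h2, hc.pos_erase h1]
            exact ⟨le_rfl, by omega⟩
    refine Finset.sum_lt_sum (fun l hl => ?_) ⟨max i j, by simp; omega, ?_⟩
    · have := (key l (by simpa [Nat.lt_succ_iff] using hl)).1
      omega
    · have := (key (max i j) (by omega)).2 rfl
      have := le_pos (Function.update w j none) (max i j) A
      omega

theorem Mover.dec {w : ZWord} {i : ℕ} {A c : ℤ} (h : w i = some c) (hA : pos w i A = c) :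
    Mover (dec w i) i A := by
  refine ⟨c - 1, by simp [h], ?_⟩
  have h1 : pos (LittleRS.dec w i) i A = pos w i A := pos_update_le _ _ le_rfl _
  rw [h1]
  omega

/-- The result of a bump: if `u` is the word without its first decremented letter, then the
permutation of the result is obtained from that of `u` by swapping the bumped wire `A` and a wire
`Z` to the left of it, with no wire in between. -/
theorem Run.result {m : ℕ} {w v : ZWord} {i : ℕ} (h : Run m w i v) {A : ℤ} (hi : i < m)
    (hr : Red (Function.update w i none) m) (hA : Mover w i A) :
    Red v m ∧ ∃ Z, Z < A ∧
      pos (Function.update w i none) m Z < pos (Function.update w i none) m A ∧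
      pre v m = Equiv.swap Z A * pre (Function.update w i none) m ∧
      ∀ X, Z < X → X < A →
        pos (Function.update w i none) m Z < pos (Function.update w i none) m X →
        pos (Function.update w i none) m X < pos (Function.update w i none) m A → False := by
  induction h with
  | halt w i h =>
    refine ⟨h, ?_⟩
    obtain ⟨Z, hc, hZA⟩ := hA.exists_cross
    set u := Function.update w i none with hu
    have h1 := hc.pre_erase hi
    have e1 := h.pos_lt_before hi (Nat.zero_le i) hc
    have e2 := h.pos_lt_after hi le_rfl hc.symm
    have e3 : pos u m Z < pos u m A := by
      rw [hc.pos_erase hi, hc.pos_erase hi, Equiv.swap_apply_left, Equiv.swap_apply_right]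
      exact e2.2 hZA
    refine ⟨Z, by simpa using e1.1 hZA, e3, ?_, ?_⟩
    · rw [h1, ← mul_assoc, Equiv.swap_mul_self, one_mul]
    · -- a wire `X` in between would not cross `Z` or `A` without the letter `i`, and would separate
      -- these wires at the time `i`, when they are neighbours
      intro X hZX hXA h2 h3
      have n1 : ∀ l, 0 ≤ l → l < m → ¬ Cross u l Z X := by
        intro l _ hl hcl
        have a1 := hr.pos_lt_before hl (Nat.zero_le l) hcl
        have a2 := hr.pos_lt_after hl le_rfl hcl
        simp only [pos_zero] at a1
        have := a1.2 hZX
        have := a2.1 h2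
        omega
      have n2 : ∀ l, 0 ≤ l → l < m → ¬ Cross u l X A := by
        intro l _ hl hcl
        have a1 := hr.pos_lt_before hl (Nat.zero_le l) hcl
        have a2 := hr.pos_lt_after hl le_rfl hcl
        simp only [pos_zero] at a1
        have := a1.2 hXA
        have := a2.1 h3
        omega
      have b1 := (pos_lt_iff_of_not_cross (Nat.zero_le i) fun l a b => n1 l a (by omega)).2
        (by simpa using hZX)
      have b2 := (pos_lt_iff_of_not_cross (Nat.zero_le i) fun l a b => n2 l a (by omega)).2
        (by simpa using hXA)
      rw [hu, pos_update_le _ _ le_rfl, pos_update_le _ _ le_rfl] at b1 b2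
      obtain ⟨c, -, h5⟩ := hc
      omega
  | push w i j v hp hv ih =>
    obtain ⟨s1, s2, s3, -⟩ := hp.step hi hr hA
    have := ih hp.1 s1 s3
    simp only [pos, s2] at this ⊢
    exact this

theorem exists_run {m : ℕ} {w : ZWord} {i : ℕ} {A : ℤ} (hi : i < m)
    (hr : Red (Function.update w i none) m) (hA : Mover w i A) : ∃ v, Run m w i v := by
  induction hn : energy (Function.update w i none) m A using Nat.strong_induction_on
    generalizing w i with
  | _ n ih =>
    by_cases hw : Red w m
    · exact ⟨w, .halt w i hw⟩
    · obtain ⟨Z, hc, -⟩ := hA.exists_cross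
      obtain ⟨j, hj, hji, hcj⟩ := exists_partner hi hr hw hc
      have hp : Partner m w i j := ⟨hj, hji, Z, A, hc, hcj⟩
      obtain ⟨s1, s2, s3, s4⟩ := hp.step hi hr hA
      obtain ⟨v, hv⟩ := ih _ (hn ▸ s4) hj s1 s3 rfl
      exact ⟨v, .push w i j v hp hv⟩

theorem Partner.unique {m : ℕ} {w : ZWord} {i j j' : ℕ}
    (hr : Red (Function.update w i none) m) (h : Partner m w i j) (h' : Partner m w i j') :
    j = j' := by
  obtain ⟨a1, a2, x, y, a3, a4⟩ := h
  obtain ⟨b1, b2, x', y', b3, b4⟩ := h'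
  rcases a3.pair b3 with ⟨rfl, rfl⟩ | ⟨rfl, rfl⟩
  · exact partner_unique hr a3 a1 b1 a2 b2 a4 b4
  · exact partner_unique hr a3 a1 b1 a2 b2 a4 b4.symm

theorem Partner.not_red {m : ℕ} {w : ZWord} {i j : ℕ} (hi : i < m) (h : Partner m w i j) :
    ¬ Red w m := by
  obtain ⟨a1, a2, x, y, a3, a4⟩ := h
  exact fun hr => a2 (hr.eq_of_cross a1 hi a4 a3)

theorem Run.unique {m : ℕ} {w v v' : ZWord} {i : ℕ} {A : ℤ} (hi : i < m)
    (hr : Red (Function.update w i none) m) (hA : Mover w i A) (h : Run m w i v)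
    (h' : Run m w i v') : v = v' := by
  induction h with
  | halt w i h =>
    cases h' with
    | halt => rfl
    | push _ _ j _ hp => exact (hp.not_red hi h).elim
  | push w i j v hp hv ih =>
    cases h' with
    | halt _ _ h => exact (hp.not_red hi h).elim
    | push _ _ j' _ hp' hv' =>
      obtain rfl := hp.unique hr hp'
      obtain ⟨s1, s2, s3, -⟩ := hp.step hi hr hA
      exact ih hp.1 s1 s3 hv'

/-! ### Bumps preserve descents -/

/-- Equal neighbouring letters swap the same wires. -/
theorem cross_adjacent {w : ZWord} {k : ℕ} {c : ℤ} (h1 : w k = some c) (h2 : w (k + 1) = some c)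
    {x y : ℤ} : Cross w (k + 1) x y ↔ Cross w k x y := by
  have key : ∀ x y, Cross w k x y → Cross w (k + 1) x y := by
    intro x y h
    refine ⟨c, h2, ?_⟩
    obtain ⟨c', hc', hh⟩ := id h
    obtain rfl : c = c' := by simpa [h1] using hc'
    rw [h.pos_left, h.pos_right]
    omega
  refine ⟨fun h => ?_, key x y⟩
  have h3 := cross_of_some h1
  rcases (key _ _ h3).pair h with ⟨rfl, rfl⟩ | ⟨rfl, rfl⟩
  exacts [h3, h3.symm]

theorem partner_adjacent {m : ℕ} {w : ZWord} {k : ℕ} (hk : k + 1 < m) {c : ℤ} (h1 : w k = some c)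
    (h2 : w (k + 1) = some c) : Partner m w k (k + 1) ∧ Partner m w (k + 1) k := by
  have h3 := cross_of_some h1
  have h4 := (cross_adjacent h1 h2).2 h3
  exact ⟨⟨hk, by omega, _, _, h3, h4⟩, ⟨by omega, by omega, _, _, h4, h3⟩⟩

theorem Red.adjacent_ne {m : ℕ} {w : ZWord} (hr : Red w m) {k : ℕ} (hk : k + 1 < m) {c d : ℤ}
    (h1 : w k = some c) (h2 : w (k + 1) = some d) : c ≠ d := by
  rintro rfl
  have h3 := cross_of_some h1
  exact hr k (k + 1) (by omega) hk _ _ h3 ((cross_adjacent h1 h2).2 h3)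

/-- During a bump, a decremented letter can become equal to its right neighbour `w (k + 1)` only
if that neighbour is decremented next. -/
theorem Run.desc {m : ℕ} {w v : ZWord} {i k : ℕ} (h : Run m w i v) {A : ℤ} (hi : i < m)
    (hr : Red (Function.update w i none) m) (hA : Mover w i A) (hk : k + 1 < m) {c d : ℤ}
    (h1 : w k = some c) (h2 : w (k + 1) = some d) (hcd : d < c ∨ (c = d ∧ i = k)) :
    ∃ c' d', v k = some c' ∧ v (k + 1) = some d' ∧ d' < c' := by
  induction h generalizing c d with
  | halt w i h =>
    refine ⟨c, d, h1, h2, ?_⟩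
    have := h.adjacent_ne hk h1 h2
    omega
  | push w i j v hp hv ih =>
    obtain ⟨s1, s2, s3, -⟩ := hp.step hi hr hA
    have hnext : c = d → j = k + 1 := by
      intro hcd'
      subst hcd'
      obtain rfl : i = k := by omega
      exact hp.unique hr (partner_adjacent hk h1 h2).1
    by_cases hjk : j = k
    · subst hjk
      refine ih hp.1 s1 s3 (c := c - 1) (d := d) (by simp [h1]) ?_ (by omega)
      rw [dec_of_ne _ (by omega), h2]
    · by_cases hjk' : j = k + 1
      · subst hjk'
        refine ih hp.1 s1 s3 (c := c) (d := d - 1) ?_ (by simp [h2]) (by omega)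
        rw [dec_of_ne _ (by omega), h1]
      · refine ih hp.1 s1 s3 (c := c) (d := d) ?_ ?_ (by omega)
        · rw [dec_of_ne _ (by omega), h1]
        · rw [dec_of_ne _ (by omega), h2]

theorem Run.asc {m : ℕ} {w v : ZWord} {i k : ℕ} (h : Run m w i v) {A : ℤ} (hi : i < m)
    (hr : Red (Function.update w i none) m) (hA : Mover w i A) (hk : k + 1 < m) {c d : ℤ}
    (h1 : w k = some c) (h2 : w (k + 1) = some d) (hcd : c < d ∨ (c = d ∧ i = k + 1)) :
    ∃ c' d', v k = some c' ∧ v (k + 1) = some d' ∧ c' < d' := by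
  induction h generalizing c d with
  | halt w i h =>
    refine ⟨c, d, h1, h2, ?_⟩
    have := h.adjacent_ne hk h1 h2
    omega
  | push w i j v hp hv ih =>
    obtain ⟨s1, s2, s3, -⟩ := hp.step hi hr hA
    have hnext : c = d → j = k := by
      intro hcd'
      subst hcd'
      obtain rfl : i = k + 1 := by omega
      exact hp.unique hr (partner_adjacent hk h1 h2).2
    by_cases hjk : j = k
    · subst hjk
      refine ih hp.1 s1 s3 (c := c - 1) (d := d) (by simp [h1]) ?_ (by omega)
      rw [dec_of_ne _ (by omega), h2]
    · by_cases hjk' : j = k + 1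
      · subst hjk'
        refine ih hp.1 s1 s3 (c := c) (d := d - 1) ?_ (by simp [h2]) (by omega)
        rw [dec_of_ne _ (by omega), h1]
      · refine ih hp.1 s1 s3 (c := c) (d := d) ?_ ?_ (by omega)
        · rw [dec_of_ne _ (by omega), h1]
        · rw [dec_of_ne _ (by omega), h2]

/-- `v` is the result of a bump of the reduced word `w` that begins at a letter whose omission
leaves a reduced word. -/
def Bump (m : ℕ) (w v : ZWord) : Prop :=
  ∃ i < m, Red w m ∧ Red (Function.update w i none) m ∧ w i ≠ none ∧ Run m (dec w i) i v

/-- The letters with indices less than `m` of `w` and `v` have the same relative order as their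
right neighbours. -/
def SameDescents (m : ℕ) (w v : ZWord) : Prop :=
  ∀ k, k + 1 < m → ∀ c d, w k = some c → w (k + 1) = some d →
    ∃ c' d', v k = some c' ∧ v (k + 1) = some d' ∧ (c < d → c' < d') ∧ (d < c → d' < c')

theorem Bump.sameDescents {m : ℕ} {w v : ZWord} (h : Bump m w v) : SameDescents m w v := by
  obtain ⟨i, hi, hw, hr, hs, h⟩ := h
  obtain ⟨a, ha⟩ := Option.ne_none_iff_exists'.1 hs
  have hA := Mover.dec ha (A := pre w i a) (by simp)
  rw [← dec_erase] at hr
  intro k hk c d h1 h2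
  have hne := hw.adjacent_ne hk h1 h2
  have key : ∃ c' d', dec w i k = some c' ∧ dec w i (k + 1) = some d' ∧
      ((c' = c ∧ d' = d ∧ i ≠ k ∧ i ≠ k + 1) ∨ (c' = c - 1 ∧ d' = d ∧ i = k) ∨
        (c' = c ∧ d' = d - 1 ∧ i = k + 1)) := by
    by_cases hjk : i = k
    · subst hjk
      exact ⟨c - 1, d, by simp [h1], by rw [dec_of_ne _ (by omega), h2], by simp⟩
    · by_cases hjk' : i = k + 1
      · subst hjk'
        exact ⟨c, d - 1, by rw [dec_of_ne _ (by omega), h1], by simp [h2], by simp⟩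
      · exact ⟨c, d, by rw [dec_of_ne _ (by omega), h1], by rw [dec_of_ne _ (by omega), h2],
          by simp [hjk, hjk']⟩
  obtain ⟨c', d', e1, e2, e3⟩ := key
  rcases lt_or_gt_of_ne hne with hlt | hlt
  · obtain ⟨c'', d'', f1, f2, f3⟩ := h.asc hi hr hA hk e1 e2 (by omega)
    exact ⟨c'', d'', f1, f2, fun _ => f3, by omega⟩
  · obtain ⟨c'', d'', f1, f2, f3⟩ := h.desc hi hr hA hk e1 e2 (by omega)
    exact ⟨c'', d'', f1, f2, by omega, fun _ => f3⟩

/-! ### Coxeter–Knuth moves commute with bumps -/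

/-- The three elementary Coxeter–Knuth moves `acb → cab`, `bac → bca` (where `a < b < c`) and
`a(a+1)a → (a+1)a(a+1)`. -/
def Ck3 (x y z x' y' z' : ℤ) : Prop :=
  (x' = y ∧ y' = x ∧ z' = z ∧ x < z ∧ z < y) ∨
  (x' = x ∧ y' = z ∧ z' = y ∧ y < x ∧ x < z) ∨
  (x = z ∧ x' = y ∧ y' = x ∧ z' = y ∧ y = x + 1)

theorem gen_comm {a c : ℤ} (h : a + 1 < c) (p : ℤ) :
    gen (some a) (gen (some c) p) = gen (some c) (gen (some a) p) := by
  rw [gen_some_apply c, gen_some_apply a p]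
  split_ifs <;> rw [gen_some_apply, gen_some_apply] <;> split_ifs <;> omega

theorem gen_braid (a p : ℤ) :
    gen (some a) (gen (some (a + 1)) (gen (some a) p)) =
      gen (some (a + 1)) (gen (some a) (gen (some (a + 1)) p)) := by
  have e1 : a + 1 + 1 ≠ a := by omega
  have e2 : a ≠ a + 1 + 1 := by omega
  by_cases h1 : p = a
  · subst h1; simp [gen_some_apply, e1, e2]
  by_cases h2 : p = a + 1
  · subst h2; simp [gen_some_apply, e1, e2]
  by_cases h3 : p = a + 1 + 1
  · subst h3; simp [gen_some_apply, e1, e2]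
  · simp [gen_some_apply, h1, h2, h3]

theorem Ck3.gen_eq {x y z x' y' z' : ℤ} (h : Ck3 x y z x' y' z') (p : ℤ) :
    gen (some z') (gen (some y') (gen (some x') p)) =
      gen (some z) (gen (some y) (gen (some x) p)) := by
  rcases h with ⟨rfl, rfl, rfl, a1, a2⟩ | ⟨rfl, rfl, rfl, a1, a2⟩ | ⟨rfl, rfl, rfl, rfl, rfl⟩
  · rw [gen_comm (a := y') (by omega)]
  · rw [gen_comm (a := z') (by omega)]
  · rw [gen_braid]

/-- The letters of `w` with indices `k`, `k + 1`, `k + 2` are `x`, `y`, `z`. -/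
def Win (k : ℕ) (w : ZWord) (x y z : ℤ) : Prop :=
  w k = some x ∧ w (k + 1) = some y ∧ w (k + 2) = some z

/-- `w` and `v` differ by a Coxeter–Knuth move on the letters with indices `k`, `k + 1`, `k + 2`. -/
def CK (k : ℕ) (w v : ZWord) : Prop :=
  (∀ l, (l < k ∨ k + 3 ≤ l) → v l = w l) ∧
    ∃ x y z x' y' z', Win k w x y z ∧ Win k v x' y' z' ∧
      (Ck3 x y z x' y' z' ∨ Ck3 x' y' z' x y z)

theorem CK.symm {k : ℕ} {w v : ZWord} (h : CK k w v) : CK k v w := by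
  obtain ⟨h, x, y, z, x', y', z', h1, h2, h3⟩ := h
  exact ⟨fun l hl => (h l hl).symm, x', y', z', x, y, z, h2, h1, h3.symm⟩

theorem CK.pos_eq {k : ℕ} {w v : ZWord} (h : CK k w v) {l : ℕ} (hl : l ≤ k ∨ k + 3 ≤ l) (t : ℤ) :
    pos v l t = pos w l t := by
  obtain ⟨h, x, y, z, x', y', z', ⟨a1, a2, a3⟩, ⟨b1, b2, b3⟩, h3⟩ := h
  have h0 : ∀ l ≤ k, pos v l t = pos w l t := fun l hl =>
    pos_congr (fun i hi => h i (by omega)) t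
  rcases hl with hl | hl
  · exact h0 l hl
  · refine pos_eq_of_agree hl (fun i hi _ => h i (by omega)) ?_
    rw [pos_succ, pos_succ, pos_succ, pos_succ, pos_succ, pos_succ, a1, a2, a3, b1, b2, b3,
      h0 k le_rfl]
    rcases h3 with h3 | h3
    · exact h3.gen_eq _
    · exact (h3.gen_eq _).symm

theorem CK.pre_eq {k m : ℕ} {w v : ZWord} (h : CK k w v) (hm : k + 2 < m) : pre v m = pre w m :=
  pre_eq_of_pos (h.pos_eq (Or.inr hm))

theorem CK.cnt_eq {k m : ℕ} {w v : ZWord} (h : CK k w v) : cnt v m = cnt w m := by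
  unfold cnt
  congr 1
  refine Finset.filter_congr fun l _ => ?_
  obtain ⟨h, x, y, z, x', y', z', ⟨a1, a2, a3⟩, ⟨b1, b2, b3⟩, h3⟩ := h
  by_cases hl : l < k ∨ k + 3 ≤ l
  · rw [h l hl]
  · have : l = k ∨ l = k + 1 ∨ l = k + 2 := by omega
    rcases this with rfl | rfl | rfl <;> simp [*]

theorem CK.red {k m : ℕ} {w v : ZWord} (h : CK k w v) (hm : k + 2 < m) (hr : Red w m) : Red v m :=
  hr.of_cnt_le (h.pre_eq hm) h.cnt_eq.le

theorem CK.cross_outside {k : ℕ} {w v : ZWord} (h : CK k w v) {l : ℕ} (hl : l < k ∨ k + 3 ≤ l)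
    {x y : ℤ} : Cross v l x y ↔ Cross w l x y := by
  unfold Cross
  rw [h.1 l hl, h.pos_eq (by omega), h.pos_eq (by omega)]

theorem CK.update_outside {k : ℕ} {w v : ZWord} (h : CK k w v) {j : ℕ} (hj : j < k ∨ k + 3 ≤ j)
    (a : Option ℤ) : CK k (Function.update w j a) (Function.update v j a) := by
  obtain ⟨h, x, y, z, x', y', z', ⟨a1, a2, a3⟩, ⟨b1, b2, b3⟩, h3⟩ := h
  refine ⟨fun l hl => ?_, x, y, z, x', y', z', ⟨?_, ?_, ?_⟩, ⟨?_, ?_, ?_⟩, h3⟩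
  · by_cases hlj : l = j
    · subst hlj; simp
    · simp [hlj, h l hl]
  all_goals rw [Function.update_of_ne (by omega)]; assumption

theorem CK.dec_outside {k : ℕ} {w v : ZWord} (h : CK k w v) {j : ℕ} (hj : j < k ∨ k + 3 ≤ j) :
    CK k (dec w j) (dec v j) := by
  unfold dec
  rw [h.1 j hj]
  exact h.update_outside hj _

theorem Cross.letter_eq {w : ZWord} {l : ℕ} {X Y x y : ℤ} (hx : w l = some x)
    (hy : w (l + 1) = some y) (h1 : Cross w l X Y) (h2 : Cross w (l + 1) X Y) : x = y := by
  obtain ⟨c, hc, hh⟩ := id h1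
  obtain ⟨d, hd, hh'⟩ := h2
  rw [h1.pos_left, h1.pos_right] at hh'
  simp only [hx, hy, Option.some.injEq] at hc hd
  omega

theorem Win.cross_unique {k : ℕ} {w : ZWord} {x y z : ℤ} (h : Win k w x y z) (hxy : x ≠ y)
    (hyz : y ≠ z) (hxz : x = z → y = x + 1 ∨ x = y + 1) {i j : ℕ} {X Y : ℤ}
    (hi : k ≤ i ∧ i < k + 3) (hj : k ≤ j ∧ j < k + 3) (h1 : Cross w i X Y) (h2 : Cross w j X Y) :
    i = j := by
  wlog hij : i < j generalizing i j
  · rcases lt_trichotomy i j with h' | h' | h'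
    · exact this hi hj h1 h2 h'
    · exact h'
    · exact (this hj hi h2 h1 h').symm
  exfalso
  have hcase : (i = k ∧ j = k + 1) ∨ (i = k + 1 ∧ j = k + 2) ∨ (i = k ∧ j = k + 2) := by omega
  obtain ⟨e1, e2, e3⟩ := h
  rcases hcase with ⟨rfl, rfl⟩ | ⟨rfl, rfl⟩ | ⟨rfl, rfl⟩
  · exact hxy (h1.letter_eq e1 e2 h2)
  · exact hyz (h1.letter_eq e2 e3 h2)
  · obtain ⟨c, hc, hh⟩ := id h1
    obtain ⟨d, hd, hh'⟩ := h2
    simp only [e1, e3, Option.some.injEq] at hc hd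
    rw [pos_succ_some e2, pos_succ_some e2, h1.pos_left, h1.pos_right] at hh'
    split_ifs at hh' <;> omega

theorem Ck3.left {x y z x' y' z' : ℤ} (h : Ck3 x y z x' y' z' ∨ Ck3 x' y' z' x y z) :
    x ≠ y ∧ y ≠ z ∧ (x = z → y = x + 1 ∨ x = y + 1) := by
  unfold Ck3 at h
  omega

theorem CK.cross_unique {k : ℕ} {w v : ZWord} (h : CK k w v) {i j : ℕ} {X Y : ℤ}
    (hi : k ≤ i ∧ i < k + 3) (hj : k ≤ j ∧ j < k + 3) (h1 : Cross w i X Y) (h2 : Cross w j X Y) :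
    i = j := by
  obtain ⟨-, x, y, z, x', y', z', h3, -, h4⟩ := h
  obtain ⟨e1, e2, e3⟩ := Ck3.left h4
  exact h3.cross_unique e1 e2 e3 hi hj h1 h2

/-- At most one more step of a bump. -/
def Steps (m : ℕ) (w : ZWord) (i : ℕ) (w' : ZWord) (i' : ℕ) : Prop :=
  (w' = w ∧ i' = i) ∨ ∃ j, Partner m w i j ∧ w' = dec w j ∧ i' = j

theorem Steps.run {m : ℕ} {w w' v : ZWord} {i i' : ℕ} (h : Steps m w i w' i')
    (hv : Run m w' i' v) : Run m w i v := by
  rcases h with ⟨rfl, rfl⟩ | ⟨j, h1, rfl, rfl⟩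
  · exact hv
  · exact .push _ _ _ _ h1 hv

theorem Steps.facts {m : ℕ} {w w' : ZWord} {i i' : ℕ} (h : Steps m w i w' i') {A : ℤ} (hi : i < m)
    (hr : Red (Function.update w i none) m) (hA : Mover w i A) :
    i' < m ∧ Red (Function.update w' i' none) m ∧
      pre (Function.update w' i' none) m = pre (Function.update w i none) m ∧ Mover w' i' A ∧
      energy (Function.update w' i' none) m A ≤ energy (Function.update w i none) m A := by
  rcases h with ⟨rfl, rfl⟩ | ⟨j, h1, rfl, rfl⟩
  · exact ⟨hi, hr, rfl, hA, le_rfl⟩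
  · obtain ⟨s1, s2, s3, s4⟩ := h1.step hi hr hA
    exact ⟨h1.1, s1, s2, s3, s4.le⟩

theorem Win.dec0 {k : ℕ} {w : ZWord} {x y z : ℤ} (h : Win k w x y z) :
    Win k (dec w k) (x - 1) y z := by
  obtain ⟨e1, e2, e3⟩ := h
  exact ⟨by simp [e1], by rw [dec_of_ne _ (by omega), e2], by rw [dec_of_ne _ (by omega), e3]⟩

theorem Win.dec1 {k : ℕ} {w : ZWord} {x y z : ℤ} (h : Win k w x y z) :
    Win k (dec w (k + 1)) x (y - 1) z := by
  obtain ⟨e1, e2, e3⟩ := h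
  exact ⟨by rw [dec_of_ne _ (by omega), e1], by simp [e2], by rw [dec_of_ne _ (by omega), e3]⟩

theorem Win.dec2 {k : ℕ} {w : ZWord} {x y z : ℤ} (h : Win k w x y z) :
    Win k (dec w (k + 2)) x y (z - 1) := by
  obtain ⟨e1, e2, e3⟩ := h
  exact ⟨by rw [dec_of_ne _ (by omega), e1], by rw [dec_of_ne _ (by omega), e2], by simp [e3]⟩

theorem Win.partner01 {k m : ℕ} {w : ZWord} {x y z : ℤ} (h : Win k w x y z) (hm : k + 2 < m)
    (hxy : x = y) : Partner m w k (k + 1) ∧ Partner m w (k + 1) k := by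
  subst hxy
  exact partner_adjacent (by omega) h.1 h.2.1

theorem Win.partner12 {k m : ℕ} {w : ZWord} {x y z : ℤ} (h : Win k w x y z) (hm : k + 2 < m)
    (hyz : y = z) : Partner m w (k + 1) (k + 2) ∧ Partner m w (k + 2) (k + 1) := by
  subst hyz
  exact partner_adjacent (by omega) h.2.1 h.2.2

theorem Win.partner02 {k m : ℕ} {w : ZWord} {x y z : ℤ} (h : Win k w x y z) (hm : k + 2 < m)
    (hxz : x = z) (hfar : y + 1 < x ∨ x + 1 < y) :
    Partner m w k (k + 2) ∧ Partner m w (k + 2) k := by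
  subst hxz
  obtain ⟨e1, e2, e3⟩ := h
  have h3 := cross_of_some e1
  have h4 : Cross w (k + 2) (pre w k x) (pre w k (x + 1)) := by
    refine ⟨x, e3, ?_⟩
    rw [pos_succ_some e2, pos_succ_some e2, h3.pos_left, h3.pos_right, pos_pre, pos_pre]
    split_ifs <;> omega
  exact ⟨⟨by omega, by omega, _, _, h3, h4⟩, ⟨by omega, by omega, _, _, h4, h3⟩⟩

/-- The words `w` and `v` agree outside of the window at `k`. -/
def Agree (k : ℕ) (w v : ZWord) : Prop := ∀ l, (l < k ∨ k + 3 ≤ l) → v l = w l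

theorem Agree.dec {k : ℕ} {w v : ZWord} (h : Agree k w v) {i j : ℕ} (hi : k ≤ i ∧ i < k + 3)
    (hj : k ≤ j ∧ j < k + 3) : Agree k (dec w i) (dec v j) := by
  intro l hl
  rw [dec_of_ne _ (by omega), dec_of_ne _ (by omega), h l hl]

theorem Agree.dec_left {k : ℕ} {w v : ZWord} (h : Agree k w v) {i : ℕ} (hi : k ≤ i ∧ i < k + 3) :
    Agree k (LittleRS.dec w i) v := by
  intro l hl
  rw [dec_of_ne _ (by omega), h l hl]

theorem Agree.dec_right {k : ℕ} {w v : ZWord} (h : Agree k w v) {i : ℕ}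
    (hi : k ≤ i ∧ i < k + 3) : Agree k w (LittleRS.dec v i) := by
  intro l hl
  rw [dec_of_ne _ (by omega), h l hl]

/-- The conclusion of the local analysis: after one or two steps inside of the window, the words
are again related by a Coxeter–Knuth move. -/
def LocalSim (k m : ℕ) (w v : ZWord) (j j' : ℕ) : Prop :=
  ∃ w1 i1 v1 i1', Steps m (dec w j) j w1 i1 ∧ Steps m (dec v j') j' v1 i1' ∧ CK k w1 v1 ∧
    (k ≤ i1 ∧ i1 < k + 3) ∧ (k ≤ i1' ∧ i1' < k + 3)

theorem LocalSim.symm {k m : ℕ} {w v : ZWord} {j j' : ℕ} (h : LocalSim k m w v j j') :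
    LocalSim k m v w j' j := by
  obtain ⟨w1, i1, v1, i1', h1, h2, h3, h4, h5⟩ := h
  exact ⟨v1, i1', w1, i1, h2, h1, h3.symm, h5, h4⟩

theorem LocalSim.of_zero_zero {k m : ℕ} {w v : ZWord} {j j' : ℕ}
    (h : CK k (dec w j) (dec v j')) (hj : k ≤ j ∧ j < k + 3) (hj' : k ≤ j' ∧ j' < k + 3) :
    LocalSim k m w v j j' :=
  ⟨_, _, _, _, Or.inl ⟨rfl, rfl⟩, Or.inl ⟨rfl, rfl⟩, h, hj, hj'⟩

theorem LocalSim.of_one_one {k m : ℕ} {w v : ZWord} {j j' i i' : ℕ}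
    (h1 : Partner m (dec w j) j i) (h2 : Partner m (dec v j') j' i')
    (h : CK k (dec (dec w j) i) (dec (dec v j') i')) (hi : k ≤ i ∧ i < k + 3)
    (hi' : k ≤ i' ∧ i' < k + 3) : LocalSim k m w v j j' :=
  ⟨_, _, _, _, Or.inr ⟨i, h1, rfl, rfl⟩, Or.inr ⟨i', h2, rfl, rfl⟩, h, hi, hi'⟩

theorem LocalSim.of_one_zero {k m : ℕ} {w v : ZWord} {j j' i : ℕ}
    (h1 : Partner m (dec w j) j i)
    (h : CK k (dec (dec w j) i) (dec v j')) (hi : k ≤ i ∧ i < k + 3)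
    (hj' : k ≤ j' ∧ j' < k + 3) : LocalSim k m w v j j' :=
  ⟨_, _, _, _, Or.inr ⟨i, h1, rfl, rfl⟩, Or.inl ⟨rfl, rfl⟩, h, hi, hj'⟩

theorem LocalSim.of_zero_one {k m : ℕ} {w v : ZWord} {j j' i' : ℕ}
    (h2 : Partner m (dec v j') j' i')
    (h : CK k (dec w j) (dec (dec v j') i')) (hj : k ≤ j ∧ j < k + 3)
    (hi' : k ≤ i' ∧ i' < k + 3) : LocalSim k m w v j j' :=
  ⟨_, _, _, _, Or.inl ⟨rfl, rfl⟩, Or.inr ⟨i', h2, rfl, rfl⟩, h, hj, hi'⟩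

theorem Agree.ck {k : ℕ} {w v : ZWord} (h : Agree k w v) {x y z x' y' z' : ℤ}
    (hw : Win k w x y z) (hv : Win k v x' y' z')
    (h3 : Ck3 x y z x' y' z' ∨ Ck3 x' y' z' x y z) : CK k w v :=
  ⟨h, x, y, z, x', y', z', hw, hv, h3⟩

section LocalAnalysis

variable {k m : ℕ} {w v : ZWord} {a b c : ℤ}

/-- The move `acb → cab`. -/
theorem localSim_acb (hm : k + 2 < m) (hag : Agree k w v) (hw : Win k w a c b)
    (hv : Win k v c a b) (hab : a < b) (hbc : b < c) :
    LocalSim k m w v k (k + 1) ∧ LocalSim k m w v (k + 1) k ∧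
      LocalSim k m w v (k + 2) (k + 2) := by
  refine ⟨?_, ?_, ?_⟩
  · exact .of_zero_zero ((hag.dec (by omega) (by omega)).ck hw.dec0 hv.dec1
      (by unfold Ck3; omega)) (by omega) (by omega)
  · by_cases h1 : c - 1 = b
    · by_cases h2 : a = b - 1
      · exact .of_one_zero (hw.dec1.partner12 hm h1).1
          (((hag.dec (by omega) (by omega)).dec_left (by omega)).ck hw.dec1.dec2 hv.dec0
          (by unfold Ck3; omega)) (by omega) (by omega)
      · exact .of_one_one (hw.dec1.partner12 hm h1).1 (hv.dec0.partner02 hm h1 (by omega)).1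
          (((hag.dec (by omega) (by omega)).dec (by omega) (by omega)).ck hw.dec1.dec2
          hv.dec0.dec2 (by unfold Ck3; omega)) (by omega) (by omega)
    · exact .of_zero_zero ((hag.dec (by omega) (by omega)).ck hw.dec1 hv.dec0
        (by unfold Ck3; omega)) (by omega) (by omega)
  · by_cases h1 : b - 1 = a
    · exact .of_one_one (hw.dec2.partner02 hm h1.symm (by omega)).2
          (hv.dec2.partner12 hm h1.symm).2
          (((hag.dec (by omega) (by omega)).dec (by omega) (by omega)).ck hw.dec2.dec0
          hv.dec2.dec1 (by unfold Ck3; omega)) (by omega) (by omega)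
    · exact .of_zero_zero ((hag.dec (by omega) (by omega)).ck hw.dec2 hv.dec2
        (by unfold Ck3; omega)) (by omega) (by omega)

/-- The move `bac → bca`. -/
theorem localSim_bac (hm : k + 2 < m) (hag : Agree k w v) (hw : Win k w b a c)
    (hv : Win k v b c a) (hab : a < b) (hbc : b < c) :
    LocalSim k m w v k k ∧ LocalSim k m w v (k + 1) (k + 2) ∧
      LocalSim k m w v (k + 2) (k + 1) := by
  refine ⟨?_, ?_, ?_⟩
  · by_cases h1 : b - 1 = a
    · exact .of_one_one (hw.dec0.partner01 hm h1).1
          (hv.dec0.partner02 hm h1 (by omega)).1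
          (((hag.dec (by omega) (by omega)).dec (by omega) (by omega)).ck hw.dec0.dec1
          hv.dec0.dec2 (by unfold Ck3; omega)) (by omega) (by omega)
    · exact .of_zero_zero ((hag.dec (by omega) (by omega)).ck hw.dec0 hv.dec0
        (by unfold Ck3; omega)) (by omega) (by omega)
  · exact .of_zero_zero ((hag.dec (by omega) (by omega)).ck hw.dec1 hv.dec2
      (by unfold Ck3; omega)) (by omega) (by omega)
  · by_cases h1 : c - 1 = b
    · by_cases h2 : a = b - 1
      · exact .of_zero_one (hv.dec1.partner01 hm h1.symm).2
          (((hag.dec (by omega) (by omega)).dec_right (by omega)).ck hw.dec2 hv.dec1.dec0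
          (by unfold Ck3; omega)) (by omega) (by omega)
      · exact .of_one_one (hw.dec2.partner02 hm h1.symm (by omega)).2
          (hv.dec1.partner01 hm h1.symm).2
          (((hag.dec (by omega) (by omega)).dec (by omega) (by omega)).ck hw.dec2.dec0
          hv.dec1.dec0 (by unfold Ck3; omega)) (by omega) (by omega)
    · exact .of_zero_zero ((hag.dec (by omega) (by omega)).ck hw.dec2 hv.dec1
        (by unfold Ck3; omega)) (by omega) (by omega)

/-- The braid move. -/
theorem localSim_braid (hm : k + 2 < m) (hag : Agree k w v) (hw : Win k w a (a + 1) a)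
    (hv : Win k v (a + 1) a (a + 1)) :
    LocalSim k m w v k (k + 2) ∧ LocalSim k m w v (k + 2) k := by
  refine ⟨?_, ?_⟩
  · exact .of_zero_one (hv.dec2.partner12 hm (by omega)).2
      (((hag.dec (by omega) (by omega)).dec_right (by omega)).ck hw.dec0 hv.dec2.dec1
      (by unfold Ck3; omega)) (by omega) (by omega)
  · exact .of_zero_one (hv.dec0.partner01 hm (by omega)).1
      (((hag.dec (by omega) (by omega)).dec_right (by omega)).ck hw.dec2 hv.dec0.dec1
      (by unfold Ck3; omega)) (by omega) (by omega)

end LocalAnalysis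

/-- If the same two wires cross inside of the window at `j` in `w` and at `j'` in `v`, then the bumps
that continue there stay related. -/
theorem localSim_of_ck3 {k m : ℕ} {w v : ZWord} (hm : k + 2 < m) (hag : Agree k w v)
    {x y z x' y' z' : ℤ} (hw : Win k w x y z) (hv : Win k v x' y' z')
    (hck : Ck3 x y z x' y' z') {j j' : ℕ} (hj : k ≤ j ∧ j < k + 3) (hj' : k ≤ j' ∧ j' < k + 3)
    {X Y : ℤ} (h1 : Cross w j X Y) (h2 : Cross v j' X Y)
    (hr : Red (Function.update w j none) m) : LocalSim k m w v j j' := by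
  have hCK : CK k w v := hag.ck hw hv (Or.inl hck)
  have hX := hCK.pos_eq (Or.inl le_rfl) X
  have hY := hCK.pos_eq (Or.inl le_rfl) Y
  have uniq : ∀ i, (k ≤ i ∧ i < k + 3) → Cross v i X Y → j' = i := fun i hi hc =>
    hCK.symm.cross_unique hj' hi h2 hc
  obtain ⟨w1, w2, w3⟩ := id hw
  obtain ⟨v1, v2, v3⟩ := id hv
  obtain ⟨d, hd, hh⟩ := id h1
  have hjc : j = k ∨ j = k + 1 ∨ j = k + 2 := by omega
  rcases hck with ⟨rfl, rfl, rfl, a1, a2⟩ | ⟨rfl, rfl, rfl, a1, a2⟩ | ⟨rfl, rfl, rfl, rfl, rfl⟩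
  · obtain ⟨l1, l2, l3⟩ := localSim_acb hm hag hw hv a1 a2
    rcases hjc with rfl | rfl | rfl
    · rw [uniq (j + 1) (by omega) ⟨d, by rw [v2, ← hd, w1], ?_⟩]
      · exact l1
      · rw [w1, Option.some.injEq] at hd
        rw [pos_succ_some v1, pos_succ_some v1, hX, hY]
        split_ifs <;> omega
    · rw [uniq k (by omega) ⟨d, by rw [v1, ← hd, w2], ?_⟩]
      · exact l2
      · rw [w2, Option.some.injEq] at hd
        rw [pos_succ_some w1, pos_succ_some w1] at hh
        rw [hX, hY]
        split_ifs at hh <;> omega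
    · rw [uniq (k + 2) (by omega) ⟨d, by rw [v3, ← hd, w3], ?_⟩]
      · exact l3
      · have hcomm : ∀ t, pos v k t = pos w k t → pos v (k + 2) t = pos w (k + 2) t := by
          intro t ht
          rw [pos_succ, pos_succ, pos_succ, pos_succ, ht, v1, v2, w1, w2, gen_comm (by omega)]
        rw [hcomm X hX, hcomm Y hY]
        exact hh
  · obtain ⟨l1, l2, l3⟩ := localSim_bac hm hag hw hv a1 a2
    have hX1 : pos v (k + 1) X = pos w (k + 1) X := by rw [pos_succ, pos_succ, hX, v1, w1]
    have hY1 : pos v (k + 1) Y = pos w (k + 1) Y := by rw [pos_succ, pos_succ, hY, v1, w1]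
    rcases hjc with rfl | rfl | rfl
    · rw [uniq j (by omega) ⟨d, by rw [v1, ← hd, w1], by rw [hX, hY]; exact hh⟩]
      exact l1
    · rw [uniq (k + 2) (by omega) ⟨d, by rw [v3, ← hd, w2], ?_⟩]
      · exact l2
      · rw [w2, Option.some.injEq] at hd
        rw [pos_succ_some v2, pos_succ_some v2, hX1, hY1]
        split_ifs <;> omega
    · rw [uniq (k + 1) (by omega) ⟨d, by rw [v2, ← hd, w3], ?_⟩]
      · exact l3
      · rw [w3, Option.some.injEq] at hd
        rw [pos_succ_some w2, pos_succ_some w2] at hh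
        rw [hX1, hY1]
        split_ifs at hh <;> omega
  · obtain ⟨l1, l2⟩ := localSim_braid hm hag hw hv
    rcases hjc with rfl | rfl | rfl
    · rw [uniq (j + 2) (by omega) ⟨y' + 1, v3, ?_⟩]
      · exact l1
      · rw [w1, Option.some.injEq] at hd
        rw [pos_succ_some v2, pos_succ_some v2, pos_succ_some v1, pos_succ_some v1, hX, hY]
        split_ifs <;> omega
    · -- deleting the middle letter of `a(a+1)a` leaves two equal letters
      exfalso
      have u1 : Function.update w (k + 1) none k = some y' := by
        rw [Function.update_of_ne (by omega), w1]
      have u3 : Function.update w (k + 1) none (k + 2) = some y' := by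
        rw [Function.update_of_ne (by omega), w3]
      have h3 := cross_of_some u1
      refine hr k (k + 2) (by omega) hm _ _ h3 ⟨y', u3, ?_⟩
      have u2 : Function.update w (k + 1) none (k + 1) = none := by simp
      rw [pos_succ_none u2, pos_succ_none u2, h3.pos_left, h3.pos_right, pos_pre, pos_pre]
      omega
    · rw [uniq k (by omega) ⟨y' + 1, v1, ?_⟩]
      · exact l2
      · rw [w3, Option.some.injEq] at hd
        rw [pos_succ_some w2, pos_succ_some w2, pos_succ_some w1, pos_succ_some w1] at hh
        rw [hX, hY]
        generalize pos w k X = p at *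
        generalize pos w k Y = q at *
        split_ifs at hh <;> omega

theorem CK.localSim {k m : ℕ} {w v : ZWord} (hm : k + 2 < m) (h : CK k w v) {j j' : ℕ}
    (hj : k ≤ j ∧ j < k + 3) (hj' : k ≤ j' ∧ j' < k + 3)
    {X Y : ℤ} (h1 : Cross w j X Y) (h2 : Cross v j' X Y)
    (hr : Red (Function.update w j none) m) (hr' : Red (Function.update v j' none) m) :
    LocalSim k m w v j j' := by
  obtain ⟨hag, x, y, z, x', y', z', hw, hv, hc | hc⟩ := h
  · exact localSim_of_ck3 hm hag hw hv hc hj hj' h1 h2 hr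
  · exact (localSim_of_ck3 hm (fun l hl => (hag l hl).symm) hv hw hc hj' hj h2 h1 hr').symm

theorem pair_of_swap_eq {x y x' y' : ℤ} (h : Equiv.swap x y = Equiv.swap x' y') (hne : x ≠ y) :
    (x' = x ∧ y' = y) ∨ (x' = y ∧ y' = x) := by
  have h1 : Equiv.swap x' y' x = y := by rw [← h]; simp
  rw [Equiv.swap_apply_def] at h1
  split_ifs at h1 <;> omega

/-- Bumps of words that differ by a Coxeter–Knuth move end with such words. -/
theorem CK.exists_run {k m : ℕ} {w v : ZWord} {i i' : ℕ} {A A' : ℤ} (hk : k + 2 < m)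
    (hck : CK k w v) (hi : i < m) (hi' : i' < m)
    (hr : Red (Function.update w i none) m) (hr' : Red (Function.update v i' none) m)
    (hpre : pre (Function.update v i' none) m = pre (Function.update w i none) m)
    (hA : Mover w i A) (hA' : Mover v i' A')
    (hpos : (i' = i ∧ (i < k ∨ k + 3 ≤ i)) ∨ ((k ≤ i ∧ i < k + 3) ∧ (k ≤ i' ∧ i' < k + 3))) :
    ∃ w1 v1, Run m w i w1 ∧ Run m v i' v1 ∧ CK k w1 v1 := by
  induction hn : energy (Function.update w i none) m A using Nat.strong_induction_on
    generalizing w v i i' with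
  | _ n ih =>
    by_cases hw : Red w m
    · exact ⟨w, v, .halt _ _ hw, .halt _ _ (hck.red hk hw), hck⟩
    have hv : ¬ Red v m := fun hv => hw (hck.symm.red hk hv)
    obtain ⟨Z, hc, -⟩ := hA.exists_cross
    obtain ⟨Z', hc', -⟩ := hA'.exists_cross
    obtain ⟨j, hj, hji, hcj⟩ := exists_partner hi hr hw hc
    obtain ⟨j', hj', hji', hcj'⟩ := exists_partner hi' hr' hv hc'
    have hpw : Partner m w i j := ⟨hj, hji, Z, A, hc, hcj⟩
    obtain ⟨s1, s2, s3, s4⟩ := hpw.step hi hr hA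
    have hswap : Equiv.swap Z A = Equiv.swap Z' A' := by
      rw [hc.pre_erase hi, hc'.pre_erase hi', hck.pre_eq hk] at hpre
      exact (mul_right_cancel hpre).symm
    have hcv : Cross v i' Z A := by
      rcases pair_of_swap_eq hswap hc.ne with ⟨rfl, rfl⟩ | ⟨rfl, rfl⟩
      exacts [hc', hc'.symm]
    have hcjv : Cross v j' Z A := by
      rcases pair_of_swap_eq hswap hc.ne with ⟨rfl, rfl⟩ | ⟨rfl, rfl⟩
      exacts [hcj', hcj'.symm]
    by_cases hjo : j < k ∨ k + 3 ≤ j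
    · have hcjv' : Cross v j Z A := (hck.cross_outside hjo).2 hcj
      have hpv : Partner m v i' j := ⟨hj, by omega, Z, A, hcv, hcjv'⟩
      obtain ⟨t1, t2, t3, -⟩ := hpv.step hi' hr' hA'
      obtain ⟨w1, v1, r1, r2, r3⟩ := ih _ (hn ▸ s4) (hck.dec_outside hjo) hj hj s1 t1
        (by rw [t2, s2, hpre]) s3 t3 (Or.inl ⟨rfl, hjo⟩) rfl
      exact ⟨w1, v1, .push _ _ _ _ hpw r1, .push _ _ _ _ hpv r2, r3⟩
    · have hjw : k ≤ j ∧ j < k + 3 := by omega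
      -- two wires cross only once inside of the window, so that `i` is outside of it
      have hio : ¬ (k ≤ i ∧ i < k + 3) := fun h => hji (hck.cross_unique hjw h hcj hc)
      have hii : i' = i := by omega
      subst hii
      have hjw' : k ≤ j' ∧ j' < k + 3 := by
        by_contra hcon
        have hcon' : j' < k ∨ k + 3 ≤ j' := by omega
        have := partner_unique hr hc hj hj' hji hji' hcj ((hck.cross_outside hcon').1 hcjv)
        omega
      have hpv : Partner m v i' j' := ⟨hj', hji', Z, A, hcv, hcjv⟩
      obtain ⟨t1, t2, t3, -⟩ := hpv.step hi' hr' hA'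
      rw [dec_erase] at s1 t1
      obtain ⟨w2, i2, v2, i2', l1, l2, l3, l4, l5⟩ :=
        hck.localSim hk hjw hjw' hcj hcjv s1 t1
      rw [← dec_erase] at s1 t1
      obtain ⟨f1, f2, f3, f4, f5⟩ := l1.facts hj s1 s3
      obtain ⟨g1, g2, g3, g4, -⟩ := l2.facts hj' t1 t3
      obtain ⟨w1, v1, r1, r2, r3⟩ := ih _ (by omega) l3 f1 g1 f2 g2
        (by rw [g3, f3, t2, s2, hpre]) f4 g4 (Or.inr ⟨l4, l5⟩) rfl
      exact ⟨w1, v1, .push _ _ _ _ hpw (l1.run r1), .push _ _ _ _ hpv (l2.run r2), r3⟩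

theorem Bump.ck {k m : ℕ} {w w1 v : ZWord} (hk : k + 2 < m) (h : Bump m w w1) (hck : CK k w v) :
    ∃ v1, Bump m v v1 ∧ CK k w1 v1 := by
  obtain ⟨i, hi, hw, hr, hs, h⟩ := h
  obtain ⟨a, ha⟩ := Option.ne_none_iff_exists'.1 hs
  have hA := Mover.dec ha (A := pre w i a) (by simp)
  have hv := hck.red hk hw
  by_cases hio : i < k ∨ k + 3 ≤ i
  · have hsv : v i = some a := by rw [hck.1 i hio, ha]
    have hA' := Mover.dec hsv (A := pre v i a) (by simp)
    have hck' := hck.update_outside hio none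
    have hr' := hck'.red hk hr
    have hpre := hck'.pre_eq hk
    obtain ⟨w2, v2, r1, r2, r3⟩ := (hck.dec_outside hio).exists_run hk hi hi (by rwa [dec_erase])
      (by rwa [dec_erase]) (by rwa [dec_erase, dec_erase]) hA hA' (Or.inl ⟨rfl, hio⟩)
    obtain rfl := h.unique hi (by rwa [dec_erase]) hA r1
    exact ⟨v2, ⟨i, hi, hv, hr', by simp [hsv], r2⟩, r3⟩
  · have hiw : k ≤ i ∧ i < k + 3 := by omega
    have hc := cross_of_some ha
    set X := pre w i a
    set Y := pre w i (a + 1)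
    have h1 := (hw.pos_lt_before hi (Nat.zero_le i) hc).1 (by simp [X, Y])
    have h2 := (hw.pos_lt_after hi le_rfl hc.symm).2 (by simp [X, Y])
    rw [← pos_of_pre_eq (hck.pre_eq hk), ← pos_of_pre_eq (hck.pre_eq hk)] at h2
    obtain ⟨i', -, hi', hc'⟩ := exists_cross (Nat.zero_le m) (by simpa using h1) h2
    have hiw' : k ≤ i' ∧ i' < k + 3 := by
      by_contra hcon
      have := hw.eq_of_cross hi hi' hc ((hck.cross_outside (by omega)).1 hc')
      omega
    have hpre : pre (Function.update v i' none) m = pre (Function.update w i none) m := by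
      rw [hc.pre_erase hi, hc'.pre_erase hi', hck.pre_eq hk]
    have hr' : Red (Function.update v i' none) m := by
      refine hr.of_cnt_le hpre ?_
      have := cnt_erase hi hc.ne_none
      have := cnt_erase hi' hc'.ne_none
      have := hck.cnt_eq (m := m)
      omega
    obtain ⟨a', ha'⟩ := Option.ne_none_iff_exists'.1 hc'.ne_none
    have hA' := Mover.dec ha' (A := pre v i' a') (by simp)
    obtain ⟨w2, i2, v2, i2', l1, l2, l3, l4, l5⟩ := hck.localSim hk hiw hiw' hc hc' hr hr'
    obtain ⟨f1, f2, f3, f4, f5⟩ := l1.facts hi (by rwa [dec_erase]) hA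
    obtain ⟨g1, g2, g3, g4, -⟩ := l2.facts hi' (by rwa [dec_erase]) hA'
    obtain ⟨w3, v3, r1, r2, r3⟩ := l3.exists_run hk f1 g1 f2 g2
      (by rw [g3, f3, dec_erase, dec_erase, hpre]) f4 g4 (Or.inr ⟨l4, l5⟩)
    obtain rfl := h.unique hi (by rwa [dec_erase]) hA (l1.run r1)
    exact ⟨v3, ⟨i', hi', hv, hr', hc'.ne_none, l2.run r2⟩, r3⟩

/-! ### Words of positive letters as words over `ℤ` -/

/-- The list `w` as a word over `ℤ`, with all its letters shifted by `-s`. Incrementing all letters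
of `w` only changes the offset `s`. -/
def ofList (s : ℤ) (w : List ℕ) : ZWord := fun l => w[l]?.map fun a => (a : ℤ) - s

theorem ofList_of_lt {s : ℤ} {w : List ℕ} {l : ℕ} (h : l < w.length) :
    ofList s w l = some ((w[l] : ℤ) - s) := by
  simp [ofList, h]

theorem ofList_of_ge {s : ℤ} {w : List ℕ} {l : ℕ} (h : w.length ≤ l) : ofList s w l = none := by
  simp [ofList, h]

theorem wordPerm_append (v w : List ℕ) : wordPerm (v ++ w) = wordPerm v * wordPerm w := by
  simp [wordPerm]

theorem wordPerm_cons (c : ℕ) (w : List ℕ) :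
    wordPerm (c :: w) = Equiv.swap c (c + 1) * wordPerm w := by
  simp [wordPerm]

theorem wordPerm_take_succ {w : List ℕ} {l : ℕ} (h : l < w.length) :
    wordPerm (w.take (l + 1)) = wordPerm (w.take l) * Equiv.swap w[l] (w[l] + 1) := by
  rw [List.take_add_one, List.getElem?_eq_getElem h, wordPerm_append]
  simp [wordPerm]

theorem pre_ofList (s : ℤ) (w : List ℕ) (l a : ℕ) :
    pre (ofList s w) l ((a : ℤ) - s) = (wordPerm (w.take l) a : ℤ) - s := by
  induction l generalizing a with
  | zero => simp [pre, wordPerm]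
  | succ l ih =>
    rw [pre, Equiv.Perm.mul_apply]
    rcases lt_or_ge l w.length with h | h
    · rw [wordPerm_take_succ h, Equiv.Perm.mul_apply, ofList_of_lt h, ← ih, gen_some_apply,
        Equiv.swap_apply_def]
      congr 1
      split_ifs <;> push_cast <;> omega
    · rw [ofList_of_ge h, List.take_of_length_le (by omega), gen, Equiv.Perm.one_apply, ih,
        List.take_of_length_le h]

theorem pre_ofList_neg {s : ℤ} (w : List ℕ) (l : ℕ) {x : ℤ} (hx : x < -s) :
    pre (ofList s w) l x = x := by
  induction l with
  | zero => simp [pre]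
  | succ l ih =>
    rw [pre, Equiv.Perm.mul_apply]
    rcases lt_or_ge l w.length with h | h
    · rw [ofList_of_lt h, gen_some_apply, if_neg (by omega), if_neg (by omega), ih]
    · rw [ofList_of_ge h, gen, Equiv.Perm.one_apply, ih]

theorem pos_ofList_iff {s : ℤ} {w : List ℕ} {l a b : ℕ} :
    pos (ofList s w) l ((a : ℤ) - s) = (b : ℤ) - s ↔ wordPerm (w.take l) b = a := by
  constructor
  · intro h
    have h1 := pre_pos (ofList s w) l ((a : ℤ) - s)
    rw [h, pre_ofList] at h1
    omega
  · rintro rfl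
    rw [← pre_ofList, pos_pre]

theorem exists_nat_or_neg (s x : ℤ) : (∃ a : ℕ, x = (a : ℤ) - s) ∨ x < -s := by
  by_cases h : x < -s
  · exact Or.inr h
  · exact Or.inl ⟨(x + s).toNat, by omega⟩

theorem pre_ofList_eq_iff {s : ℤ} {w v : List ℕ} {l l' : ℕ} :
    pre (ofList s w) l = pre (ofList s v) l' ↔ wordPerm (w.take l) = wordPerm (v.take l') := by
  constructor
  · intro h
    ext a
    have := pre_ofList s w l a
    rw [h, pre_ofList] at this
    omega
  · intro h
    ext x
    rcases exists_nat_or_neg s x with ⟨a, rfl⟩ | hx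
    · rw [pre_ofList, pre_ofList, h]
    · rw [pre_ofList_neg w l hx, pre_ofList_neg v l' hx]

theorem swapsAt_iff {w : List ℕ} {l X Y : ℕ} (h : l < w.length) :
    SwapsAt w l X Y ↔
      (wordPerm (w.take l) w[l] = X ∧ wordPerm (w.take l) (w[l] + 1) = Y) ∨
      (wordPerm (w.take l) w[l] = Y ∧ wordPerm (w.take l) (w[l] + 1) = X) := by
  simp only [SwapsAt, swapped, h, true_and, List.getD_eq_getElem _ _ h, Sym2.eq_iff]

theorem cross_ofList {s : ℤ} {w : List ℕ} {l X Y : ℕ} :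
    Cross (ofList s w) l ((X : ℤ) - s) ((Y : ℤ) - s) ↔ SwapsAt w l X Y := by
  rcases lt_or_ge l w.length with h | h
  · rw [swapsAt_iff h, Cross]
    have e : ((w[l] : ℤ) - s + 1) = ((w[l] + 1 : ℕ) : ℤ) - s := by push_cast; ring
    simp only [ofList_of_lt h, Option.some.injEq]
    constructor
    · rintro ⟨c, rfl, hc⟩
      rw [e, pos_ofList_iff, pos_ofList_iff, pos_ofList_iff, pos_ofList_iff] at hc
      tauto
    · intro hc
      refine ⟨_, rfl, ?_⟩
      rw [e, pos_ofList_iff, pos_ofList_iff, pos_ofList_iff, pos_ofList_iff]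
      tauto
  · simp [Cross, SwapsAt, ofList_of_ge h, h.not_gt]

theorem Cross.exists_nat {s : ℤ} {w : List ℕ} {l : ℕ} {x y : ℤ} (h : Cross (ofList s w) l x y) :
    ∃ X Y : ℕ, x = (X : ℤ) - s ∧ y = (Y : ℤ) - s := by
  rcases lt_or_ge l w.length with hl | hl
  · have h1 := cross_of_some (ofList_of_lt (s := s) hl)
    have e : ((w[l] : ℤ) - s + 1) = ((w[l] + 1 : ℕ) : ℤ) - s := by push_cast; ring
    rw [e, pre_ofList, pre_ofList] at h1
    rcases h1.pair h with ⟨rfl, rfl⟩ | ⟨rfl, rfl⟩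
    exacts [⟨_, _, rfl, rfl⟩, ⟨_, _, rfl, rfl⟩]
  · exact (h.ne_none (ofList_of_ge hl)).elim

theorem exists_swapsAt {w : List ℕ} {l : ℕ} (h : l < w.length) : ∃ X Y, SwapsAt w l X Y :=
  ⟨_, _, (swapsAt_iff h).2 (Or.inl ⟨rfl, rfl⟩)⟩

/-- Omitting a letter multiplies the permutation by the transposition of the values that the letter
swaps. -/
theorem wordPerm_eraseIdx {w : List ℕ} {i X Y : ℕ} (h : SwapsAt w i X Y) :
    wordPerm (w.eraseIdx i) = Equiv.swap X Y * wordPerm w := by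
  have hi := h.1
  have hw : w = w.take i ++ w[i] :: w.drop (i + 1) := by
    rw [List.getElem_cons_drop, List.take_append_drop]
  have h2 : wordPerm (w.take i) * Equiv.swap w[i] (w[i] + 1) =
      Equiv.swap X Y * wordPerm (w.take i) := by
    rw [Equiv.mul_swap_eq_swap_mul]
    rcases (swapsAt_iff hi).1 h with ⟨rfl, rfl⟩ | ⟨rfl, rfl⟩
    · rfl
    · rw [Equiv.swap_comm]
  have h3 : wordPerm w = wordPerm (w.take i) * (Equiv.swap w[i] (w[i] + 1) *
      wordPerm (w.drop (i + 1))) := by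
    conv_lhs => rw [hw]
    rw [wordPerm_append, wordPerm_cons]
  rw [List.eraseIdx_eq_take_drop_succ, wordPerm_append, h3, ← mul_assoc, ← mul_assoc, ← h2,
    mul_assoc (wordPerm (w.take i)), Equiv.swap_mul_self, mul_one]

theorem swapsAt_eraseIdx_lt {w : List ℕ} {i j X Y : ℕ} (hij : i < j) (h : SwapsAt w i X Y)
    (hj : j < w.length) : SwapsAt (w.eraseIdx j) i X Y := by
  have h1 : i < (w.eraseIdx j).length := by rw [List.length_eraseIdx_of_lt hj]; omega
  rw [swapsAt_iff h.1] at h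
  rw [swapsAt_iff h1, List.getElem_eraseIdx_of_lt _ hij]
  have : (w.eraseIdx j).take i = w.take i := by
    rw [List.take_eraseIdx_eq_take_of_le _ _ _ hij.le]
  rw [this]
  exact h

theorem cnt_le (w : ZWord) (m : ℕ) : cnt w m ≤ m := by
  unfold cnt
  exact (Finset.card_filter_le _ _).trans (by simp)

theorem cnt_ofList (s : ℤ) (w : List ℕ) : cnt (ofList s w) w.length = w.length := by
  unfold cnt
  rw [Finset.filter_true_of_mem, Finset.card_range]
  intro l hl
  rw [ofList_of_lt (by simpa using hl)]
  simp

theorem isReduced_iff (s : ℤ) {w : List ℕ} :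
    IsReduced w ↔ (∀ a ∈ w, 0 < a) ∧ Red (ofList s w) w.length := by
  constructor
  · rintro ⟨h1, h2⟩
    refine ⟨h1, fun i j hij hj x y hi hjc => ?_⟩
    obtain ⟨X, Y, rfl, rfl⟩ := hi.exists_nat
    rw [cross_ofList] at hi hjc
    have e1 := wordPerm_eraseIdx hjc
    have hi' := swapsAt_eraseIdx_lt hij hi hj
    have e2 := wordPerm_eraseIdx hi'
    rw [e1, ← mul_assoc, Equiv.swap_mul_self, one_mul] at e2
    have := h2 _ (fun a ha => h1 a (List.mem_of_mem_eraseIdx (List.mem_of_mem_eraseIdx ha))) e2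
    rw [List.length_eraseIdx_of_lt hi'.1, List.length_eraseIdx_of_lt hj] at this
    omega
  · rintro ⟨h1, h2⟩
    refine ⟨h1, fun v _ hv => ?_⟩
    have := h2.cnt_le (v := ofList s v) (m' := v.length) (pre_ofList_eq_iff.2 (by simpa using hv))
    rw [cnt_ofList] at this
    exact this.trans (cnt_le _ _)

/-- A hole acts like an omitted letter. -/
theorem pos_skip {w v : ZWord} {i : ℕ} (h1 : ∀ l < i, v l = w l) (h2 : ∀ l, i ≤ l → v l = w (l + 1))
    {l : ℕ} (hl : i ≤ l) (x : ℤ) : pos v l x = pos (Function.update w i none) (l + 1) x := by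
  induction l, hl using Nat.le_induction with
  | base =>
    rw [pos_succ_none (by simp), pos_update_le _ _ le_rfl]
    exact pos_congr h1 x
  | succ l hl ih =>
    rw [pos_succ, pos_succ (Function.update w i none), ih, h2 l hl,
      Function.update_of_ne (by omega)]

theorem pre_eraseIdx {s : ℤ} {w : List ℕ} {i : ℕ} (hi : i < w.length) :
    pre (ofList s (w.eraseIdx i)) (w.eraseIdx i).length =
      pre (Function.update (ofList s w) i none) w.length := by
  rw [List.length_eraseIdx_of_lt hi]
  obtain ⟨n, hn⟩ : ∃ n, w.length = n + 1 := ⟨w.length - 1, by omega⟩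
  rw [hn]
  refine pre_eq_of_pos (pos_skip (fun l hl => ?_) (fun l hl => ?_) (by omega))
  · simp [ofList, List.getElem?_eraseIdx, hl]
  · simp [ofList, List.getElem?_eraseIdx, hl.not_gt]

theorem red_eraseIdx {s : ℤ} {w : List ℕ} {i : ℕ} (hi : i < w.length) :
    Red (ofList s (w.eraseIdx i)) (w.eraseIdx i).length ↔
      Red (Function.update (ofList s w) i none) w.length := by
  have h1 := pre_eraseIdx (s := s) hi
  have h2 : cnt (ofList s (w.eraseIdx i)) (w.eraseIdx i).length =
      cnt (Function.update (ofList s w) i none) w.length := by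
    have := cnt_erase (w := ofList s w) hi (by simp [ofList_of_lt hi])
    rw [cnt_ofList] at this
    rw [cnt_ofList, List.length_eraseIdx_of_lt hi]
    omega
  exact ⟨fun h => h.of_cnt_le h1.symm h2.ge, fun h => h.of_cnt_le h1 h2.le⟩

/-! ### Bumps of lists and of words over `ℤ` -/

theorem length_decr (w : List ℕ) (i : ℕ) : (decr w i).length = w.length := by
  unfold decr
  split_ifs <;> simp

theorem decr_pos {w : List ℕ} (i : ℕ) (h : ∀ a ∈ w, 0 < a) : ∀ a ∈ decr w i, 0 < a := by
  intro a ha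
  unfold decr at ha
  split_ifs at ha with h1
  · rw [List.mem_mapIdx] at ha
    obtain ⟨j, hj, rfl⟩ := ha
    split_ifs with h2
    · subst h2
      rw [List.getD_eq_getElem _ _ hj] at h1
      omega
    · exact h _ (List.getElem_mem hj)
  · rw [List.mem_mapIdx] at ha
    obtain ⟨j, hj, rfl⟩ := ha
    have := h _ (List.getElem_mem hj)
    split_ifs <;> omega

/-- Decrementing a letter of a list decrements the letter of the word over `ℤ`, possibly with a new
offset. -/
theorem exists_ofList_decr (s : ℤ) {w : List ℕ} {i : ℕ} :
    ∃ s', ofList s' (decr w i) = dec (ofList s w) i := by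
  unfold decr
  split_ifs with h1
  · refine ⟨s, funext fun l => ?_⟩
    by_cases hl : l = i
    · subst hl
      rcases lt_or_ge l w.length with h | h
      · rw [List.getD_eq_getElem _ _ h] at h1
        simp [ofList, h]
        omega
      · simp [ofList, h]
    · rw [dec_of_ne _ hl]
      simp [ofList, hl]
  · refine ⟨s + 1, funext fun l => ?_⟩
    by_cases hl : l = i
    · subst hl
      rcases lt_or_ge l w.length with h | h
      · simp [ofList, h]
        omega
      · simp [ofList, h]
    · rw [dec_of_ne _ hl]
      simp [ofList, hl]
      cases w[l]? <;> simp

theorem partner_ofList {s : ℤ} {w : List ℕ} {i j : ℕ} (hi : i < w.length) :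
    Partner w.length (ofList s w) i j ↔
      j < w.length ∧ j ≠ i ∧ swapped w j = swapped w i := by
  constructor
  · rintro ⟨h1, h2, x, y, h3, h4⟩
    obtain ⟨X, Y, rfl, rfl⟩ := h3.exists_nat
    rw [cross_ofList] at h3 h4
    exact ⟨h1, h2, by rw [h3.2, h4.2]⟩
  · rintro ⟨h1, h2, h3⟩
    obtain ⟨X, Y, h4⟩ := exists_swapsAt hi
    exact ⟨h1, h2, _, _, cross_ofList.2 h4, cross_ofList.2 ⟨h1, by rw [h3, h4.2]⟩⟩

theorem BumpRun.run {w v : List ℕ} {i : ℕ} (h : BumpRun w i v) (s : ℤ) (hi : i < w.length)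
    (hp : ∀ a ∈ w, 0 < a) :
    v.length = w.length ∧ IsReduced v ∧
      ∃ s', Run w.length (dec (ofList s w) i) i (ofList s' v) := by
  induction h generalizing s with
  | halt w i h =>
    obtain ⟨s', hs'⟩ := exists_ofList_decr s (w := w) (i := i)
    refine ⟨length_decr w i, h, s', ?_⟩
    rw [hs']
    refine .halt _ _ ?_
    have := ((isReduced_iff s').1 h).2
    rwa [hs', length_decr] at this
  | push w i j v h hj hij hs hv ih =>
    obtain ⟨s', hs'⟩ := exists_ofList_decr s (w := w) (i := i)
    obtain ⟨e1, e2, s'', e3⟩ := ih s' (by rwa [length_decr]) (decr_pos i hp)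
    rw [length_decr] at e1 e3
    refine ⟨e1, e2, s'', ?_⟩
    rw [hs'] at e3
    refine .push _ _ j _ ?_ e3
    have := (partner_ofList (s := s') (w := decr w i) (i := i) (j := j) (by rwa [length_decr])).2
      ⟨by rwa [length_decr], hij, hs⟩
    rwa [hs', length_decr] at this

theorem Run.exists_bumpRun {m : ℕ} {W V : ZWord} {i : ℕ} (h : Run m W i V) {s : ℤ} {w : List ℕ}
    (hm : w.length = m) (hW : W = dec (ofList s w) i) (hi : i < m) (hp : ∀ a ∈ w, 0 < a) :
    ∃ v, BumpRun w i v := by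
  induction h generalizing s w with
  | halt W i h =>
    obtain ⟨s', hs'⟩ := exists_ofList_decr s (w := w) (i := i)
    refine ⟨_, .halt w i ((isReduced_iff s').2 ⟨decr_pos i hp, ?_⟩)⟩
    rwa [length_decr, hs', hm, ← hW]
  | push W i j V hpart hv ih =>
    obtain ⟨s', hs'⟩ := exists_ofList_decr s (w := w) (i := i)
    obtain ⟨v, hv'⟩ := ih (s := s') (w := decr w i) (by rwa [length_decr])
      (by rw [hW, hs']) hpart.1 (decr_pos i hp)
    have hnr : ¬ IsReduced (decr w i) := by
      intro hr
      have := ((isReduced_iff s').1 hr).2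
      rw [length_decr, hs', hm, ← hW] at this
      exact hpart.not_red hi this
    rw [hW, ← hs', ← hm, ← length_decr w i] at hpart
    obtain ⟨f1, f2, f3⟩ := (partner_ofList (by rw [length_decr, hm]; exact hi)).1 hpart
    exact ⟨v, .push w i j v hnr (by rwa [length_decr] at f1) f2 f3 hv'⟩

theorem LittleBump.bump {w v : List ℕ} {i : ℕ} (h : LittleBump w i v) (s : ℤ) :
    v.length = w.length ∧ IsReduced v ∧ ∃ s', Bump w.length (ofList s w) (ofList s' v) := by
  obtain ⟨hi, h1, h2, h3⟩ := h
  obtain ⟨e1, e2, s', e3⟩ := h3.run s hi h1.1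
  refine ⟨e1, e2, s', i, hi, ((isReduced_iff s).1 h1).2, ?_, by simp [ofList_of_lt hi], e3⟩
  exact (red_eraseIdx hi).1 ((isReduced_iff s).1 h2).2

theorem exists_littleBump {w : List ℕ} {i : ℕ} (hi : i < w.length) (h1 : IsReduced w)
    (h2 : IsReduced (w.eraseIdx i)) : ∃ v, LittleBump w i v := by
  have h3 := (red_eraseIdx hi).1 ((isReduced_iff 0).1 h2).2
  have hA := Mover.dec (ofList_of_lt (s := 0) hi) (A := pre (ofList 0 w) i ((w[i] : ℤ) - 0))
    (by simp)
  obtain ⟨V, hV⟩ := exists_run hi (by rwa [dec_erase]) hA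
  obtain ⟨v, hv⟩ := hV.exists_bumpRun rfl rfl hi h1.1
  exact ⟨v, hi, h1, h2, hv⟩

/-! ### Termination of the Little map -/

/-- In a reduced word, the crossing of `x` and `y` may be omitted if no third wire crosses both of
them. -/
theorem Red.erase_of_cover {w : ZWord} {m i : ℕ} (hr : Red w m) (hi : i < m) {x y : ℤ}
    (hxy : x < y) (hc : Cross w i x y)
    (hcov : ∀ X, x < X → X < y → pos w m y < pos w m X → pos w m X < pos w m x → False) :
    Red (Function.update w i none) m := by
  have hadj : pos w i y = pos w i x + 1 := by
    have h1 := hr.pos_lt_before hi (Nat.zero_le i) hc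
    simp only [pos_zero] at h1
    have h2 := h1.2 hxy
    obtain ⟨c, -, h3⟩ := hc
    omega
  -- a wire `M` that crosses `x` and `y`, one of them before and the other one after `i`
  have side : ∀ j l M, j < i → i < l → l < m →
      (Cross w j x M ∧ Cross w l y M) ∨ (Cross w j y M ∧ Cross w l x M) → False := by
    intro j l M hj hl hlm h
    have hMx : pos w i M ≠ pos w i x := by
      rw [Ne, pos_inj]
      rcases h with ⟨h1, h2⟩ | ⟨h1, h2⟩
      exacts [h1.ne.symm, h2.ne.symm]
    have hMy : pos w i M ≠ pos w i y := by
      rw [Ne, pos_inj]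
      rcases h with ⟨h1, h2⟩ | ⟨h1, h2⟩
      exacts [h2.ne.symm, h1.ne.symm]
    have key : ∀ a b, Cross w j a M → Cross w l b M →
        (pos w i a < pos w i M ↔ M < a) ∧ (pos w i b < pos w i M ↔ b < M) ∧
        (pos w i M < pos w i a ↔ a < M) ∧ (pos w i M < pos w i b ↔ M < b) ∧
        (pos w m M < pos w m a ↔ a < M) ∧ (pos w m b < pos w m M ↔ M < b) ∧
        (pos w m a < pos w m M ↔ M < a) ∧ (pos w m M < pos w m b ↔ b < M) := by
      intro a b h1 h2
      have hjm : j < m := by omega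
      have z1 := hr.pos_lt_before hjm (Nat.zero_le j) h1.symm
      have z2 := hr.pos_lt_before hlm (Nat.zero_le l) h2
      have z1' := hr.pos_lt_before hjm (Nat.zero_le j) h1
      have z2' := hr.pos_lt_before hlm (Nat.zero_le l) h2.symm
      simp only [pos_zero] at z1 z2 z1' z2'
      refine ⟨?_, ?_, ?_, ?_, ?_, ?_, ?_, ?_⟩
      · rw [hr.pos_lt_after hj hi.le h1, z1]
      · rw [← hr.pos_lt_before hlm hl.le h2, z2]
      · rw [hr.pos_lt_after hj hi.le h1.symm, z1']
      · rw [← hr.pos_lt_before hlm hl.le h2.symm, z2']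
      · rw [hr.pos_lt_after hjm le_rfl h1.symm, z1']
      · rw [hr.pos_lt_after hlm le_rfl h2, z2']
      · rw [hr.pos_lt_after hjm le_rfl h1, z1]
      · rw [hr.pos_lt_after hlm le_rfl h2.symm, z2]
    rcases h with ⟨h1, h2⟩ | ⟨h1, h2⟩
    · obtain ⟨a1, a2, a3, a4, a5, a6, a7, a8⟩ := key x y h1 h2
      exact hcov M (by omega) (by omega) (by omega) (by omega)
    · obtain ⟨a1, a2, a3, a4, a5, a6, a7, a8⟩ := key y x h1 h2
      exact hcov M (by omega) (by omega) (by omega) (by omega)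
  intro j l hjl hl P Q h1 h2
  have hji : j ≠ i := by rintro rfl; exact h1.ne_none (by simp)
  have hli : l ≠ i := by rintro rfl; exact h2.ne_none (by simp)
  rcases lt_or_gt_of_ne hji with hj | hj
  · rw [cross_update_lt _ hj] at h1
    rcases lt_or_gt_of_ne hli with hl' | hl'
    · rw [cross_update_lt _ hl'] at h2
      exact hr j l hjl hl _ _ h1 h2
    · rw [hc.cross_erase hl'] at h2
      have hPQ := h1.ne
      by_cases p1 : P = x
      · subst p1
        by_cases q1 : Q = y
        · subst q1
          exact hji (hr.eq_of_cross (by omega) hi h1 hc)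
        · rw [Equiv.swap_apply_left, Equiv.swap_apply_of_ne_of_ne hPQ.symm q1] at h2
          exact side j l Q hj hl' hl (Or.inl ⟨h1, h2⟩)
      · by_cases p2 : P = y
        · subst p2
          by_cases q1 : Q = x
          · subst q1
            exact hji (hr.eq_of_cross (by omega) hi h1.symm hc)
          · rw [Equiv.swap_apply_right, Equiv.swap_apply_of_ne_of_ne q1 hPQ.symm] at h2
            exact side j l Q hj hl' hl (Or.inr ⟨h1, h2⟩)
        · rw [Equiv.swap_apply_of_ne_of_ne p1 p2] at h2
          by_cases q1 : Q = x
          · subst q1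
            rw [Equiv.swap_apply_left] at h2
            exact side j l P hj hl' hl (Or.inl ⟨h1.symm, h2.symm⟩)
          · by_cases q2 : Q = y
            · subst q2
              rw [Equiv.swap_apply_right] at h2
              exact side j l P hj hl' hl (Or.inr ⟨h1.symm, h2.symm⟩)
            · rw [Equiv.swap_apply_of_ne_of_ne q1 q2] at h2
              exact hr j l hjl hl _ _ h1 h2
  · rw [hc.cross_erase hj] at h1
    rw [hc.cross_erase (by omega)] at h2
    exact hr j l hjl hl _ _ h1 h2

/-- `(r, t)` is the lexicographically last inversion of the permutation `σ` of `ℤ`. -/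
def LastInv (σ : Equiv.Perm ℤ) (r t : ℤ) : Prop :=
  r < t ∧ σ t < σ r ∧ ∀ r' t', r' < t' → σ t' < σ r' → r' < r ∨ (r' = r ∧ t' ≤ t)

/-- `σ` is increasing on the positions up to `f`. -/
def IncUpTo (σ : Equiv.Perm ℤ) (f : ℤ) : Prop := ∀ p q, p < q → q ≤ f → σ p < σ q

/-- The one-line notation of the result of the bump at the last inversion: with `Z = τ r` and
`x = τ q`, the value `x` moves from the position `t` to `q < r`. The positions up to `f` stay
increasing, and the last inversion becomes smaller. -/
theorem lastInv_descends {σ τ : Equiv.Perm ℤ} {f r t q : ℤ} (hf : IncUpTo σ f)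
    (hl : LastInv σ r t) (hfr : f < r) (hqr : q < r) (hZ : σ q < σ t)
    (hτ : τ = Equiv.swap (σ q) (σ t) * (Equiv.swap (σ t) (σ r) * σ))
    (hcov : ∀ p, q < p → p < r → σ q < σ p → σ p < σ t → False) :
    IncUpTo τ f ∧ ∀ r' t', LastInv τ r' t' → r' < r ∨ (r' = r ∧ t' < t) := by
  obtain ⟨hrt, hinv, hlast⟩ := hl
  have inj : ∀ {a b}, σ a = σ b → a = b := fun h => σ.injective h
  have tq : τ q = σ t := by
    rw [hτ, Equiv.Perm.mul_apply, Equiv.Perm.mul_apply,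
      Equiv.swap_apply_of_ne_of_ne hZ.ne (hZ.trans hinv).ne, Equiv.swap_apply_left]
  have tr : τ r = σ q := by
    rw [hτ, Equiv.Perm.mul_apply, Equiv.Perm.mul_apply, Equiv.swap_apply_right,
      Equiv.swap_apply_right]
  have tt : τ t = σ r := by
    rw [hτ, Equiv.Perm.mul_apply, Equiv.Perm.mul_apply, Equiv.swap_apply_left,
      Equiv.swap_apply_of_ne_of_ne (by omega) (by omega)]
  have oth : ∀ p, p ≠ q → p ≠ r → p ≠ t → τ p = σ p := by
    intro p h1 h2 h3
    rw [hτ, Equiv.Perm.mul_apply, Equiv.Perm.mul_apply,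
      Equiv.swap_apply_of_ne_of_ne (fun h => h3 (inj h)) (fun h => h2 (inj h)),
      Equiv.swap_apply_of_ne_of_ne (fun h => h1 (inj h)) (fun h => h3 (inj h))]
  constructor
  · intro p p' hpp hp'
    have h1 := hf p p' hpp hp'
    by_cases e1 : p' = q
    · subst e1
      rw [tq, oth p (by omega) (by omega) (by omega)]
      omega
    · rw [oth p' e1 (by omega) (by omega)]
      by_cases e2 : p = q
      · subst e2
        rw [tq]
        have h2 : σ p' ≠ σ t := fun h => by have := inj h; omega
        by_contra h3
        exact hcov p' hpp (by omega) h1 (by omega)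
      · rw [oth p e2 (by omega) (by omega)]
        exact h1
  · rintro r' t' ⟨h1, h2, -⟩
    rcases lt_trichotomy r' r with h | h | h
    · exact Or.inl h
    · subst h
      refine Or.inr ⟨rfl, ?_⟩
      by_contra h3
      have h4 : t' ≠ t := by
        rintro rfl
        rw [tr, tt] at h2
        omega
      rw [tr, oth t' (by omega) (by omega) h4] at h2
      rcases hlast t t' (by omega) (by omega) with h5 | h5 <;> omega
    · exfalso
      by_cases e1 : r' = t
      · subst e1
        rw [tt, oth t' (by omega) (by omega) (by omega)] at h2
        rcases hlast r t' (by omega) h2 with h5 | h5 <;> omega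
      · rw [oth r' (by omega) (by omega) e1] at h2
        by_cases e2 : t' = t
        · subst e2
          rw [tt] at h2
          rcases hlast r' t' h1 (by omega) with h5 | h5 <;> omega
        · rw [oth t' (by omega) (by omega) e2] at h2
          rcases hlast r' t' h1 h2 with h5 | h5 <;> omega

theorem wordPerm_fix {w : List ℕ} {a : ℕ} (h : ∀ c ∈ w, a ≠ c ∧ a ≠ c + 1) : wordPerm w a = a := by
  induction w with
  | nil => simp [wordPerm]
  | cons c w ih =>
    rw [wordPerm_cons, Equiv.Perm.mul_apply, ih fun d hd => h d (List.mem_cons_of_mem _ hd)]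
    have := h c List.mem_cons_self
    exact Equiv.swap_apply_of_ne_of_ne this.1 this.2

theorem wordPerm_zero {w : List ℕ} (h : ∀ a ∈ w, 0 < a) : wordPerm w 0 = 0 :=
  wordPerm_fix fun c hc => by have := h c hc; omega

theorem pre_ofList_length (s : ℤ) (w : List ℕ) (a : ℕ) :
    pre (ofList s w) w.length ((a : ℤ) - s) = (wordPerm w a : ℤ) - s := by
  rw [pre_ofList, List.take_length]

/-- Inversions over `ℤ` come from inversions at positive positions. -/
theorem inv_ofList {s : ℤ} {w : List ℕ} (h : ∀ a ∈ w, 0 < a) {p q : ℤ} (hpq : p < q)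
    (hinv : pre (ofList s w) w.length q < pre (ofList s w) w.length p) :
    ∃ i j : ℕ, p = (i : ℤ) - s ∧ q = (j : ℤ) - s ∧ IsInversion (wordPerm w) i j := by
  have hp : (∃ i : ℕ, p = (i : ℤ) - s) := by
    rcases exists_nat_or_neg s p with hp | hp
    · exact hp
    · exfalso
      rw [pre_ofList_neg w _ hp] at hinv
      rcases exists_nat_or_neg s q with ⟨j, rfl⟩ | hq
      · rw [pre_ofList_length] at hinv
        omega
      · rw [pre_ofList_neg w _ hq] at hinv
        omega
  obtain ⟨i, rfl⟩ := hp
  rcases exists_nat_or_neg s q with ⟨j, rfl⟩ | hq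
  · rw [pre_ofList_length, pre_ofList_length] at hinv
    refine ⟨i, j, rfl, rfl, ?_, by omega, by omega⟩
    by_contra hi
    obtain rfl : i = 0 := by omega
    rw [wordPerm_zero h] at hinv
    omega
  · omega

theorem IsLastInversion.lastInv {s : ℤ} {w : List ℕ} (h : ∀ a ∈ w, 0 < a) {r t : ℕ}
    (hl : IsLastInversion (wordPerm w) r t) :
    LastInv (pre (ofList s w) w.length) ((r : ℤ) - s) ((t : ℤ) - s) := by
  obtain ⟨⟨h1, h2, h3⟩, h4⟩ := hl
  refine ⟨by omega, by rw [pre_ofList_length, pre_ofList_length]; omega, ?_⟩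
  intro r' t' hrt hinv
  obtain ⟨i, j, rfl, rfl, hij⟩ := inv_ofList h hrt hinv
  have := h4 i j hij
  omega

theorem exists_isLastInversion {w : List ℕ} (h : IsReduced w) (hw : w ≠ []) :
    ∃ r t, IsLastInversion (wordPerm w) r t := by
  have hm : 0 < w.length := List.length_pos_iff.2 hw
  have hred := ((isReduced_iff 0).1 h).2
  obtain ⟨X, Y, hXY⟩ := exists_swapsAt hm
  have hc := (cross_ofList (s := 0)).2 hXY
  have hne := hc.ne
  obtain ⟨x, y, hxy, hinv⟩ : ∃ x y : ℤ, x < y ∧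
      pos (ofList 0 w) w.length y < pos (ofList 0 w) w.length x := by
    rcases lt_or_gt_of_ne hne with hlt | hlt
    · exact ⟨_, _, hlt, (hred.pos_lt_after hm le_rfl hc.symm).2 (by simpa using hlt)⟩
    · exact ⟨_, _, hlt, (hred.pos_lt_after hm le_rfl hc).2 (by simpa using hlt)⟩
  obtain ⟨i, j, -, -, hij⟩ := inv_ofList h.1 hinv (by rwa [pre_pos, pre_pos])
  obtain ⟨N, hN⟩ : ∃ N, ∀ c ∈ w, c + 1 < N :=
    ⟨w.sum + 2, fun c hc => by have := List.single_le_sum (by simp) c hc; omega⟩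
  have hbound : ∀ i j, IsInversion (wordPerm w) i j → j < N := by
    intro i j ⟨_, h2, h3⟩
    by_contra hj
    have e1 : wordPerm w j = j := wordPerm_fix fun c hc => by have := hN c hc; omega
    have e2 : wordPerm w (wordPerm w i) = wordPerm w i :=
      wordPerm_fix fun c hc => by have := hN c hc; omega
    have := (wordPerm w).injective e2
    omega
  classical
  let S := ((Finset.range N ×ˢ Finset.range N).filter
    fun p => IsInversion (wordPerm w) p.1 p.2).image toLex
  have hmem : ∀ i j, toLex (i, j) ∈ S ↔ IsInversion (wordPerm w) i j := by
    intro i j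
    simp only [S, Finset.mem_image, Finset.mem_filter, Finset.mem_product, Finset.mem_range]
    constructor
    · rintro ⟨p, hp, he⟩
      obtain rfl := toLex.injective he
      exact hp.2
    · intro h
      have h1 := hbound i j h
      exact ⟨(i, j), ⟨⟨h.2.1.trans h1, h1⟩, h⟩, rfl⟩
  have hS : S.Nonempty := ⟨_, (hmem i j).2 hij⟩
  have hmax := S.max'_mem hS
  set p := S.max' hS with hp
  obtain ⟨r, t, hrt⟩ : ∃ r t, p = toLex (r, t) := ⟨(ofLex p).1, (ofLex p).2, rfl⟩
  rw [hrt] at hmax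
  refine ⟨r, t, (hmem r t).1 hmax, fun i' j' h' => ?_⟩
  have := S.le_max' _ ((hmem i' j').2 h')
  rw [← hp, hrt, Prod.Lex.toLex_le_toLex] at this
  simpa using this

/-- At the last inversion, the procedure defining the Little map can perform a bump, and the bump
has the effect described by `lastInv_descends`. -/
theorem exists_bump_of_lastInversion {w : List ℕ} (hw : IsReduced w) {r t : ℕ}
    (hl : IsLastInversion (wordPerm w) r t) (s : ℤ) :
    ∃ i v s', SwapsAt w i (wordPerm w r) (wordPerm w t) ∧ LittleBump w i v ∧ IsReduced v ∧
      v.length = w.length ∧ ∃ q : ℤ, q < (r : ℤ) - s ∧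
      pre (ofList s w) w.length q < pre (ofList s w) w.length ((t : ℤ) - s) ∧
      pre (ofList s' v) v.length = Equiv.swap (pre (ofList s w) w.length q)
          (pre (ofList s w) w.length ((t : ℤ) - s)) *
        (Equiv.swap (pre (ofList s w) w.length ((t : ℤ) - s))
          (pre (ofList s w) w.length ((r : ℤ) - s)) * pre (ofList s w) w.length) ∧
      ∀ p, q < p → p < (r : ℤ) - s →
        pre (ofList s w) w.length q < pre (ofList s w) w.length p →
        pre (ofList s w) w.length p < pre (ofList s w) w.length ((t : ℤ) - s) → False := by
  set W := ofList s w with hW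
  set m := w.length with hm
  have hred : Red W m := ((isReduced_iff s).1 hw).2
  obtain ⟨h1, h2, h3⟩ := hl.lastInv (s := s) hw.1
  rw [← hW, ← hm] at h2 h3
  set R : ℤ := (r : ℤ) - s
  set T : ℤ := (t : ℤ) - s
  set x := pre W m T with hx
  set y := pre W m R with hy
  have hpx : pos W m x = T := pos_pre _ _ _
  have hpy : pos W m y = R := pos_pre _ _ _
  obtain ⟨i, -, hi, hc⟩ := exists_cross (w := W) (Nat.zero_le m) (x := x) (y := y)
    (by simpa using h2) (by rw [hpx, hpy]; exact h1)
  have hu : Red (Function.update W i none) m := by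
    refine hred.erase_of_cover hi h2 hc ?_
    intro X a1 a2 a3 a4
    rw [hpy] at a3
    rw [hpx] at a4
    rcases h3 (pos W m X) T a4 (by rw [pre_pos]; exact a1) with h | h <;> omega
  have hxn : x = (wordPerm w t : ℤ) - s := pre_ofList_length s w t
  have hyn : y = (wordPerm w r : ℤ) - s := pre_ofList_length s w r
  have hsw : SwapsAt w i (wordPerm w r) (wordPerm w t) := by
    rw [← cross_ofList (s := s), ← hxn, ← hyn]
    exact hc.symm
  have her : IsReduced (w.eraseIdx i) := (isReduced_iff s).2
    ⟨fun a ha => hw.1 a (List.mem_of_mem_eraseIdx ha), (red_eraseIdx hi).2 hu⟩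
  obtain ⟨v, hv⟩ := exists_littleBump hi hw her
  obtain ⟨f1, f2, s', f3⟩ := hv.2.2.2.run s hi hw.1
  rw [← hm, ← hW] at f3
  obtain ⟨c, hwc, hcc⟩ := id hc
  have hlt := (hred.pos_lt_before hi (Nat.zero_le i) hc).2 (by simpa using h2)
  have hA : Mover (dec W i) i x := Mover.dec hwc (by omega)
  obtain ⟨-, Z, g1, g2, g3, g4⟩ := f3.result hi (by rwa [dec_erase]) hA
  rw [dec_erase, hc.pre_erase hi] at g3
  rw [dec_erase, hc.pos_erase hi, hc.pos_erase hi, Equiv.swap_apply_left,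
    Equiv.swap_apply_of_ne_of_ne (by omega) (by omega), hpy] at g2
  refine ⟨i, v, s', hsw, hv, f2, f1, pos W m Z, g2, by rw [pre_pos]; exact g1,
    by rw [pre_pos, f1]; exact g3, ?_⟩
  intro p b1 b2 b3 b4
  rw [pre_pos] at b3
  have hpp : pos W m (pre W m p) = p := pos_pre _ _ _
  refine g4 (pre W m p) b3 b4 ?_ ?_
  · rw [dec_erase, hc.pos_erase hi, hc.pos_erase hi,
      Equiv.swap_apply_of_ne_of_ne (by omega) (by omega),
      Equiv.swap_apply_of_ne_of_ne (by omega) (by omega), hpp]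
    exact b1
  · rw [dec_erase, hc.pos_erase hi, hc.pos_erase hi, Equiv.swap_apply_left,
      Equiv.swap_apply_of_ne_of_ne (by omega) (by omega), hpp, hpy]
    exact b2

/-- The procedure terminates. If the permutation is increasing up to the position `f`, then so
are all the later ones (up to shifts), and the last inversion decreases lexicographically. -/
theorem exists_LS_of_incUpTo (a b : ℕ) : ∀ {w : List ℕ} {s f : ℤ} {r t : ℕ}, IsReduced w →
    w ≠ [] → IncUpTo (pre (ofList s w) w.length) f → IsLastInversion (wordPerm w) r t →
    ((r : ℤ) - s - f).toNat = a → t - r = b → ∃ T, LS w T := by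
  induction a using Nat.strong_induction_on generalizing b with
  | _ a iha =>
  induction b using Nat.strong_induction_on with
  | _ b ihb =>
  intro w s f r t hw hne hf hl ha hb
  by_cases hG : IsGrassmannian w
  · obtain ⟨k, hk⟩ := hG
    exact ⟨_, .grassmannian w k hk⟩
  have hlz := hl.lastInv (s := s) hw.1
  -- otherwise `r` would be the only descent
  have hfr : f < (r : ℤ) - s := by
    by_contra hcon
    obtain ⟨h1, h2, h3⟩ := hlz
    have e1 : ((r : ℤ) - s) = f := by
      by_contra hne'
      by_cases htf : (t : ℤ) - s ≤ f
      · have := hf _ _ h1 htf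
        omega
      · have := hf ((r : ℤ) - s) f (by omega) le_rfl
        rcases h3 f ((t : ℤ) - s) (by omega) (by omega) with h | h <;> omega
    refine hG ⟨r, hw, fun i => ⟨fun hd => ?_, ?_⟩⟩
    · have h4 := hl.2 i (i + 1) hd
      by_contra hir
      have h5 := hf ((i : ℤ) - s) (((i + 1 : ℕ) : ℤ) - s) (by push_cast; omega)
        (by push_cast; omega)
      rw [pre_ofList_length, pre_ofList_length] at h5
      have := hd.2.2
      omega
    · rintro rfl
      refine ⟨hl.1.1, by omega, ?_⟩
      have h6 := hl.1.2.1
      have h7 := hl.1.2.2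
      by_contra h8
      by_cases h9 : i + 1 = t
      · subst h9; omega
      · have := hl.2 (i + 1) t ⟨by omega, by omega, by omega⟩
        omega
  obtain ⟨i, v, s', hsw, hv, hvr, hvl, q, q1, q2, q3, q4⟩ :=
    exists_bump_of_lastInversion hw hl s
  obtain ⟨g1, g2⟩ := lastInv_descends hf hlz hfr q1 q2 q3 q4
  have hvne : v ≠ [] := by
    rw [← List.length_pos_iff, hvl]
    exact List.length_pos_iff.2 hne
  obtain ⟨r', t', hl'⟩ := exists_isLastInversion hvr hvne
  have h5 := g2 _ _ (hl'.lastInv (s := s') hvr.1)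
  have hrt' := hl'.1.2.1
  have hrt := hl.1.2.1
  have : ∃ T, LS v T := by
    rcases h5 with h5 | ⟨h5, h6⟩
    · exact iha _ (by omega) _ hvr hvne g1 hl' rfl rfl
    · exact ihb _ (by omega) hvr hvne g1 hl' (by omega) rfl
  obtain ⟨T, hT⟩ := this
  exact ⟨T, .bump w r t i v T hG hl hsw hv hT⟩

theorem exists_LS {w : List ℕ} (hw : IsReduced w) (hne : w ≠ []) : ∃ T, LS w T := by
  obtain ⟨r, t, hl⟩ := exists_isLastInversion hw hne
  refine exists_LS_of_incUpTo _ _ (s := 0) (f := 0) hw hne ?_ hl rfl rfl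
  intro p q hpq hq
  by_contra hcon
  have hinv : pre (ofList 0 w) w.length q < pre (ofList 0 w) w.length p := by
    have : pre (ofList 0 w) w.length q ≠ pre (ofList 0 w) w.length p := fun h => by
      have := (pre (ofList 0 w) w.length).injective h
      omega
    omega
  obtain ⟨i, j, rfl, rfl, h⟩ := inv_ofList hw.1 hpq hinv
  have := h.1
  omega

/-! ### Reduced words of Grassmannian permutations -/

/-- `V` is a reduced word without holes of a permutation whose only descent is at most `κ`. -/
structure Gr (V : ZWord) (m : ℕ) (κ : ℤ) : Prop where
  red : Red V m
  full : ∀ l < m, V l ≠ none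
  inc_le : ∀ p q, p < q → q ≤ κ → pre V m p < pre V m q
  inc_gt : ∀ p q, κ < p → p < q → pre V m p < pre V m q

/-- The wire that ends at the position `κ - p`. -/
def wireA (V : ZWord) (m : ℕ) (κ : ℤ) (p : ℕ) : ℤ := pre V m (κ - p)

/-- The wire that ends at the position `κ + 1 + q`. -/
def wireB (V : ZWord) (m : ℕ) (κ : ℤ) (q : ℕ) : ℤ := pre V m (κ + 1 + q)

/-- The part with index `p` of the partition of the Grassmannian permutation given by the letters with
indices from `l` on. -/
def sh (V : ZWord) (m : ℕ) (κ : ℤ) (l p : ℕ) : ℤ := pos V l (wireA V m κ p) - (κ - p)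

section Grassmannian

variable {V : ZWord} {m : ℕ} {κ : ℤ}

theorem not_cross_of_lt_of_lt {w : ZWord} {m : ℕ} (hr : Red w m) {x y : ℤ} (h1 : x < y)
    (h2 : pos w m x < pos w m y) {l : ℕ} (hl : l < m) : ¬ Cross w l x y := by
  intro hc
  have a1 := hr.pos_lt_before hl (Nat.zero_le l) hc
  have a2 := hr.pos_lt_after hl le_rfl hc
  simp only [pos_zero] at a1
  have := a1.2 h1
  have := a2.1 h2
  omega

theorem pos_lt_of_lt_of_lt {w : ZWord} {m : ℕ} (hr : Red w m) {x y : ℤ} (h1 : x < y)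
    (h2 : pos w m x < pos w m y) {l : ℕ} (hl : l ≤ m) : pos w l x < pos w l y :=
  (pos_lt_iff_of_not_cross (Nat.zero_le l) fun i _ hi =>
    not_cross_of_lt_of_lt hr h1 h2 (by omega)).2 (by simpa using h1)

theorem pos_wireA (p : ℕ) : pos V m (wireA V m κ p) = κ - p := pos_pre _ _ _

theorem pos_wireB (q : ℕ) : pos V m (wireB V m κ q) = κ + 1 + q := pos_pre _ _ _

theorem wireA_inj {p p' : ℕ} (h : wireA V m κ p = wireA V m κ p') : p = p' := by
  have := (pre V m).injective h
  omega

theorem wireB_inj {p p' : ℕ} (h : wireB V m κ p = wireB V m κ p') : p = p' := by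
  have := (pre V m).injective h
  omega

theorem wireA_ne_wireB {p q : ℕ} : wireA V m κ p ≠ wireB V m κ q := by
  intro h
  have := (pre V m).injective h
  omega

theorem Gr.wireA_lt (h : Gr V m κ) {p p' : ℕ} (hp : p < p') {l : ℕ} (hl : l ≤ m) :
    pos V l (wireA V m κ p') < pos V l (wireA V m κ p) :=
  pos_lt_of_lt_of_lt h.red (h.inc_le _ _ (by omega) (by omega))
    (by rw [pos_pre, pos_pre]; omega) hl

theorem Gr.wireB_lt (h : Gr V m κ) {q q' : ℕ} (hq : q < q') {l : ℕ} (hl : l ≤ m) :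
    pos V l (wireB V m κ q) < pos V l (wireB V m κ q') :=
  pos_lt_of_lt_of_lt h.red (h.inc_gt _ _ (by omega) (by omega))
    (by rw [pos_pre, pos_pre]; omega) hl

@[simp] theorem sh_self (p : ℕ) : sh V m κ m p = 0 := by simp [sh, pos_wireA]

/-- Each letter adds one box to the partition. -/
theorem Gr.cross_step (h : Gr V m κ) {l : ℕ} (hl : l < m) : ∃ p q : ℕ,
    Cross V l (wireA V m κ p) (wireB V m κ q) ∧
    sh V m κ l p = sh V m κ (l + 1) p + 1 ∧
    ∀ p', p' ≠ p → sh V m κ l p' = sh V m κ (l + 1) p' := by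
  obtain ⟨c, hc⟩ := Option.ne_none_iff_exists'.1 (h.full l hl)
  have hx := cross_of_some hc
  set A := pre V l c with hA
  set B := pre V l (c + 1) with hB
  have h0 := (h.red.pos_lt_before hl (Nat.zero_le l) hx).1 (by simp [hA, hB])
  have hm := (h.red.pos_lt_after hl le_rfl hx.symm).2 (by simp [hA, hB])
  simp only [pos_zero] at h0
  have eA : pre V m (pos V m A) = A := pre_pos _ _ _
  have eB : pre V m (pos V m B) = B := pre_pos _ _ _
  have h1 : pos V m B ≤ κ := by
    by_contra hcon
    have := h.inc_gt _ _ (by omega) hm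
    omega
  have h2 : κ < pos V m A := by
    by_contra hcon
    have := h.inc_le _ _ hm (by omega)
    omega
  have e1 : wireA V m κ (κ - pos V m B).toNat = B := by
    rw [wireA, Int.toNat_of_nonneg (by omega), sub_sub_cancel, eB]
  have e2 : wireB V m κ (pos V m A - κ - 1).toNat = A := by
    rw [wireB, Int.toNat_of_nonneg (by omega)]
    rw [show κ + 1 + (pos V m A - κ - 1) = pos V m A by ring, eA]
  have lA : pos V l A = c := pos_pre _ _ _
  have lB : pos V l B = c + 1 := pos_pre _ _ _
  refine ⟨(κ - pos V m B).toNat, (pos V m A - κ - 1).toNat, ?_, ?_, ?_⟩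
  · rw [e1, e2]
    exact hx.symm
  · unfold sh
    rw [e1, hx.pos_right, lA, lB]
    ring
  · intro p' hp'
    unfold sh
    have n1 : wireA V m κ p' ≠ B := fun h' => hp' (wireA_inj (h'.trans e1.symm))
    have n2 : wireA V m κ p' ≠ A := fun h' => wireA_ne_wireB (h'.trans e2.symm)
    rw [hx.pos_succ_eq, Equiv.swap_apply_of_ne_of_ne n2 n1]

theorem Gr.sh_succ_le (h : Gr V m κ) {l : ℕ} (hl : l < m) (p : ℕ) :
    sh V m κ (l + 1) p ≤ sh V m κ l p := by
  obtain ⟨p0, q, -, h1, h2⟩ := h.cross_step hl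
  by_cases hp : p = p0
  · subst hp; omega
  · exact (h2 p hp).ge

theorem Gr.sh_anti (h : Gr V m κ) {l l' : ℕ} (hll : l ≤ l') (hl : l' ≤ m) (p : ℕ) :
    sh V m κ l' p ≤ sh V m κ l p := by
  induction l', hll using Nat.le_induction with
  | base => rfl
  | succ l' hll ih => exact (h.sh_succ_le (by omega) p).trans (ih (by omega))

theorem Gr.sh_nonneg (h : Gr V m κ) {l : ℕ} (hl : l ≤ m) (p : ℕ) : 0 ≤ sh V m κ l p := by
  have := h.sh_anti hl le_rfl p
  simpa using this

theorem Gr.sh_antitone (h : Gr V m κ) {l : ℕ} (hl : l ≤ m) (p : ℕ) :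
    sh V m κ l (p + 1) ≤ sh V m κ l p := by
  have := h.wireA_lt (Nat.lt_add_one p) hl
  unfold sh
  push_cast
  omega

/-- The wires `a_p` and `b_q` are crossed from `l` on exactly if the partition contains the
cell in row `p` and column `q`. -/
theorem Gr.wireB_lt_wireA_iff (h : Gr V m κ) {l : ℕ} (hl : l ≤ m) : ∀ p q : ℕ,
    pos V l (wireB V m κ q) < pos V l (wireA V m κ p) ↔ (q : ℤ) < sh V m κ l p := by
  induction hl using Nat.decreasingInduction with
  | self =>
    intro p q
    rw [pos_wireA, pos_wireB, sh_self]
    omega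
  | of_succ l hlm ih =>
    intro p q
    obtain ⟨p0, q0, hc, h1, h2⟩ := h.cross_step hlm
    have other : ∀ p q, ¬ (p = p0 ∧ q = q0) →
        (pos V l (wireB V m κ q) < pos V l (wireA V m κ p) ↔ (q : ℤ) < sh V m κ (l + 1) p) := by
      intro p q hpq
      rw [← ih p q, pos_lt_succ_iff]
      intro hc'
      rcases hc.pair hc' with ⟨e1, e2⟩ | ⟨e1, e2⟩
      · exact wireA_ne_wireB e1.symm
      · exact hpq ⟨wireA_inj e2, wireB_inj e1⟩
    have hc1 : pos V l (wireB V m κ q0) < pos V l (wireA V m κ p0) := by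
      have e1 := h.red.pos_lt_after hlm le_rfl hc
      rw [pos_wireA, pos_wireB] at e1
      exact e1.1 (by omega)
    have hc2 : ¬ ((q0 : ℤ) < sh V m κ (l + 1) p0) := by
      rw [← ih p0 q0, hc.pos_left, hc.pos_right]
      omega
    have hq0 : (q0 : ℤ) = sh V m κ (l + 1) p0 := by
      by_contra hne
      have hnn := h.sh_nonneg (l := l + 1) hlm p0
      obtain ⟨q', hq'⟩ : ∃ q' : ℕ, (q' : ℤ) = sh V m κ (l + 1) p0 := ⟨_, Int.toNat_of_nonneg hnn⟩
      have h3 := h.wireB_lt (show q' < q0 by omega) hlm.le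
      have h4 := (other p0 q' (by omega)).1 (by omega)
      omega
    by_cases hpq : p = p0 ∧ q = q0
    · obtain ⟨rfl, rfl⟩ := hpq
      exact ⟨fun _ => by omega, fun _ => hc1⟩
    · rw [other p q hpq]
      by_cases hp : p = p0
      · subst hp
        have : q ≠ q0 := fun hq => hpq ⟨rfl, hq⟩
        omega
      · rw [h2 p hp]

theorem Gr.cross_column (h : Gr V m κ) {l : ℕ} (hl : l < m) {p q : ℕ}
    (hc : Cross V l (wireA V m κ p) (wireB V m κ q)) :
    (q : ℤ) = sh V m κ (l + 1) p ∧ sh V m κ l p = sh V m κ (l + 1) p + 1 := by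
  obtain ⟨p0, q0, hc0, h1, h2⟩ := h.cross_step hl
  have e : p = p0 := by
    rcases hc0.pair hc with ⟨e1, e2⟩ | ⟨e1, e2⟩
    · exact wireA_inj e1
    · exact (wireA_ne_wireB e1).elim
  subst e
  have e1 := h.red.pos_lt_after hl le_rfl hc
  rw [pos_wireA, pos_wireB] at e1
  have e2 := (h.wireB_lt_wireA_iff hl.le p q).1 (e1.1 (by omega))
  have e3 := h.wireB_lt_wireA_iff (l := l + 1) hl p q
  rw [hc.pos_left, hc.pos_right] at e3
  have := e3.not.1 (by omega)
  exact ⟨by omega, h1⟩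

theorem Gr.sum_sh (h : Gr V m κ) {K : ℕ} (hK : ∀ p, K ≤ p → sh V m κ 0 p = 0) {l : ℕ}
    (hl : l ≤ m) : ∑ p ∈ Finset.range K, sh V m κ l p = (m : ℤ) - l := by
  induction hl using Nat.decreasingInduction with
  | self => simp
  | of_succ l hlm ih =>
    obtain ⟨p0, q, -, h1, h2⟩ := h.cross_step hlm
    have hp0 : p0 < K := by
      by_contra hcon
      have e1 := h.sh_anti (Nat.zero_le l) hlm.le p0
      have e2 := h.sh_nonneg (l := l + 1) hlm p0
      rw [hK p0 (by omega)] at e1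
      omega
    rw [← Finset.add_sum_erase _ _ (Finset.mem_range.2 hp0)] at ih ⊢
    have h3 : ∑ p ∈ (Finset.range K).erase p0, sh V m κ l p =
        ∑ p ∈ (Finset.range K).erase p0, sh V m κ (l + 1) p :=
      Finset.sum_congr rfl fun p hp => h2 p (Finset.ne_of_mem_erase hp)
    rw [h1, h3]
    push_cast at ih
    linarith

/-- A wire that moves from the right of `P` to `P` or to the left of it does so by the letter `P`. -/
theorem exists_drop {w : ZWord} {a b : ℕ} (hab : a ≤ b) {x P : ℤ} (h1 : P + 1 ≤ pos w a x)
    (h2 : pos w b x ≤ P) :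
    ∃ l, a ≤ l ∧ l < b ∧ w l = some P ∧ pos w l x = P + 1 ∧ pos w (l + 1) x = P := by
  induction b, hab using Nat.le_induction with
  | base => omega
  | succ b hab ih =>
    by_cases h3 : pos w b x ≤ P
    · obtain ⟨l, a1, a2, a3⟩ := ih h3
      exact ⟨l, a1, by omega, a3⟩
    · rcases hw : w b with _ | c
      · rw [pos_succ_none hw] at h2
        omega
      · have h4 := h2
        rw [pos_succ_some hw] at h4
        split_ifs at h4 with h5 h6
        · omega
        · obtain rfl : c = P := by omega
          refine ⟨b, hab, by omega, hw, h6, ?_⟩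
          rw [pos_succ_some hw, if_neg h5, if_pos h6]
        · exact (h3 h4).elim

/-- The letters with indices in `[a, b)` are related by `r` to their later ones. -/
def MonoOn (r : ℤ → ℤ → Prop) (w : ZWord) (a b : ℕ) : Prop :=
  ∀ i j, a ≤ i → i < j → j < b → ∀ c d, w i = some c → w j = some d → r c d

/-- A decreasing stretch of letters adds a horizontal strip. -/
theorem Gr.sh_le_of_decreasing (h : Gr V m κ) {a b : ℕ} (hab : a ≤ b) (hb : b ≤ m)
    (hd : MonoOn (· > ·) V a b) (p : ℕ) : sh V m κ a (p + 1) ≤ sh V m κ b p := by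
  by_contra hcon
  unfold sh at hcon
  push_cast at hcon
  set P := pos V b (wireA V m κ p) with hP
  have h1 := h.wireA_lt (Nat.lt_add_one p) hb
  obtain ⟨l, l1, l2, l3, l4, -⟩ := exists_drop (w := V) (P := P - 1) hab
    (x := wireA V m κ (p + 1)) (by omega) (by omega)
  have h2 := h.wireA_lt (Nat.lt_add_one p) (l := l) (by omega)
  obtain ⟨l', l1', l2', l3', l4', -⟩ := exists_drop (w := V) (P := P) l2.le
    (x := wireA V m κ p) (by omega) (by omega)
  rcases l1'.eq_or_lt with he | hlt
  · subst he
    rw [l3] at l3'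
    simp at l3'
  · have := hd l l' l1 hlt l2' _ _ l3 l3'
    omega

/-- An increasing stretch of letters adds a vertical strip. -/
theorem Gr.sh_le_of_increasing (_h : Gr V m κ) {a b : ℕ} (hab : a ≤ b)
    (hd : MonoOn (· < ·) V a b) (p : ℕ) : sh V m κ a p ≤ sh V m κ b p + 1 := by
  by_contra hcon
  unfold sh at hcon
  set P := pos V b (wireA V m κ p) with hP
  obtain ⟨l, l1, l2, l3, l4, l5⟩ := exists_drop (w := V) (P := P + 1) hab
    (x := wireA V m κ p) (by omega) (by omega)
  obtain ⟨l', l1', l2', l3', -, -⟩ := exists_drop (w := V) (P := P) (a := l + 1) l2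
    (x := wireA V m κ p) (by omega) (by omega)
  have := hd l l' l1 (by omega) l2' _ _ l3 l3'
  omega

/-- The letters from the index `a` on consist of stretches of the lengths given by the list, each of
which is monotone. -/
def Blocks (r : ℤ → ℤ → Prop) (w : ZWord) : ℕ → List ℕ → Prop
  | _, [] => True
  | a, n :: L => MonoOn r w a (a + n) ∧ Blocks r w (a + n) L

theorem Gr.sh_le_of_decreasing_blocks (h : Gr V m κ) (L : List ℕ) : ∀ {a : ℕ},
    Blocks (· > ·) V a L → a + L.sum ≤ m →
    ∀ p, sh V m κ a (p + L.length) ≤ sh V m κ (a + L.sum) p := by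
  induction L with
  | nil => intro a _ _ p; simp
  | cons n L ih =>
    intro a hb ha p
    rw [List.sum_cons] at ha ⊢
    have h1 := ih hb.2 (by omega) p
    have h2 := h.sh_le_of_decreasing (Nat.le_add_right a n) (by omega) hb.1 (p + L.length)
    rw [List.length_cons, ← add_assoc, ← add_assoc]
    exact h2.trans h1

theorem Gr.sh_le_of_increasing_blocks (h : Gr V m κ) (L : List ℕ) : ∀ {a : ℕ},
    Blocks (· < ·) V a L → a + L.sum ≤ m →
    ∀ p, sh V m κ a p ≤ sh V m κ (a + L.sum) p + L.length := by
  induction L with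
  | nil => intro a _ _ p; simp
  | cons n L ih =>
    intro a hb ha p
    rw [List.sum_cons] at ha ⊢
    have h1 := ih hb.2 (by omega) p
    have h2 := h.sh_le_of_increasing (Nat.le_add_right a n) hb.1 p
    rw [List.length_cons, ← add_assoc]
    push_cast
    omega

/-- The total length of `t` decreasing stretches is at most the sum of the `t` largest parts. -/
theorem Gr.sum_le_of_decreasing_blocks (h : Gr V m κ) {K : ℕ}
    (hK : ∀ p, K ≤ p → sh V m κ 0 p = 0) {L : List ℕ} {a : ℕ} (hb : Blocks (· > ·) V a L)
    (ha : a + L.sum ≤ m) : (L.sum : ℤ) ≤ ∑ p ∈ Finset.range L.length, sh V m κ a p := by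
  have h1 := h.sum_sh hK (l := a) (by omega)
  have h2 := h.sum_sh hK ha
  have h3 : ∑ p ∈ Finset.range K, sh V m κ a (L.length + p) ≤
      ∑ p ∈ Finset.range K, sh V m κ (a + L.sum) p := Finset.sum_le_sum fun p _ => by
    rw [add_comm]
    exact h.sh_le_of_decreasing_blocks L hb ha p
  have h4 : ∑ p ∈ Finset.range K, sh V m κ a p ≤
      ∑ p ∈ Finset.range (L.length + K), sh V m κ a p := by
    refine Finset.sum_le_sum_of_subset_of_nonneg ?_ fun p _ _ => h.sh_nonneg (by omega) p
    intro p
    simp only [Finset.mem_range]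
    omega
  rw [Finset.sum_range_add] at h4
  rw [Nat.cast_add] at h2
  omega

/-- The total length of the last `t` increasing stretches is at most the sum of the `t` largest parts
of the conjugate partition. -/
theorem Gr.sum_le_of_increasing_blocks (h : Gr V m κ) {K : ℕ}
    (hK : ∀ p, K ≤ p → sh V m κ 0 p = 0) {L : List ℕ} {a l : ℕ} (hb : Blocks (· < ·) V a L)
    (ha : a + L.sum = m) (hl : l ≤ a) :
    (L.sum : ℤ) ≤ ∑ p ∈ Finset.range K, min (sh V m κ l p) L.length := by
  have h1 := h.sum_sh hK (l := a) (by omega)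
  have h2 : ∑ p ∈ Finset.range K, sh V m κ a p ≤
      ∑ p ∈ Finset.range K, min (sh V m κ l p) L.length := Finset.sum_le_sum fun p _ => by
    have h3 := h.sh_le_of_increasing_blocks L hb ha.le p
    rw [ha, sh_self] at h3
    exact le_min (h.sh_anti hl (by omega) p) (by omega)
  have h4 : (m : ℤ) = a + L.sum := by rw [← ha]; push_cast; ring
  omega

end Grassmannian

/-! ### The tableau of a Grassmannian word -/

theorem exists_descent {σ : Equiv.Perm ℕ} {i j : ℕ} (h : IsInversion σ i j) :
    ∃ d, i ≤ d ∧ d < j ∧ IsDescent σ d := by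
  by_contra! hcon
  obtain ⟨h0, h1, h2⟩ := h
  have key : ∀ j', i ≤ j' → j' ≤ j → σ i ≤ σ j' := by
    intro j' hj'
    induction j', hj' using Nat.le_induction with
    | base => exact fun _ => le_rfl
    | succ n hn ih =>
      intro hj
      have h3 := ih (by omega)
      have h4 := hcon n hn (by omega)
      by_contra h5
      exact h4 ⟨by omega, by omega, by omega⟩
  have := key j h1.le le_rfl
  omega

theorem IsGrassmannianAt.gr {v : List ℕ} {k : ℕ} (h : IsGrassmannianAt v k) (s : ℤ) :
    Gr (ofList s v) v.length ((k : ℤ) - s) := by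
  have hinv : ∀ p q : ℤ, p < q →
      ¬ (pre (ofList s v) v.length p < pre (ofList s v) v.length q) →
      p ≤ (k : ℤ) - s ∧ (k : ℤ) - s < q := by
    intro p q hpq hn
    have hne : pre (ofList s v) v.length p ≠ pre (ofList s v) v.length q := fun he => by
      have := (pre (ofList s v) v.length).injective he
      omega
    obtain ⟨i, j, rfl, rfl, hij⟩ := inv_ofList (s := s) h.1.1 hpq (by omega)
    obtain ⟨d, d1, d2, d3⟩ := exists_descent hij
    have := (h.2 d).1 d3
    omega
  refine ⟨((isReduced_iff s).1 h.1).2, fun l hl => by simp [ofList_of_lt hl], ?_, ?_⟩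
  · intro p q hpq hq
    by_contra hn
    have := hinv p q hpq hn
    omega
  · intro p q hp hpq
    by_contra hn
    have := hinv p q hpq hn
    omega

theorem wireA_ofList {s : ℤ} {v : List ℕ} {k p : ℕ} (hp : p < k) :
    wireA (ofList s v) v.length ((k : ℤ) - s) p = (wordPerm v (k - p) : ℤ) - s := by
  rw [wireA, ← pre_ofList_length, Nat.cast_sub hp.le]
  congr 1
  ring

theorem wireB_ofList {s : ℤ} {v : List ℕ} {k q : ℕ} :
    wireB (ofList s v) v.length ((k : ℤ) - s) q = (wordPerm v (k + 1 + q) : ℤ) - s := by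
  rw [wireB, ← pre_ofList_length]
  congr 1
  push_cast
  ring

theorem sh_ofList_zero {s : ℤ} {v : List ℕ} (hv : ∀ a ∈ v, 0 < a) {k p : ℕ} (hp : k ≤ p) :
    sh (ofList s v) v.length ((k : ℤ) - s) 0 p = 0 := by
  rw [sh, pos_zero, wireA]
  rcases hp.eq_or_lt with rfl | hlt
  · have := pre_ofList_length s v 0
    rw [wordPerm_zero hv] at this
    rw [show (k : ℤ) - s - k = ((0 : ℕ) : ℤ) - s by push_cast; ring, this]
    ring
  · rw [pre_ofList_neg _ _ (by omega)]
    ring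

/-- The entry of `tab v k` in the row of `a_p` and the column of `b_q`. -/
def ent (v : List ℕ) (k p q : ℕ) : Option ℕ :=
  ((List.range v.length).find? fun l =>
    swapped v l = s(wordPerm v (k - p), wordPerm v (k + 1 + q))).map fun l => v.length - l

theorem ent_eq_some_iff {v : List ℕ} {k p q a : ℕ} (hv : IsReduced v) :
    ent v k p q = some a ↔
      ∃ l, SwapsAt v l (wordPerm v (k - p)) (wordPerm v (k + 1 + q)) ∧ a = v.length - l := by
  unfold ent
  constructor
  · intro h
    rw [Option.map_eq_some_iff] at h
    obtain ⟨l, h1, rfl⟩ := h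
    have h2 := List.find?_some h1
    have h3 := List.mem_of_find?_eq_some h1
    exact ⟨l, ⟨by simpa using h3, by simpa using h2⟩, rfl⟩
  · rintro ⟨l, hl, rfl⟩
    rcases hf : (List.range v.length).find? fun l =>
      swapped v l = s(wordPerm v (k - p), wordPerm v (k + 1 + q)) with _ | l'
    · rw [List.find?_eq_none] at hf
      have := hf l (by simpa using hl.1)
      simp [hl.2] at this
    · have h2 := List.find?_some hf
      have h3 := List.mem_of_find?_eq_some hf
      have hl' : SwapsAt v l' (wordPerm v (k - p)) (wordPerm v (k + 1 + q)) :=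
        ⟨by simpa using h3, by simpa using h2⟩
      have := ((isReduced_iff 0).1 hv).2.eq_of_cross hl.1 hl'.1 (cross_ofList.2 hl)
        (cross_ofList.2 hl')
      simp [this]

/-- The row with index `p` of `tab v k`, restricted to the cells that come from the letters with
indices from `l` on. -/
def rowFrom (s : ℤ) (v : List ℕ) (k l p : ℕ) : List ℕ :=
  (List.range (sh (ofList s v) v.length ((k : ℤ) - s) l p).toNat).filterMap (ent v k p)

/-- The subtableau of `tab v k` that comes from the letters with indices from `l` on. -/
def tabFrom (s : ℤ) (v : List ℕ) (k l : ℕ) : Tableau :=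
  ((List.range k).map (rowFrom s v k l)).filter fun row => row ≠ []

theorem filterMap_range_of_none {f : ℕ → Option ℕ} {n N : ℕ} (hn : n ≤ N)
    (h : ∀ q, n ≤ q → f q = none) : (List.range N).filterMap f = (List.range n).filterMap f := by
  obtain ⟨d, rfl⟩ := Nat.exists_eq_add_of_le hn
  have h0 : (List.map (fun x => n + x) (List.range d)).filterMap f = [] := by
    rw [List.filterMap_eq_nil_iff]
    intro a ha
    obtain ⟨x, -, rfl⟩ := List.mem_map.1 ha
    exact h _ (by omega)
  rw [List.range_add, List.filterMap_append, h0, List.append_nil]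

theorem wordPerm_le {w : List ℕ} {N a : ℕ} (h : ∀ c ∈ w, c < N) (ha : a ≤ N) :
    wordPerm w a ≤ N := by
  by_contra hcon
  have e2 : wordPerm w (wordPerm w a) = wordPerm w a :=
    wordPerm_fix fun c hc => by have := h c hc; omega
  have := (wordPerm w).injective e2
  omega

theorem lt_foldr_max {w : List ℕ} {c : ℕ} (hc : c ∈ w) : c < w.foldr max 0 + 1 := by
  induction w with
  | nil => simp at hc
  | cons d w ih =>
    rcases List.mem_cons.1 hc with rfl | hc
    · simp
    · have := ih hc
      simp only [List.foldr_cons]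
      omega

section

variable {v : List ℕ} {k : ℕ} (s : ℤ)

theorem sh_ofList_le {p : ℕ} (hp : p < k) :
    (sh (ofList s v) v.length ((k : ℤ) - s) 0 p).toNat ≤ v.foldr max 0 + 1 := by
  rw [sh, pos_zero, wireA_ofList hp]
  by_cases hk : k - p ≤ v.foldr max 0 + 1
  · have := wordPerm_le (w := v) (fun c hc => lt_foldr_max hc) hk
    omega
  · have : wordPerm v (k - p) = k - p :=
      wordPerm_fix fun c hc => by have := lt_foldr_max hc; omega
    rw [this]
    omega

theorem IsGrassmannianAt.ent_eq_none (h : IsGrassmannianAt v k) {p q : ℕ} (hp : p < k)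
    (hq : sh (ofList s v) v.length ((k : ℤ) - s) 0 p ≤ q) : ent v k p q = none := by
  rw [← Option.not_isSome_iff_eq_none, Option.isSome_iff_exists]
  rintro ⟨a, ha⟩
  obtain ⟨l, hl, -⟩ := (ent_eq_some_iff h.1).1 ha
  have hc := (cross_ofList (s := s)).2 hl
  rw [← wireA_ofList hp, ← wireB_ofList] at hc
  have h1 := (h.gr s).cross_column hl.1 hc
  have h2 := (h.gr s).sh_anti (Nat.zero_le l) hl.1.le p
  omega

theorem IsGrassmannianAt.tab_eq (h : IsGrassmannianAt v k) : tab v k = tabFrom s v k 0 := by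
  unfold tab tabFrom
  congr 1
  refine List.map_congr_left fun p hp => ?_
  have hp' : p < k := by simpa using hp
  exact filterMap_range_of_none (f := ent v k p) (sh_ofList_le s hp') fun q hq =>
    h.ent_eq_none s hp' (by omega)

theorem IsGrassmannianAt.rowFrom_step (h : IsGrassmannianAt v k) {l : ℕ} (hl : l < v.length) :
    ∃ p < k, sh (ofList s v) v.length ((k : ℤ) - s) l p =
        sh (ofList s v) v.length ((k : ℤ) - s) (l + 1) p + 1 ∧
      (∀ p', p' ≠ p → sh (ofList s v) v.length ((k : ℤ) - s) l p' =
        sh (ofList s v) v.length ((k : ℤ) - s) (l + 1) p') ∧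
      rowFrom s v k l p = rowFrom s v k (l + 1) p ++ [v.length - l] ∧
      ∀ p', p' ≠ p → rowFrom s v k l p' = rowFrom s v k (l + 1) p' := by
  have g := h.gr s
  obtain ⟨p, q, hc, h1, h2⟩ := g.cross_step hl
  have h3 := g.sh_nonneg (l := l + 1) hl p
  have hp : p < k := by
    by_contra hcon
    have e1 := g.sh_anti (Nat.zero_le l) hl.le p
    rw [sh_ofList_zero h.1.1 (by omega)] at e1
    omega
  have h4 := (g.cross_column hl hc).1
  rw [wireA_ofList hp, wireB_ofList, cross_ofList] at hc
  refine ⟨p, hp, h1, h2, ?_, fun p' hp' => by rw [rowFrom, rowFrom, h2 p' hp']⟩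
  have e : ent v k p q = some (v.length - l) := (ent_eq_some_iff h.1).2 ⟨l, hc, rfl⟩
  rw [rowFrom, rowFrom, h1, ← h4]
  rw [show ((q : ℤ) + 1).toNat = q + 1 by omega, show ((q : ℤ)).toNat = q by omega,
    List.range_succ, List.filterMap_append]
  simp [e]

theorem IsGrassmannianAt.length_rowFrom (h : IsGrassmannianAt v k) {l : ℕ} (hl : l ≤ v.length) :
    ∀ p, (rowFrom s v k l p).length = (sh (ofList s v) v.length ((k : ℤ) - s) l p).toNat := by
  induction hl using Nat.decreasingInduction with
  | self => intro p; simp [rowFrom]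
  | of_succ l hlm ih =>
    intro p
    obtain ⟨p0, -, h1, h2, h3, h4⟩ := h.rowFrom_step s hlm
    have h5 := (h.gr s).sh_nonneg (l := l + 1) hlm p0
    by_cases hp : p = p0
    · subst hp
      rw [h3, h1, List.length_append, ih]
      simp
      omega
    · rw [h4 p hp, h2 p hp, ih]

end

theorem filter_map_range_addBox {a : ℕ} (k : ℕ) : ∀ (f g : ℕ → List ℕ) (p : ℕ), p < k →
    (∀ p', p' ≠ p → g p' = f p') → g p = f p ++ [a] →
    (∀ i j, i ≤ j → f i = [] → f j = []) → (∀ i j, i ≤ j → g i = [] → g j = []) →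
    ((List.range k).map g).filter (fun row => row ≠ []) =
      addBox a p (((List.range k).map f).filter fun row => row ≠ []) := by
  induction k with
  | zero => intro f g p hp; omega
  | succ k ih =>
    intro f g p hp hne heq hf hg
    rw [List.range_succ_eq_map, List.map_cons, List.map_cons, List.map_map, List.map_map]
    by_cases h0 : f 0 = []
    · have hfe : (List.map (f ∘ Nat.succ) (List.range k)).filter (fun row => row ≠ []) = [] := by
        rw [List.filter_eq_nil_iff]
        intro R hR
        obtain ⟨i, -, rfl⟩ := List.mem_map.1 hR
        simp [hf 0 (i + 1) (by omega) h0]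
      have hp0 : p = 0 := by
        by_contra hp0
        have h1 := hg 0 p (by omega) (by rw [hne 0 (Ne.symm hp0), h0])
        simp [heq] at h1
      subst hp0
      have hge : List.map (g ∘ Nat.succ) (List.range k) = List.map (f ∘ Nat.succ) (List.range k) :=
        List.map_congr_left fun i _ => hne _ (by simp)
      rw [hge, List.filter_cons, List.filter_cons, hfe, heq, h0]
      simp [addBox]
    · cases p with
      | zero =>
        have hge : List.map (g ∘ Nat.succ) (List.range k) =
            List.map (f ∘ Nat.succ) (List.range k) :=
          List.map_congr_left fun i _ => hne _ (by simp)
        rw [hge, List.filter_cons, List.filter_cons, heq]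
        simp [h0, addBox]
      | succ p =>
        have := ih (f ∘ Nat.succ) (g ∘ Nat.succ) p (by omega)
          (fun p' hp' => hne _ (by simpa using hp')) heq
          (fun i j hij => hf _ _ (by simpa using hij)) (fun i j hij => hg _ _ (by simpa using hij))
        rw [List.filter_cons, List.filter_cons, hne 0 (by omega), this]
        simp [h0, addBox]

/-- The tableau of a Grassmannian word grows by one box with each letter, from the last one to the
first one. -/
theorem IsGrassmannianAt.tabFrom_step {v : List ℕ} {k : ℕ} (h : IsGrassmannianAt v k) (s : ℤ)
    {l : ℕ} (hl : l < v.length) : ∃ p,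
      sh (ofList s v) v.length ((k : ℤ) - s) l p =
        sh (ofList s v) v.length ((k : ℤ) - s) (l + 1) p + 1 ∧
      (∀ p', p' ≠ p → sh (ofList s v) v.length ((k : ℤ) - s) l p' =
        sh (ofList s v) v.length ((k : ℤ) - s) (l + 1) p') ∧
      tabFrom s v k l = addBox (v.length - l) p (tabFrom s v k (l + 1)) := by
  obtain ⟨p, hp, h1, h2, h3, h4⟩ := h.rowFrom_step s hl
  have key : ∀ l ≤ v.length, ∀ i j, i ≤ j → rowFrom s v k l i = [] → rowFrom s v k l j = [] := by
    intro l hl i j hij hi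
    rw [← List.length_eq_zero_iff, h.length_rowFrom s hl] at hi ⊢
    have := antitone_nat_of_succ_le (fun p => (h.gr s).sh_antitone hl p) hij
    omega
  exact ⟨p, h1, h2, filter_map_range_addBox k _ _ p hp h4 h3 (key _ hl) (key _ hl.le)⟩

/-! ### Row insertion -/

/-- The insertion tableau of a word. -/
def insWord (x : List ℕ) : Tableau := x.foldl (fun T a => (insertTableau a T).1) []

theorem insWord_append_singleton (x : List ℕ) (a : ℕ) :
    insWord (x ++ [a]) = (insertTableau a (insWord x)).1 := by simp [insWord]

/-- The length of the row with index `p`. -/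
def rowLen (T : Tableau) (p : ℕ) : ℕ := (T.getD p []).length

@[simp] theorem rowLen_nil (p : ℕ) : rowLen [] p = 0 := by simp [rowLen]

@[simp] theorem rowLen_cons_zero (R : List ℕ) (T : Tableau) : rowLen (R :: T) 0 = R.length := by
  simp [rowLen]

@[simp] theorem rowLen_cons_succ (R : List ℕ) (T : Tableau) (p : ℕ) :
    rowLen (R :: T) (p + 1) = rowLen T p := by simp [rowLen]

theorem insertRow_of_forall_le {x : ℕ} {R : List ℕ} (h : ∀ a ∈ R, a ≤ x) :
    insertRow x R = (R ++ [x], none) := by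
  induction R with
  | nil => rfl
  | cons a R ih =>
    have ha := h a List.mem_cons_self
    rw [insertRow, if_neg (by omega), ih fun b hb => h b (List.mem_cons_of_mem _ hb)]
    rfl

theorem insertRow_append_cons {x y : ℕ} {A : List ℕ} (B : List ℕ) (h : ∀ a ∈ A, a ≤ x)
    (hxy : x < y) : insertRow x (A ++ y :: B) = (A ++ x :: B, some y) := by
  induction A with
  | nil => simp [insertRow, hxy]
  | cons a A ih =>
    have ha := h a List.mem_cons_self
    rw [List.cons_append, insertRow, if_neg (by omega),
      ih fun b hb => h b (List.mem_cons_of_mem _ hb)]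
    rfl

theorem forall_le_or_exists_first_gt (x : ℕ) (R : List ℕ) :
    (∀ a ∈ R, a ≤ x) ∨ ∃ A y B, R = A ++ y :: B ∧ (∀ a ∈ A, a ≤ x) ∧ x < y := by
  induction R with
  | nil => simp
  | cons z R ih =>
    by_cases h : x < z
    · exact Or.inr ⟨[], z, R, rfl, by simp, h⟩
    · rcases ih with ih | ⟨A, y, B, rfl, h3, h4⟩
      · exact Or.inl (List.forall_mem_cons.2 ⟨not_lt.1 h, ih⟩)
      · exact Or.inr ⟨z :: A, y, B, rfl, List.forall_mem_cons.2 ⟨not_lt.1 h, h3⟩, h4⟩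

theorem insertTableau_cons_none {x : ℕ} {R R' : List ℕ} (T : Tableau)
    (h : insertRow x R = (R', none)) : insertTableau x (R :: T) = (R' :: T, 0) := by
  simp [insertTableau, h]

theorem insertTableau_cons_some {x y : ℕ} {R R' : List ℕ} (T : Tableau)
    (h : insertRow x R = (R', some y)) : insertTableau x (R :: T) =
      (R' :: (insertTableau y T).1, (insertTableau y T).2 + 1) := by
  simp [insertTableau, h]

/-- Case distinction on the effect of an insertion on the first row. -/
theorem insertTableau_cons_cases (x : ℕ) (R : List ℕ) (T : Tableau) :
    (insertTableau x (R :: T) = ((R ++ [x]) :: T, 0) ∧ ∀ a ∈ R, a ≤ x) ∨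
      ∃ A y B, R = A ++ y :: B ∧ insertTableau x (R :: T) =
        ((A ++ x :: B) :: (insertTableau y T).1, (insertTableau y T).2 + 1) ∧
        (∀ a ∈ A, a ≤ x) ∧ x < y := by
  rcases forall_le_or_exists_first_gt x R with h | ⟨A, y, B, rfl, h3, h4⟩
  · exact Or.inl ⟨insertTableau_cons_none T (insertRow_of_forall_le h), h⟩
  · exact Or.inr ⟨A, y, B, rfl, insertTableau_cons_some T (insertRow_append_cons B h3 h4), h3, h4⟩

theorem rowLen_insertTableau (x : ℕ) (T : Tableau) (p : ℕ) :
    rowLen (insertTableau x T).1 p = rowLen T p + if p = (insertTableau x T).2 then 1 else 0 := by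
  induction T generalizing x p with
  | nil => cases p <;> simp [insertTableau]
  | cons R T ih =>
    rcases insertTableau_cons_cases x R T with ⟨h, -⟩ | ⟨A, y, B, rfl, h, -⟩
    · rw [h]
      cases p <;> simp
    · rw [h]
      cases p with
      | zero => simp
      | succ p => simp [ih y p]

theorem perm_flatten_insertTableau (x : ℕ) (T : Tableau) :
    (insertTableau x T).1.flatten.Perm (x :: T.flatten) := by
  induction T generalizing x with
  | nil => simp [insertTableau]
  | cons R T ih =>
    rcases insertTableau_cons_cases x R T with ⟨h, -⟩ | ⟨A, y, B, rfl, h, -⟩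
    · rw [h]
      simp only [List.flatten_cons, List.append_assoc, List.singleton_append]
      exact List.perm_middle
    · rw [h]
      simp only [List.flatten_cons, List.append_assoc, List.cons_append]
      refine List.perm_middle.trans (List.Perm.cons x (List.Perm.append_left A ?_))
      exact ((ih y).append_left B).trans List.perm_middle

theorem perm_flatten_insWord (x : List ℕ) : (insWord x).flatten.Perm x := by
  induction x using List.reverseRecOn with
  | nil => simp [insWord]
  | append_singleton x a ih =>
    rw [insWord_append_singleton]
    exact (perm_flatten_insertTableau a _).trans
      ((List.Perm.cons a ih).trans (List.perm_append_singleton a x).symm)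

/-- The row `S` may stand below the row `R`: it is not longer, and its entries are larger. -/
def ColLt (R S : List ℕ) : Prop :=
  ∀ i b : ℕ, S[i]? = some b → ∃ a : ℕ, R[i]? = some a ∧ a < b

theorem colLt_nil (R : List ℕ) : ColLt R [] := by simp [ColLt]

theorem colLt_cons_cons {a b : ℕ} {R S : List ℕ} :
    ColLt (a :: R) (b :: S) ↔ a < b ∧ ColLt R S := by
  constructor
  · intro h
    refine ⟨by simpa using h 0 b rfl, fun i c hc => by simpa using h (i + 1) c (by simpa using hc)⟩
  · rintro ⟨h1, h2⟩ i c hc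
    cases i with
    | zero => simp at hc; subst hc; exact ⟨a, by simp, h1⟩
    | succ i => simpa using h2 i c (by simpa using hc)

theorem ColLt.length_le {R S : List ℕ} (h : ColLt R S) : S.length ≤ R.length := by
  by_contra hcon
  obtain ⟨a, ha, -⟩ := h R.length S[R.length] (List.getElem?_eq_getElem (by omega))
  simp at ha

theorem ColLt.append {R S : List ℕ} (h : ColLt R S) (x : ℕ) : ColLt (R ++ [x]) S := by
  intro i b hb
  obtain ⟨a, ha, hab⟩ := h i b hb
  refine ⟨a, ?_, hab⟩
  rw [List.getElem?_append_left (by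
    rw [List.getElem?_eq_some_iff] at ha; exact ha.1), ha]

theorem ColLt.replace {A B S : List ℕ} {x y : ℕ} (h : ColLt (A ++ y :: B) S) (hxy : x < y) :
    ColLt (A ++ x :: B) S := by
  induction A generalizing S with
  | nil =>
    cases S with
    | nil => exact colLt_nil _
    | cons b S =>
      simp only [List.nil_append, colLt_cons_cons] at h ⊢
      exact ⟨by omega, h.2⟩
  | cons a A ih =>
    cases S with
    | nil => exact colLt_nil _
    | cons b S =>
      simp only [List.cons_append, colLt_cons_cons] at h ⊢
      exact ⟨h.1, ih h.2⟩

/-- The bumped entry `y` is inserted weakly to the left of its former column. -/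
theorem ColLt.insertRow {A B S : List ℕ} {x y : ℕ} (h : ColLt (A ++ y :: B) S)
    (hA : ∀ a ∈ A, a ≤ x) (hxy : x < y) : ColLt (A ++ x :: B) (LittleRS.insertRow y S).1 := by
  induction A generalizing S with
  | nil =>
    cases S with
    | nil => simpa [LittleRS.insertRow, colLt_cons_cons] using ⟨hxy, colLt_nil _⟩
    | cons b S =>
      simp only [List.nil_append, colLt_cons_cons] at h
      simp only [LittleRS.insertRow, if_pos h.1, List.nil_append, colLt_cons_cons]
      exact ⟨hxy, h.2⟩
  | cons a A ih =>
    have ha := hA a List.mem_cons_self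
    cases S with
    | nil =>
      simp only [LittleRS.insertRow, List.cons_append, colLt_cons_cons]
      exact ⟨by omega, colLt_nil _⟩
    | cons b S =>
      simp only [List.cons_append, colLt_cons_cons] at h
      simp only [LittleRS.insertRow]
      split_ifs with hb
      · simp only [List.cons_append, colLt_cons_cons]
        exact ⟨by omega, h.2.replace hxy⟩
      · simp only [List.cons_append, colLt_cons_cons]
        exact ⟨h.1, ih h.2 fun a' ha' => hA a' (List.mem_cons_of_mem _ ha')⟩

/-- Rows and columns are strictly increasing, and rows are not empty. -/
def Std : Tableau → Prop
  | [] => True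
  | R :: T => R.Pairwise (· < ·) ∧ R ≠ [] ∧ ColLt R (T.headD []) ∧ Std T

theorem insertTableau_head (y : ℕ) (T : Tableau) :
    (insertTableau y T).1.headD [] = (insertRow y (T.headD [])).1 := by
  cases T with
  | nil => simp [insertTableau, insertRow]
  | cons S T =>
    rcases h : insertRow y S with ⟨S', _ | z⟩
    · simp [insertTableau_cons_none T h, h]
    · simp [insertTableau_cons_some T h, h]

theorem Std.insertTableau {x : ℕ} {T : Tableau} (h : Std T) (hx : x ∉ T.flatten)
    (hnd : T.flatten.Nodup) : Std (insertTableau x T).1 := by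
  induction T generalizing x with
  | nil => simp [LittleRS.insertTableau, Std, colLt_nil]
  | cons R T ih =>
    obtain ⟨h1, h2, h3, h4⟩ := h
    rw [List.flatten_cons] at hnd hx
    have hnd' := List.nodup_append.1 hnd
    rcases insertTableau_cons_cases x R T with ⟨e, h5⟩ | ⟨A, y, B, rfl, e, h5, h6⟩
    · rw [e]
      refine ⟨?_, by simp, h3.append x, h4⟩
      rw [List.pairwise_append]
      refine ⟨h1, by simp, fun a ha b hb => ?_⟩
      simp only [List.mem_singleton] at hb
      subst hb
      have := h5 a ha
      have : a ≠ b := by rintro rfl; exact hx (List.mem_append_left _ ha)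
      omega
    · rw [e]
      refine ⟨?_, by simp, ?_, ih h4 ?_ hnd'.2.1⟩
      · rw [List.pairwise_append, List.pairwise_cons] at h1 ⊢
        obtain ⟨g1, ⟨g2, g3⟩, g4⟩ := h1
        refine ⟨g1, ⟨fun b hb => h6.trans (g2 b hb), g3⟩, fun a ha b hb => ?_⟩
        rcases List.mem_cons.1 hb with rfl | hb
        · have := h5 a ha
          have : a ≠ b := by rintro rfl; exact hx (by simp [ha])
          omega
        · exact g4 a ha b (List.mem_cons_of_mem _ hb)
      · rw [insertTableau_head]
        exact h3.insertRow h5 h6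
      · intro hy
        exact hnd'.2.2 y (by simp) y hy rfl

theorem std_insWord {x : List ℕ} (hx : x.Nodup) : Std (insWord x) := by
  induction x using List.reverseRecOn with
  | nil => simp [insWord, Std]
  | append_singleton x a ih =>
    rw [insWord_append_singleton]
    have h := List.nodup_append.1 hx
    have hp := perm_flatten_insWord x
    refine (ih h.1).insertTableau (fun ha => ?_) (hp.nodup_iff.2 h.1)
    exact h.2.2 a (hp.mem_iff.1 ha) a (by simp) rfl

theorem Std.rows {T : Tableau} (h : Std T) : ∀ R ∈ T, R.Pairwise (· < ·) := by
  induction T with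
  | nil => simp
  | cons R T ih =>
    intro S hS
    rcases List.mem_cons.1 hS with rfl | hS
    · exact h.1
    · exact ih h.2.2.2 S hS

/-! ### Knuth equivalence -/

/-- The elementary Knuth moves. -/
inductive KStep : List ℕ → List ℕ → Prop
  | acb (A B : List ℕ) (a b c : ℕ) (hab : a < b) (hbc : b < c) :
      KStep (A ++ a :: c :: b :: B) (A ++ c :: a :: b :: B)
  | bac (A B : List ℕ) (a b c : ℕ) (hab : a < b) (hbc : b < c) :
      KStep (A ++ b :: a :: c :: B) (A ++ b :: c :: a :: B)

/-- Knuth equivalence. -/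
def Knuth : List ℕ → List ℕ → Prop := Relation.EqvGen KStep

theorem KStep.congr {x y : List ℕ} (h : KStep x y) (A B : List ℕ) :
    KStep (A ++ x ++ B) (A ++ y ++ B) := by
  cases h with
  | acb A' B' a b c h1 h2 => simpa using KStep.acb (A ++ A') (B' ++ B) a b c h1 h2
  | bac A' B' a b c h1 h2 => simpa using KStep.bac (A ++ A') (B' ++ B) a b c h1 h2

theorem Knuth.refl (x : List ℕ) : Knuth x x := Relation.EqvGen.refl x

theorem Knuth.symm {x y : List ℕ} (h : Knuth x y) : Knuth y x := Relation.EqvGen.symm _ _ h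

theorem Knuth.trans {x y z : List ℕ} (h : Knuth x y) (h' : Knuth y z) : Knuth x z :=
  Relation.EqvGen.trans _ _ _ h h'

theorem Knuth.congr {x y : List ℕ} (h : Knuth x y) (A B : List ℕ) :
    Knuth (A ++ x ++ B) (A ++ y ++ B) := by
  induction h with
  | rel x y h => exact .rel _ _ (h.congr A B)
  | refl x => exact .refl _
  | symm x y _ ih => exact ih.symm
  | trans x y z _ _ ih1 ih2 => exact ih1.trans ih2

theorem Knuth.cons {x y : List ℕ} (h : Knuth x y) (a : ℕ) : Knuth (a :: x) (a :: y) := by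
  simpa using h.congr [a] []

theorem knuth_move_left (B : List ℕ) : ∀ {x y : ℕ}, x < y → (y :: B).Pairwise (· < ·) →
    Knuth (y :: B ++ [x]) (y :: x :: B) := by
  induction B with
  | nil => intro x y _ _; exact .refl _
  | cons b B ih =>
    intro x y hxy hp
    have hyb : y < b := (List.pairwise_cons.1 hp).1 b List.mem_cons_self
    have h1 := (ih (x := x) (hxy.trans hyb) (List.pairwise_cons.1 hp).2).cons y
    exact h1.trans (Relation.EqvGen.symm _ _ (.rel _ _ (KStep.bac [] B x y b hxy hyb)))

theorem knuth_move_front (A : List ℕ) : ∀ {x y : ℕ} (B : List ℕ), x < y →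
    (A ++ [x]).Pairwise (· < ·) → Knuth (A ++ y :: x :: B) (y :: A ++ x :: B) := by
  induction A with
  | nil => intro x y B _ _; exact .refl _
  | cons a A ih =>
    intro x y B hxy hp
    rw [List.cons_append, List.pairwise_cons] at hp
    have h1 := (ih B hxy hp.2).cons a
    refine h1.trans ?_
    obtain ⟨n, N, hN, hn⟩ : ∃ n N, A ++ x :: B = n :: N ∧ n ∈ A ++ [x] := by
      cases A with
      | nil => exact ⟨x, B, rfl, by simp⟩
      | cons a' A => exact ⟨a', A ++ x :: B, rfl, by simp⟩
    have h2 : a < n := hp.1 n hn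
    have h3 : n < y := by
      rcases List.mem_append.1 hn with hn | hn
      · have := (List.pairwise_append.1 hp.2).2.2 n hn x (by simp)
        omega
      · simp at hn
        omega
    rw [List.cons_append, List.cons_append, List.cons_append, hN]
    exact .rel _ _ (KStep.acb [] N a n y h2 h3)

/-- The row reading word: the rows from bottom to top. -/
def rowWord (T : Tableau) : List ℕ := T.reverse.flatten

theorem rowWord_cons (R : List ℕ) (T : Tableau) : rowWord (R :: T) = rowWord T ++ R := by
  simp [rowWord]

/-- Row insertion as a sequence of Knuth moves: the inserted entry moves to the left until it stands
behind the bumped entry, which then moves to the front of its row. -/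
theorem knuth_insertTableau {x : ℕ} {T : Tableau} (hT : ∀ R ∈ T, R.Pairwise (· < ·))
    (hx : x ∉ T.flatten) (hnd : T.flatten.Nodup) :
    Knuth (rowWord T ++ [x]) (rowWord (insertTableau x T).1) := by
  induction T generalizing x with
  | nil => simpa [rowWord, insertTableau] using Knuth.refl [x]
  | cons R T ih =>
    rw [List.flatten_cons] at hnd hx
    have hnd' := List.nodup_append.1 hnd
    rcases insertTableau_cons_cases x R T with ⟨e, h5⟩ | ⟨A, y, B, rfl, e, h5, h6⟩
    · rw [e, rowWord_cons, rowWord_cons, List.append_assoc]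
      exact .refl _
    · rw [e, rowWord_cons, rowWord_cons]
      have hR := hT _ List.mem_cons_self
      rw [List.pairwise_append] at hR
      have h7 := knuth_move_left B h6 hR.2.1
      have h8 : (A ++ [x]).Pairwise (· < ·) := by
        rw [List.pairwise_append]
        refine ⟨hR.1, by simp, fun a ha b hb => ?_⟩
        simp only [List.mem_singleton] at hb
        subst hb
        have := h5 a ha
        have : a ≠ b := by rintro rfl; exact hx (by simp [ha])
        omega
      have h9 := (h7.congr A []).trans (by simpa using knuth_move_front A B h6 h8)
      have h10 := h9.congr (rowWord T) []
      have hy : y ∉ T.flatten := fun hy => hnd'.2.2 y (by simp) y hy rfl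
      have h11 := (ih (fun R hR => hT R (List.mem_cons_of_mem _ hR)) hy hnd'.2.1).congr []
        (A ++ x :: B)
      simp only [List.append_nil, List.nil_append, List.append_assoc, List.cons_append] at h10 h11 ⊢
      exact h10.trans h11

/-- A word is Knuth equivalent to the row reading word of its insertion tableau. -/
theorem knuth_rowWord {x : List ℕ} (hx : x.Nodup) : Knuth x (rowWord (insWord x)) := by
  induction x using List.reverseRecOn with
  | nil => exact .refl _
  | append_singleton x a ih =>
    have h := List.nodup_append.1 hx
    have hp := perm_flatten_insWord x
    rw [insWord_append_singleton]
    refine Knuth.trans (by simpa using (ih h.1).congr [] [a]) ?_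
    refine knuth_insertTableau (std_insWord h.1).rows (fun ha => ?_) (hp.nodup_iff.2 h.1)
    exact h.2.2 a (hp.mem_iff.1 ha) a (by simp) rfl

/-! ### The column reading word -/

/-- Append the entries of the column `C` to the rows of a tableau. -/
def zipCol : Tableau → List ℕ → Tableau
  | [], C => C.map fun c => [c]
  | R :: U, [] => R :: U
  | R :: U, c :: C => (R ++ [c]) :: zipCol U C

/-- Each entry of the column `C` is larger than the entries of its row in `U`. -/
def DomCol (U : Tableau) (C : List ℕ) : Prop :=
  ∀ i c : ℕ, C[i]? = some c → ∀ a ∈ U.getD i [], a < c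

/-- If the entry on top of a column is inserted after the rest of the column, then it pushes the
rest of the column down by one row. -/
theorem insertTableau_zipCol {x : ℕ} {U : Tableau} {C : List ℕ}
    (hC : (x :: C).Pairwise (· < ·)) (hU : DomCol U (x :: C)) :
    (insertTableau x (zipCol U C)).1 = zipCol U (x :: C) := by
  induction C generalizing x U with
  | nil =>
    cases U with
    | nil => simp [zipCol, insertTableau]
    | cons R U =>
      have hR : ∀ a ∈ R, a < x := by simpa using hU 0 x rfl
      rcases insertTableau_cons_cases x R U with ⟨e, -⟩ | ⟨A, y, B, rfl, e, h5, h6⟩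
      · cases U <;> simp [zipCol, e]
      · have := hR y (by simp)
        omega
  | cons c C ih =>
    have hxc : x < c := (List.pairwise_cons.1 hC).1 c List.mem_cons_self
    have hC' := (List.pairwise_cons.1 hC).2
    have hDtail : ∀ R U', U = R :: U' → DomCol U' (c :: C) := by
      rintro R U' rfl i d hd a ha
      exact hU (i + 1) d (by simpa using hd) a (by simpa using ha)
    cases U with
    | nil =>
      have e := insertTableau_cons_some (C.map fun c => [c]) (x := x) (R := [c]) (R' := [x])
        (y := c) (by simp [insertRow, hxc])
      have := ih (U := []) hC' (by intro i d _ a ha; simp at ha)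
      simp only [zipCol, List.map_cons] at this ⊢
      rw [e, this]
    | cons R U =>
      have hR : ∀ a ∈ R, a < x := by simpa using hU 0 x rfl
      have e := insertRow_append_cons [] (fun a ha => (hR a ha).le) hxc
      simp only [zipCol]
      rw [insertTableau_cons_some _ e]
      simp only
      rw [ih hC' (hDtail R U rfl)]

theorem foldl_insert_zipCol {U : Tableau} {C : List ℕ} (hC : C.Pairwise (· < ·))
    (hU : DomCol U C) (hUC : ∀ C', C' <:+ C → DomCol U C') :
    C.reverse.foldl (fun T a => (insertTableau a T).1) U = zipCol U C := by
  induction C with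
  | nil => cases U <;> simp [zipCol]
  | cons c C ih =>
    rw [List.reverse_cons, List.foldl_append, ih (List.pairwise_cons.1 hC).2
      (hUC C (List.suffix_cons c C)) fun C' h => hUC C' (h.trans (List.suffix_cons c C))]
    exact insertTableau_zipCol hC hU

theorem DomCol.suffix {U : Tableau} {C C' : List ℕ} (hC : C.Pairwise (· < ·)) (h : DomCol U C)
    (hs : C' <:+ C) : DomCol U C' := by
  obtain ⟨D, rfl⟩ := hs
  intro i c hc a ha
  have hi : i < C'.length := (List.getElem?_eq_some_iff.1 hc).1
  have h1 : (D ++ C')[D.length + i]? = some c := by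
    rw [List.getElem?_append_right (by omega)]
    simpa using hc
  have hi' : i < (D ++ C').length := by rw [List.length_append]; omega
  have h2 := h i _ (List.getElem?_eq_getElem hi') a ha
  rcases Nat.eq_zero_or_pos D.length with h0 | h0
  · rw [h0, zero_add, List.getElem?_eq_getElem hi'] at h1
    simp only [Option.some.injEq] at h1
    omega
  · rw [List.pairwise_iff_getElem] at hC
    have h3 : D.length + i < (D ++ C').length := by rw [List.length_append]; omega
    have h4 := hC i (D.length + i) hi' h3 (by omega)
    rw [List.getElem?_eq_getElem h3] at h1
    simp only [Option.some.injEq] at h1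
    omega

/-- The column with index `q` of a tableau, from top to bottom. -/
def col (T : Tableau) (q : ℕ) : List ℕ := T.filterMap fun R => R[q]?

/-- The column reading word of the first `t` columns: each column from bottom to top. -/
def colWord (T : Tableau) : ℕ → List ℕ
  | 0 => []
  | t + 1 => colWord T t ++ (col T t).reverse

theorem Std.col_eq_nil {T : Tableau} (h : Std T) {q : ℕ} (hq : (T.headD []).length ≤ q) :
    col T q = [] ∧ T.map (List.take (q + 1)) = T.map (List.take q) := by
  induction T with
  | nil => simp [col]
  | cons R T ih =>
    obtain ⟨-, -, h3, h4⟩ := h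
    simp only [List.headD_cons] at hq
    obtain ⟨e1, e2⟩ := ih h4 (h3.length_le.trans hq)
    refine ⟨?_, ?_⟩
    · rw [col, List.filterMap_cons, List.getElem?_eq_none hq]
      exact e1
    · rw [List.map_cons, List.map_cons, e2, List.take_of_length_le hq,
        List.take_of_length_le (by omega)]

theorem Std.zipCol_take {T : Tableau} (h : Std T) (q : ℕ) :
    zipCol (T.map (List.take q)) (col T q) = T.map (List.take (q + 1)) := by
  induction T with
  | nil => simp [col, zipCol]
  | cons R T ih =>
    rcases lt_or_ge q R.length with hq | hq
    · have : col (R :: T) q = R[q] :: col T q := by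
        simp [col, List.getElem?_eq_getElem hq]
      rw [this, List.map_cons, zipCol, ih h.2.2.2, List.map_cons, List.take_add_one,
        List.getElem?_eq_getElem hq]
      simp
    · obtain ⟨e1, e2⟩ := h.col_eq_nil (q := q) (by simpa using hq)
      rw [e1, e2, List.map_cons, zipCol]

theorem Std.col_head {T : Tableau} (h : Std T) {q c : ℕ} (hc : c ∈ col T q) :
    ∃ a, (T.headD [])[q]? = some a ∧ a ≤ c := by
  induction T with
  | nil => simp [col] at hc
  | cons R T ih =>
    rw [col, List.mem_filterMap] at hc
    obtain ⟨S, hS, hSc⟩ := hc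
    rcases List.mem_cons.1 hS with rfl | hS
    · exact ⟨c, by simpa using hSc, le_rfl⟩
    · obtain ⟨a, ha, hac⟩ := ih h.2.2.2 (List.mem_filterMap.2 ⟨S, hS, hSc⟩)
      obtain ⟨b, hb, hba⟩ := h.2.2.1 q a ha
      exact ⟨b, by simpa using hb, by omega⟩

theorem Std.col_pairwise {T : Tableau} (h : Std T) (q : ℕ) : (col T q).Pairwise (· < ·) := by
  induction T with
  | nil => simp [col]
  | cons R T ih =>
    rcases hq : R[q]? with _ | a
    · have : col (R :: T) q = col T q := by simp [col, hq]
      rw [this]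
      exact ih h.2.2.2
    · have : col (R :: T) q = a :: col T q := by simp [col, hq]
      rw [this, List.pairwise_cons]
      refine ⟨fun c hc => ?_, ih h.2.2.2⟩
      obtain ⟨b, hb, hbc⟩ := h.2.2.2.col_head hc
      obtain ⟨a', ha', hab⟩ := h.2.2.1 q b hb
      rw [hq, Option.some.injEq] at ha'
      omega

theorem Std.domCol {T : Tableau} (h : Std T) (q : ℕ) :
    DomCol (T.map (List.take q)) (col T q) := by
  induction T with
  | nil => intro i c hc; simp [col] at hc
  | cons R T ih =>
    rcases lt_or_ge q R.length with hq | hq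
    · have e : col (R :: T) q = R[q] :: col T q := by
        simp [col, List.getElem?_eq_getElem hq]
      rw [e]
      intro i c hc a ha
      cases i with
      | zero =>
        simp at hc ha
        subst hc
        obtain ⟨j, hj, rfl⟩ := List.mem_take_iff_getElem.1 ha
        exact List.pairwise_iff_getElem.1 h.1 j q (by omega) hq (by omega)
      | succ i =>
        exact ih h.2.2.2 i c (by simpa using hc) a (by simpa using ha)
    · rw [(h.col_eq_nil (q := q) (by simpa using hq)).1]
      intro i c hc
      simp at hc

theorem Std.insWord_colWord_succ {T : Tableau} (h : Std T) (t : ℕ) :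
    insWord (colWord T (t + 1)) = T.map (List.take (t + 1)) := by
  induction t with
  | zero =>
    have h1 := h.col_pairwise 0
    have hd : ∀ C, DomCol [] C := by
      intro C i c _ a ha
      simp at ha
    simp only [colWord, List.nil_append, insWord]
    rw [foldl_insert_zipCol h1 (hd _) fun C' _ => hd C']
    simp only [zipCol, col]
    clear h1 hd
    induction T with
    | nil => rfl
    | cons R T ih =>
      obtain ⟨a, R', rfl⟩ := List.exists_cons_of_ne_nil h.2.1
      simp only [List.filterMap_cons, List.getElem?_cons_zero, List.map_cons, ih h.2.2.2]
      simp
  | succ t ih =>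
    have h1 := h.col_pairwise (t + 1)
    have h2 := h.domCol (t + 1)
    rw [colWord, insWord, List.foldl_append]
    rw [insWord] at ih
    rw [ih, foldl_insert_zipCol h1 h2 fun C' hC' => h2.suffix h1 hC', h.zipCol_take]

theorem Std.length_le_head {T : Tableau} (h : Std T) : ∀ R ∈ T, R.length ≤ (T.headD []).length := by
  induction T with
  | nil => simp
  | cons R T ih =>
    intro S hS
    rcases List.mem_cons.1 hS with rfl | hS
    · simp
    · exact (ih h.2.2.2 S hS).trans (by simpa using h.2.2.1.length_le)

/-- The column reading word of a tableau has this tableau as its insertion tableau. -/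
theorem Std.insWord_colWord {T : Tableau} (h : Std T) :
    insWord (colWord T ((T.headD []).length)) = T := by
  cases T with
  | nil => rfl
  | cons R T =>
    obtain ⟨t, ht⟩ : ∃ t, R.length = t + 1 :=
      Nat.exists_eq_succ_of_ne_zero (by simpa using h.2.1)
    rw [List.headD_cons, ht, h.insWord_colWord_succ]
    have : ∀ S ∈ R :: T, List.take (t + 1) S = S := fun S hS =>
      List.take_of_length_le (by simpa [ht] using h.length_le_head S hS)
    conv_rhs => rw [← List.map_id (R :: T)]
    exact List.map_congr_left this

/-! ### Bumps and Coxeter–Knuth moves in a final segment -/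

/-- `w` and `v` are joined by Coxeter–Knuth moves on letters with indices in `[l, m)`. -/
def CKs (m l : ℕ) : ZWord → ZWord → Prop :=
  Relation.EqvGen fun w v => ∃ k, l ≤ k ∧ k + 2 < m ∧ CK k w v

/-- A sequence of bumps. -/
def Chain (m : ℕ) : ZWord → ZWord → Prop := Relation.ReflTransGen (Bump m)

theorem CK.ne_none {k : ℕ} {w v : ZWord} (h : CK k w v) (i : ℕ) (hi : w i ≠ none) :
    v i ≠ none := by
  obtain ⟨h1, x, y, z, x', y', z', -, ⟨e1, e2, e3⟩, -⟩ := h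
  by_cases hk : i < k ∨ k + 3 ≤ i
  · rwa [h1 i hk]
  · obtain rfl | rfl | rfl : i = k ∨ i = k + 1 ∨ i = k + 2 := by omega
    · simp [e1]
    · simp [e2]
    · simp [e3]

theorem CKs.pre_eq {m l : ℕ} {w v : ZWord} (h : CKs m l w v) :
    (∀ i ≤ l, pre v i = pre w i) ∧ pre v m = pre w m := by
  induction h with
  | rel w v h =>
    obtain ⟨k, h1, h2, h3⟩ := h
    exact ⟨fun i hi => pre_eq_of_pos fun t => h3.pos_eq (Or.inl (by omega)) t, h3.pre_eq h2⟩
  | refl w => exact ⟨fun _ _ => rfl, rfl⟩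
  | symm w v _ ih => exact ⟨fun i hi => (ih.1 i hi).symm, ih.2.symm⟩
  | trans w v u _ _ ih1 ih2 =>
    exact ⟨fun i hi => (ih2.1 i hi).trans (ih1.1 i hi), ih2.2.trans ih1.2⟩

theorem CKs.red_iff {m l : ℕ} {w v : ZWord} (h : CKs m l w v) : Red w m ↔ Red v m := by
  induction h with
  | rel w v h =>
    obtain ⟨k, -, h2, h3⟩ := h
    exact ⟨h3.red h2, h3.symm.red h2⟩
  | refl w => rfl
  | symm w v _ ih => exact ih.symm
  | trans w v u _ _ ih1 ih2 => exact ih1.trans ih2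

theorem CKs.ne_none_iff {m l : ℕ} {w v : ZWord} (h : CKs m l w v) (i : ℕ) :
    w i ≠ none ↔ v i ≠ none := by
  induction h with
  | rel w v h =>
    obtain ⟨k, -, -, h3⟩ := h
    exact ⟨h3.ne_none i, h3.symm.ne_none i⟩
  | refl w => rfl
  | symm w v _ ih => exact ih.symm
  | trans w v u _ _ ih1 ih2 => exact ih1.trans ih2

theorem CKs.gr {m l : ℕ} {w v : ZWord} (h : CKs m l w v) {κ : ℤ} (hw : Gr w m κ) : Gr v m κ where
  red := h.red_iff.1 hw.red
  full i hi := (h.ne_none_iff i).1 (hw.full i hi)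
  inc_le := by rw [h.pre_eq.2]; exact hw.inc_le
  inc_gt := by rw [h.pre_eq.2]; exact hw.inc_gt

theorem CKs.sh_eq {m l : ℕ} {w v : ZWord} (h : CKs m l w v) (κ : ℤ) {i : ℕ} (hi : i ≤ l) (p : ℕ) :
    sh v m κ i p = sh w m κ i p := by
  unfold sh wireA
  rw [h.pre_eq.2, pos_of_pre_eq (h.pre_eq.1 i hi)]

theorem CKs.exists_bump {m l : ℕ} {w v : ZWord} (h : CKs m l w v) :
    (∀ w1, Bump m w w1 → ∃ v1, Bump m v v1 ∧ CKs m l w1 v1) ∧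
      ∀ v1, Bump m v v1 → ∃ w1, Bump m w w1 ∧ CKs m l v1 w1 := by
  induction h with
  | rel w v h =>
    obtain ⟨k, h1, h2, h3⟩ := h
    constructor
    · intro w1 hb
      obtain ⟨v1, hb1, hc⟩ := hb.ck h2 h3
      exact ⟨v1, hb1, .rel _ _ ⟨k, h1, h2, hc⟩⟩
    · intro w1 hb
      obtain ⟨v1, hb1, hc⟩ := hb.ck h2 h3.symm
      exact ⟨v1, hb1, .rel _ _ ⟨k, h1, h2, hc⟩⟩
  | refl w => exact ⟨fun w1 hb => ⟨w1, hb, .refl _⟩, fun w1 hb => ⟨w1, hb, .refl _⟩⟩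
  | symm w v _ ih => exact ih.symm
  | trans w v u _ _ ih1 ih2 =>
    constructor
    · intro w1 hb
      obtain ⟨v1, hb1, hc1⟩ := ih1.1 w1 hb
      obtain ⟨u1, hb2, hc2⟩ := ih2.1 v1 hb1
      exact ⟨u1, hb2, .trans _ _ _ hc1 hc2⟩
    · intro w1 hb
      obtain ⟨v1, hb1, hc1⟩ := ih2.2 w1 hb
      obtain ⟨u1, hb2, hc2⟩ := ih1.2 v1 hb1
      exact ⟨u1, hb2, .trans _ _ _ hc1 hc2⟩

/-- Coxeter–Knuth moves are carried along by a sequence of bumps. -/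
theorem Chain.cks {m l : ℕ} {w w1 v : ZWord} (h : Chain m w w1) (hv : CKs m l w v) :
    ∃ v1, Chain m v v1 ∧ CKs m l w1 v1 := by
  induction h with
  | refl => exact ⟨v, .refl, hv⟩
  | tail _ hb ih =>
    obtain ⟨v1, h1, h2⟩ := ih
    obtain ⟨v2, h3, h4⟩ := h2.exists_bump.1 _ hb
    exact ⟨v2, h1.tail h3, h4⟩

theorem Chain.sameDescents {m : ℕ} {w v : ZWord} (h : Chain m w v) : SameDescents m w v := by
  induction h with
  | refl => exact fun k _ c d hc hd => ⟨c, d, hc, hd, id, id⟩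
  | tail _ hb ih =>
    intro k hk c d hc hd
    obtain ⟨c1, d1, e1, e2, e3, e4⟩ := ih k hk c d hc hd
    obtain ⟨c2, d2, g1, g2, g3, g4⟩ := hb.sameDescents k hk c1 d1 e1 e2
    exact ⟨c2, d2, g1, g2, g3 ∘ e3, g4 ∘ e4⟩

theorem MonoOn.of_consecutive {r r' : ℤ → ℤ → Prop} (htr : ∀ x y z, r' x y → r' y z → r' x z)
    {m : ℕ} {w v : ZWord}
    (hstep : ∀ k, k + 1 < m → ∀ c d, w k = some c → w (k + 1) = some d →
      ∃ c' d', v k = some c' ∧ v (k + 1) = some d' ∧ (r c d → r' c' d'))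
    (hfull : ∀ l < m, w l ≠ none) {a b : ℕ} (hb : b ≤ m) (h : MonoOn r w a b) :
    MonoOn r' v a b := by
  intro i j hi hij
  induction j, hij using Nat.le_induction with
  | base =>
    intro hj c d hc hd
    obtain ⟨c0, h0⟩ := Option.ne_none_iff_exists'.1 (hfull i (by omega))
    obtain ⟨d0, h1⟩ := Option.ne_none_iff_exists'.1 (hfull (i + 1) (by omega))
    obtain ⟨c', d', e1, e2, e3⟩ := hstep i (by omega) c0 d0 h0 h1
    obtain rfl : c' = c := by simpa [e1] using hc
    obtain rfl : d' = d := by simpa [e2] using hd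
    exact e3 (h i (i + 1) hi (by omega) hj _ _ h0 h1)
  | succ j hij ih =>
    intro hj c d hc hd
    obtain ⟨c0, h0⟩ := Option.ne_none_iff_exists'.1 (hfull j (by omega))
    obtain ⟨d0, h1⟩ := Option.ne_none_iff_exists'.1 (hfull (j + 1) (by omega))
    obtain ⟨c', d', e1, e2, e3⟩ := hstep j (by omega) c0 d0 h0 h1
    obtain rfl : d' = d := by simpa [e2] using hd
    exact htr _ _ _ (ih (by omega) c c' hc e1)
      (e3 (h j (j + 1) (by omega) (by omega) hj _ _ h0 h1))

theorem Blocks.imp {r r' : ℤ → ℤ → Prop} {m : ℕ} {w v : ZWord}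
    (hm : ∀ a b, b ≤ m → MonoOn r w a b → MonoOn r' v a b) {L : List ℕ} : ∀ {a : ℕ},
    a + L.sum ≤ m → Blocks r w a L → Blocks r' v a L := by
  induction L with
  | nil => intro a _ _; trivial
  | cons n L ih =>
    intro a ha h
    rw [List.sum_cons] at ha
    exact ⟨hm _ _ (by omega) h.1, ih (by omega) h.2⟩

theorem Chain.blocks_lt {m : ℕ} {w v : ZWord} (h : Chain m w v) (hfull : ∀ l < m, w l ≠ none)
    {L : List ℕ} {a : ℕ} (ha : a + L.sum ≤ m) (hb : Blocks (· < ·) w a L) :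
    Blocks (· < ·) v a L := by
  refine hb.imp (fun a b hb => MonoOn.of_consecutive (r' := (· < ·))
    (fun x y z => lt_trans) ?_ hfull hb) ha
  intro k hk c d hc hd
  obtain ⟨c', d', e1, e2, e3, -⟩ := h.sameDescents k hk c d hc hd
  exact ⟨c', d', e1, e2, e3⟩

theorem Chain.blocks_gt {m : ℕ} {w v : ZWord} (h : Chain m w v) (hfull : ∀ l < m, w l ≠ none)
    {L : List ℕ} {a : ℕ} (ha : a + L.sum ≤ m) (hb : Blocks (· > ·) w a L) :
    Blocks (· > ·) v a L := by
  refine hb.imp (fun a b hb => MonoOn.of_consecutive (r' := (· > ·))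
    (fun x y z h1 h2 => lt_trans h2 h1) ?_ hfull hb)
    ha
  intro k hk c d hc hd
  obtain ⟨c', d', e1, e2, -, e4⟩ := h.sameDescents k hk c d hc hd
  exact ⟨c', d', e1, e2, e4⟩

theorem MonoOn.ofList {r : ℤ → ℤ → Prop} {s : ℤ} (P L S : List ℕ)
    (h : L.Pairwise fun a b : ℕ => r ((a : ℤ) - s) ((b : ℤ) - s)) :
    MonoOn r (ofList s (P ++ (L ++ S))) P.length (P.length + L.length) := by
  intro i j hi hij hj c d hc hd
  obtain ⟨i, rfl⟩ := Nat.exists_eq_add_of_le hi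
  obtain ⟨j, rfl⟩ := Nat.exists_eq_add_of_le (hi.trans hij.le)
  have key : ∀ t, t < L.length → ∀ e, LittleRS.ofList s (P ++ (L ++ S)) (P.length + t) = some e →
      ∃ ht : t < L.length, e = (L[t] : ℤ) - s := by
    intro t ht e he
    refine ⟨ht, ?_⟩
    have : (P ++ (L ++ S))[P.length + t]? = some L[t] := by
      rw [List.getElem?_append_right (by omega), Nat.add_sub_cancel_left,
        List.getElem?_append_left ht, List.getElem?_eq_getElem ht]
    simpa [LittleRS.ofList, this, eq_comm] using he
  obtain ⟨h1, rfl⟩ := key i (by omega) c hc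
  obtain ⟨h2, rfl⟩ := key j (by omega) d hd
  exact List.pairwise_iff_getElem.1 h i j h1 h2 (by omega)

theorem blocks_ofList {r : ℤ → ℤ → Prop} {s : ℤ} (S : List ℕ) {Ls : List (List ℕ)} :
    ∀ P : List ℕ, (∀ L ∈ Ls, L.Pairwise fun a b : ℕ => r ((a : ℤ) - s) ((b : ℤ) - s)) →
      Blocks r (ofList s (P ++ (Ls.flatten ++ S))) P.length (Ls.map List.length) := by
  induction Ls with
  | nil => intro P _; trivial
  | cons L Ls ih =>
    intro P h
    refine ⟨?_, ?_⟩
    · rw [List.flatten_cons, List.append_assoc]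
      exact MonoOn.ofList P L _ (h L List.mem_cons_self)
    · have := ih (P ++ L) fun L' hL' => h L' (List.mem_cons_of_mem _ hL')
      simpa using this

/-! ### Permutations as words in the odd generators -/

/-- The word `(2x_n - 1) ⋯ (2x_1 - 1)` of a sequence `x`. -/
def oddWord (x : List ℕ) : List ℕ := (x.map fun a => 2 * a - 1).reverse

@[simp] theorem length_oddWord (x : List ℕ) : (oddWord x).length = x.length := by simp [oddWord]

theorem oddWord_append (x y : List ℕ) : oddWord (x ++ y) = oddWord y ++ oddWord x := by
  simp [oddWord]

theorem ck_ofList {s : ℤ} (P S : List ℕ) {x y z x' y' z' : ℕ}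
    (h : Ck3 ((x : ℤ) - s) (y - s) (z - s) (x' - s) (y' - s) (z' - s)) :
    CK P.length (ofList s (P ++ x :: y :: z :: S)) (ofList s (P ++ x' :: y' :: z' :: S)) := by
  have hwin : ∀ x y z : ℕ,
      Win P.length (ofList s (P ++ x :: y :: z :: S)) ((x : ℤ) - s) (y - s) (z - s) := by
    intro x y z
    refine ⟨?_, ?_, ?_⟩ <;> simp [ofList]
  refine ⟨fun l hl => ?_, _, _, _, _, _, _, hwin x y z, hwin x' y' z', Or.inl h⟩
  unfold ofList
  congr 1
  rcases hl with hl | hl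
  · rw [List.getElem?_append_left hl, List.getElem?_append_left hl]
  · obtain ⟨t, rfl⟩ := Nat.exists_eq_add_of_le hl
    rw [List.getElem?_append_right (by omega), List.getElem?_append_right (by omega),
      show P.length + 3 + t - P.length = t + 3 by omega]
    rfl

/-- A Knuth move is a Coxeter–Knuth move of the reversed words. -/
theorem KStep.cks {x y : List ℕ} (h : KStep x y) (D : List ℕ) :
    CKs (x ++ D).length D.length (ofList 0 (oddWord (x ++ D))) (ofList 0 (oddWord (y ++ D))) := by
  refine .rel _ _ ?_
  cases h with
  | acb A B a b c h1 h2 =>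
    refine ⟨(oddWord (B ++ D)).length, by simp, by simp; omega, CK.symm ?_⟩
    have := ck_ofList (s := 0) (oddWord (B ++ D)) (oddWord A) (x := 2 * b - 1) (y := 2 * a - 1)
      (z := 2 * c - 1) (x' := 2 * b - 1) (y' := 2 * c - 1) (z' := 2 * a - 1)
      (Or.inr (Or.inl ⟨rfl, rfl, rfl, by omega, by omega⟩))
    simpa [oddWord] using this
  | bac A B a b c h1 h2 =>
    refine ⟨(oddWord (B ++ D)).length, by simp, by simp; omega, CK.symm ?_⟩
    have := ck_ofList (s := 0) (oddWord (B ++ D)) (oddWord A) (x := 2 * a - 1) (y := 2 * c - 1)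
      (z := 2 * b - 1) (x' := 2 * c - 1) (y' := 2 * a - 1) (z' := 2 * b - 1)
      (Or.inl ⟨rfl, rfl, rfl, by omega, by omega⟩)
    simpa [oddWord] using this

theorem KStep.length_eq {x y : List ℕ} (h : KStep x y) : x.length = y.length := by
  cases h <;> simp

theorem Knuth.length_eq {x y : List ℕ} (h : Knuth x y) : x.length = y.length := by
  induction h with
  | rel x y h => exact h.length_eq
  | refl x => rfl
  | symm x y _ ih => exact ih.symm
  | trans x y z _ _ ih1 ih2 => exact ih1.trans ih2

theorem Knuth.cks {x y : List ℕ} (h : Knuth x y) (D : List ℕ) :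
    CKs (x.length + D.length) D.length (ofList 0 (oddWord (x ++ D)))
      (ofList 0 (oddWord (y ++ D))) := by
  induction h with
  | rel x y h => simpa using h.cks D
  | refl x => exact .refl _
  | symm x y h ih =>
    rw [← Knuth.length_eq h]
    exact .symm _ _ ih
  | trans x y z h _ ih1 ih2 =>
    rw [← Knuth.length_eq h] at ih2
    exact .trans _ _ _ ih1 ih2

/-- A Knuth move on a prefix `x` does not change the shapes that the final segments with at least
`x.length` letters contribute at the end of a sequence of bumps. -/
theorem Chain.transfer {x y D : List ℕ} {m : ℕ} {V : ZWord} {κ : ℤ} (hm : x.length + D.length = m)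
    (h : Chain m (ofList 0 (oddWord (x ++ D))) V) (hV : Gr V m κ) (hxy : Knuth x y) :
    ∃ V', Chain m (ofList 0 (oddWord (y ++ D))) V' ∧ Gr V' m κ ∧
      ∀ i ≤ D.length, ∀ p, sh V' m κ i p = sh V m κ i p := by
  subst hm
  obtain ⟨V', h1, h2⟩ := Chain.cks h (hxy.cks D)
  exact ⟨V', h1, h2.gr hV, fun i hi p => h2.sh_eq κ hi p⟩

theorem ofList_ne_none {s : ℤ} {w : List ℕ} {l : ℕ} (h : l < w.length) : ofList s w l ≠ none := by
  simp [ofList_of_lt h]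

theorem sum_map_length_rows (T : Tableau) (t : ℕ) :
    ((T.take t).map List.length).sum = ∑ p ∈ Finset.range t, rowLen T p := by
  induction T generalizing t with
  | nil => simp
  | cons R T ih =>
    cases t with
    | zero => simp
    | succ t => rw [Finset.sum_range_succ']; simp [← ih t, -List.map_take, add_comm]

/-- The first `t` rows of the insertion tableau of a prefix `x` are not larger than those of the
shape that the last `x.length` letters of `V` contribute. -/
theorem Chain.rows_le {x D : List ℕ} {m : ℕ} {V : ZWord} {κ : ℤ} {K : ℕ}
    (hm : x.length + D.length = m) (hx : x.Nodup)
    (h : Chain m (ofList 0 (oddWord (x ++ D))) V) (hV : Gr V m κ)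
    (hK : ∀ p, K ≤ p → sh V m κ 0 p = 0) {t : ℕ} (ht : t ≤ (insWord x).length) :
    ((∑ p ∈ Finset.range t, rowLen (insWord x) p : ℕ) : ℤ) ≤
      ∑ p ∈ Finset.range t, sh V m κ D.length p := by
  obtain ⟨V', h1, h2, h3⟩ := Chain.transfer hm h hV (knuth_rowWord hx)
  set T := insWord x with hT
  have hlen : (rowWord T).length = x.length := (knuth_rowWord hx).length_eq.symm
  have e : oddWord (rowWord T ++ D) = oddWord D ++ ((((T.take t).map oddWord).flatten) ++
      ((T.drop t).map oddWord).flatten) := by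
    rw [oddWord_append, ← List.flatten_append, ← List.map_append, List.take_append_drop]
    congr 1
    clear_value T
    clear hT h1 h2 h3 ht hlen
    induction T with
    | nil => simp [rowWord, oddWord]
    | cons R T ih => rw [rowWord_cons, oddWord_append, ih]; simp
  have hb : Blocks (· > ·) (ofList 0 (oddWord (rowWord T ++ D))) D.length
      ((T.take t).map List.length) := by
    rw [e]
    have := blocks_ofList (r := (· > ·)) (s := 0) (((T.drop t).map oddWord).flatten)
      (Ls := (T.take t).map oddWord) (oddWord D) ?_
    · simpa [Function.comp_def] using this
    · intro L hL
      obtain ⟨R, hR, rfl⟩ := List.mem_map.1 hL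
      have := (std_insWord hx).rows R (List.mem_of_mem_take hR)
      rw [oddWord, List.pairwise_reverse, List.pairwise_map]
      refine this.imp fun {a b} hab => ?_
      show (_ : ℤ) < _
      omega
  have hle : D.length + ((T.take t).map List.length).sum ≤ m := by
    have e2 : (oddWord (rowWord T ++ D)).length = m := by
      rw [length_oddWord, List.length_append]; omega
    rw [e] at e2
    simp only [List.length_append, List.length_flatten, List.map_map, length_oddWord] at e2
    have e3 : List.map (List.length ∘ oddWord) (T.take t) = (T.take t).map List.length :=
      List.map_congr_left fun R _ => by simp
    rw [e3] at e2
    omega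
  have hb' := Chain.blocks_gt h1 (fun l hl => ofList_ne_none (by
    rw [length_oddWord, List.length_append]; omega)) hle hb
  have := h2.sum_le_of_decreasing_blocks (K := K)
    (fun p hp => by rw [h3 0 (Nat.zero_le _), hK p hp]) hb' hle
  rw [sum_map_length_rows, List.length_map, List.length_take, min_eq_left ht] at this
  refine this.trans_eq (Finset.sum_congr rfl fun p _ => h3 _ le_rfl p)

theorem length_col (T : Tableau) (q : ℕ) :
    (col T q).length = (T.map fun R => if q < R.length then 1 else 0).sum := by
  induction T with
  | nil => simp [col]
  | cons R T ih =>
    rw [List.map_cons, List.sum_cons, ← ih, col, List.filterMap_cons]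
    split_ifs with h
    · rw [List.getElem?_eq_getElem h]
      simp [col, add_comm]
    · rw [List.getElem?_eq_none (by omega)]
      simp [col]

theorem length_colWord (T : Tableau) (t : ℕ) :
    (colWord T t).length = (T.map fun R => min R.length t).sum := by
  induction t with
  | zero => simp [colWord]
  | succ t ih =>
    rw [colWord, List.length_append, List.length_reverse, ih, length_col, ← List.sum_map_add]
    congr 1
    refine List.map_congr_left fun R _ => ?_
    split_ifs <;> omega

theorem sum_map_min (T : Tableau) (t : ℕ) {K : ℕ} (hK : T.length ≤ K) :
    (T.map fun R => min R.length t).sum = ∑ p ∈ Finset.range K, min (rowLen T p) t := by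
  induction T generalizing K with
  | nil => simp
  | cons R T ih =>
    obtain ⟨K, rfl⟩ : ∃ K', K = K' + 1 := Nat.exists_eq_succ_of_ne_zero (by simp at hK; omega)
    rw [Finset.sum_range_succ', List.map_cons, List.sum_cons, ih (K := K) (by simpa using hK)]
    simp [add_comm]

/-- The columns of a tableau with indices below `t`, from right to left. -/
def colsRev (T : Tableau) : ℕ → List (List ℕ)
  | 0 => []
  | t + 1 => col T t :: colsRev T t

theorem length_colsRev (T : Tableau) (t : ℕ) : (colsRev T t).length = t := by
  induction t with
  | zero => rfl
  | succ t ih => simp [colsRev, ih]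

theorem mem_colsRev {T : Tableau} {t : ℕ} {L : List ℕ} (h : L ∈ colsRev T t) :
    ∃ q, L = col T q := by
  induction t with
  | zero => simp [colsRev] at h
  | succ t ih =>
    rcases List.mem_cons.1 h with rfl | h
    · exact ⟨t, rfl⟩
    · exact ih h

theorem reverse_colWord (T : Tableau) (t : ℕ) :
    (colWord T t).reverse = (colsRev T t).flatten := by
  induction t with
  | zero => rfl
  | succ t ih => simp [colWord, colsRev, ih]

theorem colWord_add (T : Tableau) (t d : ℕ) :
    ∃ Y, colWord T (t + d) = colWord T t ++ Y := by
  induction d with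
  | zero => exact ⟨[], by simp⟩
  | succ d ih =>
    obtain ⟨Y, hY⟩ := ih
    exact ⟨Y ++ (col T (t + d)).reverse, by rw [← add_assoc, colWord, hY]; simp⟩

/-- A word is Knuth equivalent to the column reading word of its insertion tableau: both are Knuth
equivalent to the row reading word. -/
theorem knuth_colWord {x : List ℕ} (hx : x.Nodup) :
    Knuth x (colWord (insWord x) ((insWord x).headD []).length) := by
  have h := (std_insWord hx).insWord_colWord
  set y := colWord (insWord x) ((insWord x).headD []).length
  have hy : y.Nodup := by
    have h1 := perm_flatten_insWord y
    rw [h] at h1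
    exact (h1.symm.trans (perm_flatten_insWord x)).nodup_iff.2 hx
  have h2 := knuth_rowWord hy
  rw [h] at h2
  exact (knuth_rowWord hx).trans h2.symm

/-- The first `t` columns of the insertion tableau of a prefix `x` are not larger than those of the
shape that the last `x.length` letters of `V` contribute. -/
theorem Chain.cols_le {x D : List ℕ} {m : ℕ} {V : ZWord} {κ : ℤ} {K : ℕ}
    (hm : x.length + D.length = m) (hx : x.Nodup)
    (h : Chain m (ofList 0 (oddWord (x ++ D))) V) (hV : Gr V m κ)
    (hK : ∀ p, K ≤ p → sh V m κ 0 p = 0) (hK' : (insWord x).length ≤ K) {t : ℕ}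
    (ht : t ≤ ((insWord x).headD []).length) :
    ((∑ p ∈ Finset.range K, min (rowLen (insWord x) p) t : ℕ) : ℤ) ≤
      ∑ p ∈ Finset.range K, min (sh V m κ D.length p) t := by
  obtain ⟨V', h1, h2, h3⟩ := Chain.transfer hm h hV (knuth_colWord hx)
  set T := insWord x with hT
  obtain ⟨d, hd⟩ := Nat.exists_eq_add_of_le ht
  have hlen := (knuth_colWord hx).length_eq
  rw [← hT] at hlen
  set y := colWord T (T.headD []).length with hy
  obtain ⟨Y, hY⟩ := colWord_add T t d
  rw [← hd, ← hy] at hY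
  have e : oddWord (y ++ D) = (oddWord D ++ oddWord Y) ++
      (((colsRev T t).map (List.map fun a => 2 * a - 1)).flatten ++ []) := by
    rw [oddWord_append, hY, oddWord_append, List.append_assoc, List.append_nil]
    congr 2
    rw [oddWord, ← List.map_reverse, reverse_colWord, List.map_flatten]
  have hL : ((colsRev T t).map List.length).sum = (colWord T t).length := by
    rw [← List.length_flatten, ← reverse_colWord, List.length_reverse]
  have hsum : (D.length + Y.length) + ((colsRev T t).map List.length).sum = m := by
    rw [hL]
    have := congrArg List.length hY
    rw [List.length_append] at this
    omega
  have hb : Blocks (· < ·) (ofList 0 (oddWord (y ++ D))) (D.length + Y.length)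
      ((colsRev T t).map List.length) := by
    rw [e]
    have := blocks_ofList (r := (· < ·)) (s := 0) []
      (Ls := (colsRev T t).map (List.map fun a => 2 * a - 1)) (oddWord D ++ oddWord Y) ?_
    · simpa [Function.comp_def] using this
    · intro L hL
      obtain ⟨C, hC, rfl⟩ := List.mem_map.1 hL
      obtain ⟨q, rfl⟩ := mem_colsRev hC
      rw [List.pairwise_map]
      refine ((std_insWord hx).col_pairwise q).imp fun {a b} hab => ?_
      omega
  have hb' := Chain.blocks_lt h1 (fun l hl => ofList_ne_none (by
    rw [length_oddWord, List.length_append]; omega)) hsum.le hb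
  have := h2.sum_le_of_increasing_blocks (K := K) (l := D.length)
    (fun p hp => by rw [h3 0 (Nat.zero_le _), hK p hp]) hb' hsum (by omega)
  rw [hL, length_colWord, sum_map_min T t hK', List.length_map, length_colsRev] at this
  refine this.trans_eq (Finset.sum_congr rfl fun p _ => by rw [h3 _ le_rfl p])

/-! ### The tableau at the end of a sequence of bumps -/

/-- The pair of tableaux that the RSK algorithm assigns to a list of columns of a two-line array. -/
def rskList (z : List (ℕ × ℕ)) : Tableau × Tableau :=
  z.foldl
    (fun PQ a => ((insertTableau a.2 PQ.1).1, addBox a.1 (insertTableau a.2 PQ.1).2 PQ.2)) ([], [])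

theorem rskList_append_singleton (z : List (ℕ × ℕ)) (a : ℕ × ℕ) :
    rskList (z ++ [a]) = ((insertTableau a.2 (rskList z).1).1,
      addBox a.1 (insertTableau a.2 (rskList z).1).2 (rskList z).2) := by
  simp [rskList]

theorem rskList_fst (z : List (ℕ × ℕ)) : (rskList z).1 = insWord (z.map Prod.snd) := by
  induction z using List.reverseRecOn with
  | nil => rfl
  | append_singleton z a ih =>
    rw [rskList_append_singleton, List.map_append, List.map_singleton, insWord_append_singleton, ih]

/-- The recording tableau of a word. -/
def recWord (x : List ℕ) : Tableau := (rskList ((List.range' 1 x.length).zip x)).2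

theorem recWord_append_singleton (x : List ℕ) (a : ℕ) : recWord (x ++ [a]) =
    addBox (x.length + 1) (insertTableau a (insWord x)).2 (recWord x) := by
  have : (List.range' 1 (x ++ [a]).length).zip (x ++ [a]) =
      (List.range' 1 x.length).zip x ++ [(x.length + 1, a)] := by
    rw [List.length_append, List.length_singleton, List.range'_1_concat,
      List.zip_append (by simp)]
    simp [add_comm]
  rw [recWord, this, rskList_append_singleton, rskList_fst, List.map_snd_zip (by simp)]
  rfl

theorem Std.rowLen_antitone {T : Tableau} (h : Std T) : Antitone (rowLen T) := by
  refine antitone_nat_of_succ_le fun p => ?_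
  induction T generalizing p with
  | nil => simp
  | cons R T ih =>
    cases p with
    | zero =>
      have := h.2.2.1.length_le
      cases T <;> simp_all
    | succ p => simpa using ih h.2.2.2 p

theorem lt_length_of_rowLen_pos {T : Tableau} {p : ℕ} (h : 0 < rowLen T p) : p < T.length := by
  by_contra hcon
  rw [rowLen, List.getD_eq_default _ _ (by omega)] at h
  simp at h

/-- A step of an induction: two sequences of partitions that agree and then both grow by a box
agree again if the new shape `μ` has neither more boxes in its first rows nor in its first columns
than the new shape `μ'`. -/
theorem box_eq_of_dominance {K p q : ℕ} {l μ : ℕ → ℕ} {μ' : ℕ → ℤ} (hqK : q < K)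
    (hμ : ∀ i, μ i = l i + if i = q then 1 else 0) (hanti : Antitone μ)
    (hp : μ' p = l p + 1) (hp' : ∀ i, i ≠ p → μ' i = l i)
    (hrow : ((∑ i ∈ Finset.range (q + 1), μ i : ℕ) : ℤ) ≤ ∑ i ∈ Finset.range (q + 1), μ' i)
    (hcol : ((∑ i ∈ Finset.range K, min (μ i) (μ q) : ℕ) : ℤ) ≤
      ∑ i ∈ Finset.range K, min (μ' i) (μ q : ℕ)) : p = q := by
  push_cast at hrow hcol
  -- if `p < q`, then the new shape `μ` has a box more than `μ'` in the first `μ q` columns; if `q < p`,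
  -- then it has a box more in the first `q + 1` rows
  rcases lt_trichotomy p q with h | h | h
  · refine absurd hcol (not_le.2 (Finset.sum_lt_sum (fun i _ => ?_) ⟨q, by simpa using hqK, ?_⟩))
    · by_cases hi : i = p
      · subst hi
        have := hanti h.le
        omega
      · rw [hp' i hi, hμ i]
        push_cast
        split_ifs <;> omega
    · rw [hp' q h.ne', hμ q]
      simp
  · exact h
  · refine absurd hrow (not_le.2 (Finset.sum_lt_sum (fun i hi => ?_) ⟨q, by simp, ?_⟩))
    · rw [Finset.mem_range] at hi
      rw [hp' i (by omega), hμ i]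
      push_cast
      split_ifs <;> omega
    · rw [hp' q (by omega), hμ q]
      simp

/-- For each prefix `x` of `y = x ++ D`, the last `x.length` letters of a Grassmannian word reached
from `oddWord y` contribute to its tableau the recording tableau of `x`. -/
theorem Chain.tabFrom_eq {v y : List ℕ} {k : ℕ} {s : ℤ} (hv : IsGrassmannianAt v k)
    (hlen : v.length = y.length) (hy : y.Nodup)
    (h : Chain y.length (ofList 0 (oddWord y)) (ofList s v)) (x : List ℕ) :
    ∀ D, y = x ++ D →
      (∀ p, sh (ofList s v) v.length (k - s) D.length p = rowLen (insWord x) p) ∧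
        tabFrom s v k D.length = recWord x := by
  induction x using List.reverseRecOn with
  | nil =>
    intro D hD
    have hD' : D.length = v.length := by rw [hlen, hD]; simp
    refine ⟨fun p => by rw [hD', sh_self]; simp [insWord], ?_⟩
    rw [hD', tabFrom]
    show _ = []
    rw [List.filter_eq_nil_iff]
    intro R hR
    obtain ⟨p, -, rfl⟩ := List.mem_map.1 hR
    have := hv.length_rowFrom s le_rfl p
    rw [sh_self] at this
    have : (rowFrom s v k v.length p).length = 0 := by simpa using this
    simpa using List.eq_nil_of_length_eq_zero this
  | append_singleton x a ih =>
    intro D hD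
    obtain ⟨ih1, ih2⟩ := ih (a :: D) (by simpa using hD)
    rw [List.length_cons] at ih1 ih2
    have hl : v.length = x.length + 1 + D.length := by rw [hlen, hD]; simp; omega
    obtain ⟨p, hp, hp', htab⟩ := hv.tabFrom_step s (l := D.length) (by omega)
    have hx : (x ++ [a]).Nodup := (List.nodup_append.1 (hD ▸ hy)).1
    have hG := hv.gr s
    set q := (insertTableau a (insWord x)).2 with hq
    have hrl : ∀ i, rowLen (insWord (x ++ [a])) i =
        rowLen (insWord x) i + if i = q then 1 else 0 := by
      intro i
      rw [insWord_append_singleton, rowLen_insertTableau]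
    have hqT : q < (insWord (x ++ [a])).length :=
      lt_length_of_rowLen_pos (by rw [hrl q]; simp)
    have hanti := (std_insWord hx).rowLen_antitone
    have hm : (x ++ [a]).length + D.length = v.length := by simp; omega
    rw [← hlen, hD] at h
    set K := max k (insWord (x ++ [a])).length with hK
    have hK0 : ∀ p, K ≤ p → sh (ofList s v) v.length (k - s) 0 p = 0 := fun p hp =>
      sh_ofList_zero hv.1.1 (by omega)
    have hpq : p = q := by
      refine box_eq_of_dominance (K := K) (l := rowLen (insWord x))
        (μ := rowLen (insWord (x ++ [a])))
        (μ' := sh (ofList s v) v.length (k - s) D.length) (by omega) hrl hanti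
        (by rw [hp, ih1]) (fun i hi => by rw [hp' i hi, ih1]) ?_ ?_
      · exact Chain.rows_le hm hx h hG hK0 hqT
      · refine Chain.cols_le hm hx h hG hK0 (le_max_right _ _) ?_
        refine (hanti (Nat.zero_le q)).trans ?_
        cases insWord (x ++ [a]) <;> simp
    clear_value q
    subst hpq
    constructor
    · intro i
      rw [hrl i]
      by_cases hi : i = p
      · subst hi
        rw [hp, ih1]
        simp
      · rw [hp' i hi, ih1]
        simp [hi]
    · rw [htab, ih2, recWord_append_singleton, ← hq, show v.length - D.length = x.length + 1 by omega]

/-! ### The output of the Little map on a word of odd letters -/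

/-- Whichever bumps the procedure performs, its output is the recording tableau. -/
theorem LS.eq_recWord {w : List ℕ} {T : Tableau} (h : LS w T) : ∀ {y : List ℕ} {s : ℤ}, y.Nodup →
    w.length = y.length → Chain y.length (ofList 0 (oddWord y)) (ofList s w) → T = recWord y := by
  induction h with
  | grassmannian w k hw =>
    intro y s hy hlen hc
    rw [hw.tab_eq s]
    exact (Chain.tabFrom_eq hw hlen hy hc y [] (by simp)).2
  | bump w r s' i v T _ _ _ hv _ ih =>
    intro y s hy hlen hc
    obtain ⟨h1, -, s1, h2⟩ := hv.bump s
    rw [hlen] at h2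
    exact ih hy (h1.trans hlen) (hc.tail h2)

/-- Odd letters keep each wire within its pair of positions `{2a - 1, 2a}`. -/
theorem pos_of_odd {w : ZWord} (h : ∀ l c, w l = some c → c % 2 = 1) (l : ℕ) (x : ℤ) :
    (pos w l x + 1) / 2 = (x + 1) / 2 := by
  induction l with
  | zero => simp
  | succ l ih =>
    rw [← ih]
    rcases hl : w l with _ | c
    · rw [pos_succ_none hl]
    · have := h l c hl
      rw [pos_succ_some hl]
      split_ifs <;> omega

theorem isReduced_oddWord {y : List ℕ} (hy : y.Nodup) (hpos : ∀ a ∈ y, 0 < a) :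
    IsReduced (oddWord y) := by
  refine (LittleRS.isReduced_iff 0).2 ⟨?_, ?_⟩
  · intro a ha
    simp only [oddWord, List.mem_reverse, List.mem_map] at ha
    obtain ⟨b, hb, rfl⟩ := ha
    have := hpos b hb
    omega
  · have hlet : ∀ l c, ofList 0 (oddWord y) l = some c →
        ∃ hl : l < (oddWord y).length, c = ((oddWord y)[l] : ℤ) ∧ c % 2 = 1 := by
      intro l c hc
      have hl : l < (oddWord y).length := by
        by_contra hl
        simp [ofList, List.getElem?_eq_none (not_lt.1 hl)] at hc
      rw [ofList_of_lt hl, Option.some.injEq] at hc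
      refine ⟨hl, by omega, ?_⟩
      have hm := List.getElem_mem hl
      simp only [oddWord, List.mem_reverse, List.mem_map] at hm
      obtain ⟨b, hb, hb'⟩ := hm
      have := hpos b hb
      simp only [oddWord] at hc
      omega
    have hodd : ∀ l c, ofList 0 (oddWord y) l = some c → c % 2 = 1 := fun l c hc =>
      (hlet l c hc).choose_spec.2
    have hnd : (oddWord y).Nodup := by
      rw [oddWord, List.nodup_reverse]
      refine List.Nodup.map_on (fun a ha b hb hab => ?_) hy
      have := hpos a ha
      have := hpos b hb
      omega
    rintro i j hij hj x z ⟨c, hc, h1⟩ ⟨d, hd, h2⟩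
    have a1 := pos_of_odd hodd i x
    have a2 := pos_of_odd hodd j x
    obtain ⟨hi, e1, o1⟩ := hlet i c hc
    obtain ⟨hj', e2, o2⟩ := hlet j d hd
    have hcd : c = d := by omega
    have : (oddWord y)[i] = (oddWord y)[j] := by omega
    rw [hnd.getElem_inj_iff] at this
    omega

theorem rsWord_eq {n : ℕ} (σ : Equiv.Perm (Fin n)) :
    rsWord σ = oddWord (List.ofFn (oneLine σ)) := by
  rw [rsWord, oddWord, List.map_ofFn]
  rfl

theorem nodup_oneLine {n : ℕ} (σ : Equiv.Perm (Fin n)) : (List.ofFn (oneLine σ)).Nodup := by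
  refine List.nodup_ofFn_ofInjective fun i j h => ?_
  unfold oneLine at h
  exact σ.injective (Fin.ext (by omega))

theorem isReduced_rsWord {n : ℕ} (σ : Equiv.Perm (Fin n)) : IsReduced (rsWord σ) := by
  rw [rsWord_eq]
  refine isReduced_oddWord (nodup_oneLine σ) fun a ha => ?_
  obtain ⟨i, rfl⟩ := List.mem_ofFn.1 ha
  exact Nat.succ_pos _

theorem rsk_eq {n : ℕ} (u v : Fin n → ℕ) : rsk u v = rskList (List.ofFn fun i => (u i, v i)) := rfl

theorem zip_range_ofFn {n : ℕ} (f : Fin n → ℕ) : (List.range' 1 n).zip (List.ofFn f) =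
    List.ofFn fun i : Fin n => ((i : ℕ) + 1, f i) := by
  refine List.ext_getElem (by simp) fun i h1 h2 => ?_
  simp [add_comm]

theorem rs_snd {n : ℕ} (σ : Equiv.Perm (Fin n)) :
    (rs σ).2 = recWord (List.ofFn (oneLine σ)) := by
  rw [recWord, List.length_ofFn, zip_range_ofFn]
  rfl

theorem rs_fst {n : ℕ} (σ : Equiv.Perm (Fin n)) :
    (rs σ).1 = insWord (List.ofFn (oneLine σ)) := by
  rw [rs, rsk_eq, rskList_fst, List.map_ofFn]
  rfl

/-- The Little map on `w(σ)` terminates, and every output is the recording tableau of `σ`. -/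
theorem ls_rsWord_iff {n : ℕ} (hn : 0 < n) (σ : Equiv.Perm (Fin n)) (T : Tableau) :
    LS (rsWord σ) T ↔ T = (rs σ).2 := by
  have key : ∀ T, LS (rsWord σ) T → T = (rs σ).2 := by
    intro T hT
    rw [rs_snd]
    refine hT.eq_recWord (s := 0) (nodup_oneLine σ) (by simp [rsWord]) ?_
    rw [rsWord_eq]
    exact .refl
  refine ⟨key T, ?_⟩
  rintro rfl
  obtain ⟨T, hT⟩ := exists_LS (isReduced_rsWord σ) (by
    refine List.ne_nil_of_length_pos ?_
    simpa [rsWord] using hn)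
  rwa [← key T hT]

/-! ### The symmetry of the Robinson–Schensted correspondence -/

theorem insertTableau_of_forall_lt {a : ℕ} {T : Tableau} (h : ∀ b ∈ T.flatten, b < a) :
    insertTableau a T = (addBox a 0 T, 0) := by
  cases T with
  | nil => rfl
  | cons R T =>
    rcases insertTableau_cons_cases a R T with ⟨e, -⟩ | ⟨A, y, B, rfl, -, -, h6⟩
    · rw [e]; rfl
    · have := h y (by simp)
      omega

theorem length_insertTableau (x : ℕ) (T : Tableau) :
    T.length ≤ (insertTableau x T).1.length ∧ (insertTableau x T).2 < (insertTableau x T).1.length := by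
  induction T generalizing x with
  | nil => simp [insertTableau]
  | cons R T ih =>
    rcases insertTableau_cons_cases x R T with ⟨e, -⟩ | ⟨A, y, B, rfl, e, -⟩
    · rw [e]; simp
    · rw [e]
      have := ih y
      simp only [List.length_cons]
      omega

/-- Insertion of a smaller number into a tableau with largest entry `j`: the largest entry stays in
its row `r` unless the insertion without `j` ends in this row; then `j` is bumped to the next row. -/
theorem insertTableau_addBox {j : ℕ} {T : Tableau} : ∀ {x r : ℕ}, (∀ b ∈ T.flatten, b < j) →
    x < j → r ≤ T.length →
    insertTableau x (addBox j r T) =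
      if r = (insertTableau x T).2 then
        (addBox j (r + 1) (insertTableau x T).1, r + 1)
      else (addBox j r (insertTableau x T).1, (insertTableau x T).2) := by
  induction T with
  | nil =>
    intro x r _ hx hr
    obtain rfl : r = 0 := by simpa using hr
    simp [addBox, insertTableau, insertRow, hx]
  | cons R T ih =>
    intro x r hj hx hr
    have hT : ∀ b ∈ T.flatten, b < j := fun b hb => hj b (by simp at hb ⊢; right; exact hb)
    rcases insertTableau_cons_cases x R T with ⟨e, h5⟩ | ⟨A, y, B, rfl, e, h5, h6⟩
    · rw [e]
      cases r with
      | zero =>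
        have e1 := insertRow_append_cons [] h5 hx
        simp only [addBox, insertTableau_cons_some T e1, insertTableau_of_forall_lt hT, if_true]
      | succ r =>
        rcases insertTableau_cons_cases x R (addBox j r T) with ⟨e1, -⟩ | ⟨A, y, B, rfl, -, -, h7⟩
        · simp [addBox, e1]
        · have := h5 y (by simp)
          omega
    · rw [e]
      have hrow := fun C => insertRow_append_cons C h5 h6
      cases r with
      | zero =>
        have e1 := insertTableau_cons_some T (hrow (B ++ [j]))
        simp only [addBox, List.append_assoc, List.cons_append]
        rw [e1]
        simp
      | succ r =>
        have e1 := insertTableau_cons_some (addBox j r T) (hrow B)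
        rw [addBox, e1, ih hT (hj y (by simp)) (by simpa using hr)]
        simp only [Nat.add_right_cancel_iff]
        split_ifs <;> simp [addBox]

/-- The local rule of a growth diagram. The arguments say whether the square is marked, and in
which rows the partitions on its lower and on its left side differ (`none` if they agree); the
result describes the upper and the right side in the same way. -/
def growthRule (m : Bool) : Option ℕ → Option ℕ → Option ℕ × Option ℕ
  | some s, some r => if m then (some 0, some 0) else
      if r = s then (some (r + 1), some (r + 1)) else (some s, some r)
  | a, b => if m then (some 0, some 0) else (a, b)

theorem growthRule_swap (m : Bool) (a b : Option ℕ) :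
    growthRule m b a = (growthRule m a b).swap := by
  rcases a with _ | a <;> rcases b with _ | b <;> cases m <;> simp [growthRule]
  by_cases h : a = b
  · simp [h]
  · simp [h, Ne.symm h]

/-- The growth diagram of a matrix of marks. -/
def growth (M : ℕ → ℕ → Bool) : ℕ → ℕ → Option ℕ × Option ℕ
  | 0, _ => (none, none)
  | _ + 1, 0 => (none, none)
  | i + 1, j + 1 => growthRule (M i j) (growth M (i + 1) j).1 (growth M i (j + 1)).2

/-- The local rule is symmetric, hence transposing the matrix transposes the growth diagram. -/
theorem growth_flip (M : ℕ → ℕ → Bool) (i j : ℕ) :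
    growth (fun a b => M b a) j i = (growth M i j).swap := by
  induction i generalizing j with
  | zero => cases j <;> simp [growth]
  | succ i ih =>
    induction j with
    | zero => simp [growth]
    | succ j ihj =>
      rw [growth, growth, ih, ihj, growthRule_swap]
      simp

/-- The insertion tableau of the subword of the entries at most `j` among the first `i` entries. -/
def partIns (x : List ℕ) (i j : ℕ) : Tableau := insWord ((x.take i).filter (· ≤ j))

theorem lt_of_mem_partIns {x : List ℕ} {i j b : ℕ} (h : b ∈ (partIns x i j).flatten) :
    b ≤ j ∧ b ∈ x.take i := by
  have := (perm_flatten_insWord _).mem_iff.1 h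
  simp only [List.mem_filter, decide_eq_true_eq] at this
  exact ⟨this.2, this.1⟩

theorem partIns_succ {x : List ℕ} {i : ℕ} (hi : i < x.length) (j : ℕ) :
    partIns x (i + 1) j =
      if x[i] ≤ j then (insertTableau x[i] (partIns x i j)).1 else partIns x i j := by
  unfold partIns
  rw [List.take_add_one, List.getElem?_eq_getElem hi, Option.toList_some, List.filter_append]
  split_ifs with h
  · rw [List.filter_singleton, decide_eq_true h]
    exact insWord_append_singleton _ _
  · rw [List.filter_singleton, decide_eq_false h]
    simp

theorem partIns_succ_right {x : List ℕ} {i j : ℕ} (h : j + 1 ∉ x.take i) :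
    partIns x i (j + 1) = partIns x i j := by
  unfold partIns
  congr 1
  refine List.filter_congr fun a ha => ?_
  have : a ≠ j + 1 := by rintro rfl; exact h ha
  rw [decide_eq_decide]
  omega

/-- The marks of a permutation matrix. -/
def marks (x : List ℕ) (i j : ℕ) : Bool := x[i]? = some (j + 1)

/-- `o` says in which row the tableau of the entries at most `j` grows when the entry with index `i`
is inserted. -/
def GrowsRight (x : List ℕ) (i j : ℕ) (hi : i < x.length) : Option ℕ → Prop
  | none => j < x[i]
  | some r => x[i] ≤ j ∧ (insertTableau x[i] (partIns x i j)).2 = r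

/-- `o` says in which row the tableau of the first `i` entries grows when the entry `j + 1` is
admitted. -/
def GrowsUp (x : List ℕ) (i j : ℕ) : Option ℕ → Prop
  | none => j + 1 ∉ x.take i
  | some r => j + 1 ∈ x.take i ∧ partIns x i (j + 1) = addBox (j + 1) r (partIns x i j) ∧
      r ≤ (partIns x i j).length

/-- The local rule describes the growth of the tableaux `partIns` at the square `(i, j)`. -/
theorem grows_step {x : List ℕ} (hx : x.Nodup) {i j : ℕ} (hi : i < x.length) {a b : Option ℕ}
    (ha : GrowsRight x i j hi a) (hb : GrowsUp x i j b) :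
    GrowsRight x i (j + 1) hi (growthRule (marks x i j) a b).1 ∧
      GrowsUp x (i + 1) j (growthRule (marks x i j) a b).2 := by
  have hmem : j + 1 ∈ x.take (i + 1) ↔ j + 1 ∈ x.take i ∨ x[i] = j + 1 := by
    rw [List.take_add_one, List.getElem?_eq_getElem hi, List.mem_append, Option.toList_some,
      List.mem_singleton, eq_comm (a := j + 1)]
  have hmark : marks x i j = true ↔ x[i] = j + 1 := by
    simp [marks, List.getElem?_eq_getElem hi]
  have hlt : ∀ c ∈ (partIns x i j).flatten, c < j + 1 := fun c hc => by
    have := (lt_of_mem_partIns hc).1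
    omega
  have hnot : x[i] ∉ x.take i := by
    intro h
    obtain ⟨t, ht, e⟩ := List.mem_take_iff_getElem.1 h
    rw [hx.getElem_inj_iff] at e
    omega
  rcases hm : marks x i j with _ | _
  · have hne : x[i] ≠ j + 1 := fun h => by simp [hmark.2 h] at hm
    rcases a with _ | s
    · simp only [GrowsRight] at ha
      have e1 : ∀ t, t ≤ j + 1 → partIns x (i + 1) t = partIns x i t := fun t ht => by
        rw [partIns_succ hi, if_neg (by omega)]
      rw [show growthRule false none b = (none, b) by simp [growthRule]]
      refine ⟨by simp only [GrowsRight]; omega, ?_⟩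
      rcases b with _ | r
      · simp only [GrowsUp] at hb ⊢
        tauto
      · simp only [GrowsUp] at hb ⊢
        rw [e1 _ le_rfl, e1 j (by omega)]
        tauto
    · obtain ⟨ha1, ha2⟩ := ha
      rcases b with _ | r
      · simp only [GrowsUp] at hb
        rw [show growthRule false (some s) none = (some s, none) by simp [growthRule]]
        refine ⟨⟨by omega, ?_⟩, ?_⟩
        · rw [partIns_succ_right hb, ha2]
        · simp only [GrowsUp]
          tauto
      · obtain ⟨hb1, hb2, hb3⟩ := hb
        have e1 := insertTableau_addBox (x := x[i]) hlt (by omega) hb3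
        rw [← hb2, ha2] at e1
        have e2 := length_insertTableau x[i] (partIns x i j)
        rw [ha2] at e2
        rw [show growthRule false (some s) (some r) = if r = s then (some (r + 1), some (r + 1))
          else (some s, some r) by simp [growthRule]]
        have e3 : partIns x (i + 1) j = (insertTableau x[i] (partIns x i j)).1 := by
          rw [partIns_succ hi, if_pos ha1]
        have e4 : partIns x (i + 1) (j + 1) = (insertTableau x[i] (partIns x i (j + 1))).1 := by
          rw [partIns_succ hi, if_pos (by omega)]
        split_ifs with hrs
        · rw [if_pos hrs] at e1
          refine ⟨⟨by omega, by rw [e1]⟩, hmem.2 (Or.inl hb1), ?_, ?_⟩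
          · rw [e4, e1, e3]
          · rw [e3]; omega
        · rw [if_neg hrs] at e1
          refine ⟨⟨by omega, by rw [e1]⟩, hmem.2 (Or.inl hb1), ?_, ?_⟩
          · rw [e4, e1, e3]
          · rw [e3]; omega
  · have he := hmark.1 hm
    have hn : j + 1 ∉ x.take i := he ▸ hnot
    have e1 := insertTableau_of_forall_lt hlt
    rw [show growthRule true a b = (some 0, some 0) by
      rcases a with _ | a <;> rcases b with _ | b <;> simp [growthRule]]
    refine ⟨⟨by omega, ?_⟩, hmem.2 (Or.inr he), ?_, Nat.zero_le _⟩
    · rw [partIns_succ_right hn, he, e1]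
    · rw [partIns_succ hi, if_pos (by omega), partIns_succ_right hn, he, e1, partIns_succ hi,
        if_neg (by omega)]

/-- The growth diagram of a permutation matrix records the growth of the tableaux `partIns`. -/
theorem grows {x : List ℕ} (hx : x.Nodup) (hpos : ∀ a ∈ x, 0 < a) (i : ℕ) :
    ∀ j, (∀ hi : i < x.length, GrowsRight x i j hi (growth (marks x) (i + 1) j).1) ∧
      (i ≤ x.length → GrowsUp x i j (growth (marks x) i (j + 1)).2) := by
  have right : ∀ i, (∀ j, i ≤ x.length → GrowsUp x i j (growth (marks x) i (j + 1)).2) →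
      ∀ j, ∀ hi : i < x.length, GrowsRight x i j hi (growth (marks x) (i + 1) j).1 := by
    intro i hup j hi
    induction j with
    | zero => simpa [growth, GrowsRight] using hpos _ (List.getElem_mem hi)
    | succ j ih =>
      rw [growth]
      exact (grows_step hx hi ih (hup j hi.le)).1
  have up : ∀ i j, i ≤ x.length → GrowsUp x i j (growth (marks x) i (j + 1)).2 := by
    intro i
    induction i with
    | zero => intro j _; simp [growth, GrowsUp]
    | succ i ih =>
      intro j hi
      rw [growth]
      exact (grows_step hx hi (right i ih j hi) (ih j (by omega))).2
  exact fun j => ⟨right i (up i) j, up i j⟩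

/-- If the permutation matrices of `x` and `y` are transposes of each other, then the rows in which
the recording tableau of `y` grows are those in which the insertion tableau of `x` receives its
entries in increasing order. -/
theorem recWord_eq_partIns {n : ℕ} {x y : List ℕ} (hx : x.Nodup) (hy : y.Nodup)
    (hxn : x.length = n) (hyn : y.length = n) (hx0 : ∀ a ∈ x, 0 < a) (hy0 : ∀ a ∈ y, 0 < a)
    (hyle : ∀ a ∈ y, a ≤ n) (hxy : marks y = fun a b => marks x b a) (j : ℕ) (hj : j ≤ n) :
    recWord (y.take j) = partIns x n j := by
  induction j with
  | zero =>
    have : (x.take n).filter (· ≤ 0) = [] := by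
      rw [List.filter_eq_nil_iff]
      intro a ha
      have := hx0 a (List.mem_of_mem_take ha)
      simp; omega
    rw [partIns, this]
    rfl
  | succ j ih =>
    have hjy : j < y.length := by omega
    have h1 := (grows hy hy0 j n).1 hjy
    have h2 := (grows hx hx0 n j).2 hxn.ge
    rw [hxy, growth_flip] at h1
    have h3 : partIns y j n = insWord (y.take j) := by
      rw [partIns, List.filter_eq_self.2]
      intro a ha
      simpa using hyle a (List.mem_of_mem_take ha)
    have h4 := hyle _ (List.getElem_mem hjy)
    rcases hg : (growth (marks x) n (j + 1)).2 with _ | r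
    · simp only [Prod.fst_swap, hg, GrowsRight] at h1
      omega
    · simp only [Prod.fst_swap, hg, GrowsRight, GrowsUp, h3] at h1 h2
      rw [List.take_add_one, List.getElem?_eq_getElem hjy, Option.toList_some,
        recWord_append_singleton, h1.2, ih (by omega), h2.2.1, List.length_take,
        min_eq_left (by omega)]

/-- Inversion of the permutation exchanges the two tableaux. -/
theorem rs_inv_snd {n : ℕ} (σ : Equiv.Perm (Fin n)) : (rs σ⁻¹).2 = (rs σ).1 := by
  have hle : ∀ τ : Equiv.Perm (Fin n), ∀ a ∈ List.ofFn (oneLine τ), 0 < a ∧ a ≤ n := by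
    intro τ a ha
    obtain ⟨i, rfl⟩ := List.mem_ofFn.1 ha
    exact ⟨Nat.succ_pos _, (τ i).2⟩
  have hmarks : ∀ τ : Equiv.Perm (Fin n), ∀ a b, marks (List.ofFn (oneLine τ)) a b = true ↔
      ∃ (ha : a < n) (hb : b < n), τ ⟨a, ha⟩ = ⟨b, hb⟩ := by
    intro τ a b
    simp only [marks, decide_eq_true_eq, List.getElem?_eq_some_iff, List.length_ofFn,
      List.getElem_ofFn, oneLine, Nat.add_right_cancel_iff]
    constructor
    · rintro ⟨h1, h2⟩
      exact ⟨h1, h2 ▸ (τ ⟨a, h1⟩).2, Fin.ext h2⟩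
    · rintro ⟨h1, h2, h3⟩
      exact ⟨h1, by rw [h3]⟩
  have hxy : marks (List.ofFn (oneLine σ⁻¹)) = fun a b => marks (List.ofFn (oneLine σ)) b a := by
    funext a b
    rw [Bool.eq_iff_iff, hmarks, hmarks]
    constructor
    · rintro ⟨h1, h2, h3⟩
      exact ⟨h2, h1, by rw [← h3]; exact σ.apply_symm_apply _⟩
    · rintro ⟨h1, h2, h3⟩
      exact ⟨h2, h1, by rw [← h3]; exact σ.symm_apply_apply _⟩
  have := recWord_eq_partIns (n := n) (nodup_oneLine σ) (nodup_oneLine σ⁻¹) (by simp) (by simp)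
    (fun a ha => (hle σ a ha).1) (fun a ha => (hle _ a ha).1) (fun a ha => (hle _ a ha).2) hxy n le_rfl
  rw [rs_snd, rs_fst]
  rw [List.take_of_length_le (by simp), partIns, List.take_of_length_le (by simp),
    List.filter_eq_self.2 fun a ha => by simpa using (hle σ a ha).2] at this
  exact this

/-! ### Relabelling the entries -/

theorem addBox_map (g : ℕ → ℕ) (a : ℕ) (T : Tableau) : ∀ r,
    addBox (g a) r (T.map (List.map g)) = (addBox a r T).map (List.map g) := by
  induction T with
  | nil => intro r; simp [addBox]
  | cons R T ih =>
    intro r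
    cases r with
    | zero => simp [addBox]
    | succ r => simp [addBox, ih]

/-- If an entry of a row is smaller than an entry of a lower row, then it remains smaller when `f`
is applied. -/
def StrictBelow (f : ℕ → ℕ) (T : Tableau) : Prop :=
  T.Pairwise fun R S => ∀ x ∈ R, ∀ y ∈ S, x < y → f x < f y

/-- Insertion commutes with a weakly increasing relabelling, if the relabelled entries that are
equal to the inserted one come from smaller entries. -/
theorem insertTableau_map {f : ℕ → ℕ} {P : Set ℕ} (hf : MonotoneOn f P) {T : Tableau} :
    ∀ {x : ℕ}, (∀ b ∈ T.flatten, b ∈ P) → x ∈ P → (∀ R ∈ T, R.Pairwise (· < ·)) →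
      StrictBelow f T → (∀ y ∈ T.flatten, x < y → f x < f y) →
      insertTableau (f x) (T.map (List.map f)) =
          ((insertTableau x T).1.map (List.map f), (insertTableau x T).2) ∧
        StrictBelow f (insertTableau x T).1 := by
  induction T with
  | nil => intro x _ _ _ _ _; simp [insertTableau, StrictBelow]
  | cons R T ih =>
    intro x hP hx hT hS h
    rw [StrictBelow, List.pairwise_cons] at hS
    simp only [List.flatten_cons, List.mem_append] at hP h
    rcases insertTableau_cons_cases x R T with ⟨e, h5⟩ | ⟨A, y, B, rfl, e, h5, h6⟩
    · have e1 : ∀ a ∈ R.map f, a ≤ f x := by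
        intro a ha
        obtain ⟨b, hb, rfl⟩ := List.mem_map.1 ha
        exact hf (hP b (Or.inl hb)) hx (h5 b hb)
      rw [e, List.map_cons, insertTableau_cons_none _ (insertRow_of_forall_le e1)]
      refine ⟨by simp, List.pairwise_cons.2 ⟨fun S hS' a ha b hb hab => ?_, hS.2⟩⟩
      rcases List.mem_append.1 ha with ha | ha
      · exact hS.1 S hS' a ha b hb hab
      · obtain rfl := List.mem_singleton.1 ha
        exact h b (Or.inr (List.mem_flatten_of_mem hS' hb)) hab
    · have hyR : y ∈ A ++ y :: B := by simp
      have e1 : ∀ a ∈ A.map f, a ≤ f x := by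
        intro a ha
        obtain ⟨b, hb, rfl⟩ := List.mem_map.1 ha
        exact hf (hP b (Or.inl (by simp [hb]))) hx (h5 b hb)
      have hfxy := h y (Or.inl hyR) h6
      obtain ⟨ih1, ih2⟩ := ih (x := y) (fun b hb => hP b (Or.inr hb)) (hP y (Or.inl hyR))
        (fun S hS' => hT S (List.mem_cons_of_mem _ hS')) hS.2 (fun b hb hyb => by
          obtain ⟨S, hS', hbS⟩ := List.mem_flatten.1 hb
          exact hS.1 S hS' y hyR b hbS hyb)
      rw [e, List.map_cons, List.map_append, List.map_cons,
        insertTableau_cons_some _ (insertRow_append_cons (B.map f) e1 hfxy), ih1]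
      refine ⟨by simp, List.pairwise_cons.2 ⟨fun S hS' a ha b hb hab => ?_, ih2⟩⟩
      have hb' := (perm_flatten_insertTableau y T).mem_iff.1 (List.mem_flatten_of_mem hS' hb)
      have hrow := List.pairwise_append.1 (hT _ List.mem_cons_self)
      rcases List.mem_cons.1 hb' with rfl | hb'
      · rcases List.mem_append.1 ha with ha | ha
        · exact (hf (hP a (Or.inl (by simp [ha]))) hx (h5 a ha)).trans_lt hfxy
        · rcases List.mem_cons.1 ha with rfl | ha
          · exact hfxy
          · have := (List.pairwise_cons.1 hrow.2.1).1 a ha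
            omega
      · by_cases hax : a = x
        · subst hax
          exact h b (Or.inr hb') hab
        · obtain ⟨S', hS', hbS⟩ := List.mem_flatten.1 hb'
          refine hS.1 S' hS' a ?_ b hbS hab
          simp only [List.mem_append, List.mem_cons] at ha ⊢
          tauto

/-- RSK commutes with relabelling, if the labels of the second row are weakly increasing and equal
labels belong to an increasing subsequence. -/
theorem rskList_map {f g : ℕ → ℕ} {P : Set ℕ} (hf : MonotoneOn f P) (z : List (ℕ × ℕ)) :
    (z.map Prod.snd).Nodup → (∀ a ∈ z.map Prod.snd, a ∈ P) →
    (z.map Prod.snd).Pairwise (fun a b => b < a → f b < f a) →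
    rskList (z.map (Prod.map g f)) =
        ((rskList z).1.map (List.map f), (rskList z).2.map (List.map g)) ∧
      StrictBelow f (rskList z).1 := by
  induction z using List.reverseRecOn with
  | nil => intro _ _ _; simp [rskList, StrictBelow]
  | append_singleton z a ih =>
    intro hnd hP hpw
    rw [List.map_append, List.map_singleton] at hnd hP hpw
    rw [List.nodup_append] at hnd
    rw [List.pairwise_append] at hpw
    obtain ⟨ih1, ih2⟩ := ih hnd.1 (fun b hb => hP b (List.mem_append_left _ hb)) hpw.1
    have hmem : ∀ b, b ∈ (rskList z).1.flatten ↔ b ∈ z.map Prod.snd := fun b => by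
      rw [rskList_fst]
      exact (perm_flatten_insWord _).mem_iff
    obtain ⟨h1, h2⟩ := insertTableau_map hf (T := (rskList z).1) (x := a.2)
      (fun b hb => hP b (List.mem_append_left _ ((hmem b).1 hb))) (hP _ (by simp))
      (by rw [rskList_fst]; exact (std_insWord hnd.1).rows) ih2
      (fun y hy => hpw.2.2 y ((hmem y).1 hy) a.2 (by simp))
    rw [List.map_append, List.map_singleton, rskList_append_singleton, rskList_append_singleton, ih1]
    refine ⟨?_, h2⟩
    simp only [Prod.map_fst, Prod.map_snd, h1, addBox_map]

/-- The RSK tableaux of a two-line array are relabellings of the tableaux of the standardization of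
its second row. -/
theorem rsk_eq_relabel {n : ℕ} (u v : Fin n → ℕ) :
    rsk u v = (relabel (fun k => v ((standardization v)⁻¹ k)) (rs (standardization v)).1,
      relabel u (rs (standardization v)).2) := by
  set σ := standardization v with hσ
  set F : ℕ → ℕ := fun k => (List.ofFn fun k => v (σ⁻¹ k)).getD (k - 1) 0 with hF
  set G : ℕ → ℕ := fun k => (List.ofFn u).getD (k - 1) 0 with hG
  have hget : ∀ (t : Fin n → ℕ) (i : Fin n), (List.ofFn t).getD ((i : ℕ) + 1 - 1) 0 = t i := by
    intro t i
    rw [Nat.add_sub_cancel, List.getD_eq_getElem _ _ (by simp)]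
    simp
  have hmono : MonotoneOn F {a | 1 ≤ a ∧ a ≤ n} := by
    rintro a ⟨ha, ha'⟩ b ⟨hb, hb'⟩ hab
    have e : ∀ c, 1 ≤ c → ∀ hc : c - 1 < n, F c = v (σ⁻¹ ⟨c - 1, hc⟩) := by
      intro c _ hc
      simp only [hF]
      rw [List.getD_eq_getElem _ _ (by simpa using hc)]
      simp
    rw [e a ha (by omega), e b hb (by omega), hσ, standardization, inv_inv]
    exact Tuple.monotone_sort v (Fin.mk_le_mk.2 (by omega))
  have hsnd : (List.ofFn fun i : Fin n => ((i : ℕ) + 1, oneLine σ i)).map Prod.snd =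
      List.ofFn (oneLine σ) := by
    rw [List.map_ofFn]
    rfl
  have hz : (List.ofFn fun i : Fin n => ((i : ℕ) + 1, oneLine σ i)).map (Prod.map G F) =
      List.ofFn fun i => (u i, v i) := by
    rw [List.map_ofFn]
    congr 1
    funext i
    have h1 : G ((i : ℕ) + 1) = u i := hget u i
    have h2 : F (oneLine σ i) = v i := by
      refine (hget _ (σ i)).trans ?_
      congr 1
      exact σ.symm_apply_apply i
    simp [h1, h2]
  obtain ⟨h, -⟩ := rskList_map (f := F) (g := G) hmono
    (List.ofFn fun i : Fin n => ((i : ℕ) + 1, oneLine σ i)) (by rw [hsnd]; exact nodup_oneLine σ)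
    (by
      rw [hsnd]
      intro a ha
      obtain ⟨i, rfl⟩ := List.mem_ofFn.1 ha
      exact ⟨Nat.succ_pos _, (σ i).2⟩)
    (by
      rw [hsnd, List.pairwise_ofFn]
      intro i j hij hji
      have hlt : σ j < σ i := by
        unfold oneLine at hji
        exact Fin.lt_def.2 (by omega)
      have e : ∀ i, F (oneLine σ i) = v i := fun i =>
        (hget _ (σ i)).trans (congrArg v (σ.symm_apply_apply i))
      rw [e, e]
      rcases (standardization_lt_iff v j i).1 hlt with h | ⟨-, h⟩
      · exact h
      · exact absurd h hij.asymm)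
  rw [hz] at h
  exact h

end LittleRS

theorem mainTheorem5 (n : ℕ) (hn : 0 < n) :
    (∀ σ : Equiv.Perm (Fin n),
      LittleRS.IsReduced (LittleRS.rsWord σ) ∧
      (∀ T : LittleRS.Tableau,
        LittleRS.LS (LittleRS.rsWord σ) T ↔ T = (LittleRS.rs σ).2) ∧
      (∀ T : LittleRS.Tableau,
        LittleRS.LS (LittleRS.rsWord σ⁻¹) T ↔ T = (LittleRS.rs σ).1)) ∧
    (∀ u v : Fin n → ℕ, (Monotone fun i => toLex (u i, v i)) →
      ∃ P Q : LittleRS.Tableau,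
        LittleRS.LS (LittleRS.rsWord (LittleRS.standardization v)⁻¹) P ∧
        LittleRS.LS (LittleRS.rsWord (LittleRS.standardization v)) Q ∧
        LittleRS.rsk u v =
          (LittleRS.relabel (fun k => v ((LittleRS.standardization v)⁻¹ k)) P,
            LittleRS.relabel u Q)) := by
  refine ⟨fun σ => ⟨LittleRS.isReduced_rsWord σ, LittleRS.ls_rsWord_iff hn σ, fun T => ?_⟩,
    fun u v _ => ⟨_, _, ?_, (LittleRS.ls_rsWord_iff hn _ _).2 rfl, LittleRS.rsk_eq_relabel u v⟩⟩
  · rw [← LittleRS.rs_inv_snd]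
    exact LittleRS.ls_rsWord_iff hn σ⁻¹ T
  · exact (LittleRS.ls_rsWord_iff hn _ _).2 (LittleRS.rs_inv_snd _).symm
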